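/- Let $n\ge 2$ and let $F$ be a field containing a primitive $n$-th root of unity $\zeta$ (so $n\in F^\times$). Let $a,b\in F^\times$ be such that $z^n-a$ is irreducible over $F$, i.e. $L=F[\sqrt[n]{a}]$ is a cyclic Galois extension of $F$ of degree $n$, and let $$A=F\langle u,v\rangle/\langle u^n=a,\ v^n=b,\ uv=\zeta vu\rangle$$ be the associated cyclic algebra, a central simple $F$-algebra of degree $n$. For a commutative $F$-algebra $R$, a right ideal $I$ of $A_R=R\otimes_F A$ is said to have reduced dimension $i$ if $A_R/I$ is a locally free $R$-module of rank $n(n-i)$ (equivalently, $I$ is a direct summand of $A_R$ of rank $ni$). Let $Y$ be the functor that sends $R$ to the set of pairs $(I_1, I_{n-1})$ of right ideals of $A_R$ of reduced dimensions $1$ and $n-1$ such that $$I_1\subset I_{n-1}\quad\text{and}\quad uI_1\subset I_{n-1},$$ and acts on morphisms by extension of scalars. Then $Y$ is represented by a smooth variety over $F$: there is a separated, quasi-compact, smooth $F$-scheme $Y$ with $\operatorname{Hom}_F(\operatorname{Spec} R,Y)$ naturally identified with this set for every commutative $F$-algebra $R$. -/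

import Mathlib

open CategoryTheory AlgebraicGeometry TensorProduct

universe u

namespace TwistedMilnor

/-! ### The cyclic algebra -/

/-- The two generators `u` and `v` of the cyclic algebra. -/
inductive Gen : Type
  | u
  | v

/-- The defining relations `uⁿ = a`, `vⁿ = b`, `u v = ζ v u`. -/
inductive CyclicRel {F : Type u} [Field F] (n : ℕ) (ζ a b : F) :
    FreeAlgebra F Gen → FreeAlgebra F Gen → Prop
  | u_pow : CyclicRel n ζ a b (FreeAlgebra.ι F Gen.u ^ n) (algebraMap F _ a)
  | v_pow : CyclicRel n ζ a b (FreeAlgebra.ι F Gen.v ^ n) (algebraMap F _ b)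
  | comm : CyclicRel n ζ a b (FreeAlgebra.ι F Gen.u * FreeAlgebra.ι F Gen.v)
      (ζ • (FreeAlgebra.ι F Gen.v * FreeAlgebra.ι F Gen.u))

/-- The cyclic algebra `F⟨u, v⟩ / ⟨uⁿ = a, vⁿ = b, u v = ζ v u⟩`. -/
abbrev CyclicAlgebra {F : Type u} [Field F] (n : ℕ) (ζ a b : F) : Type u :=
  RingQuot (CyclicRel n ζ a b)

/-- The generator `u` of the cyclic algebra. -/
noncomputable def cyclicU {F : Type u} [Field F] (n : ℕ) (ζ a b : F) : CyclicAlgebra n ζ a b :=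
  RingQuot.mkAlgHom F (CyclicRel n ζ a b) (FreeAlgebra.ι F Gen.u)

/-! ### Base change of submodules -/

section BaseChange

variable {F : Type u} [Field F] {A : Type u} [Ring A] [Algebra F A]
  {R S : Type u} [CommRing R] [Algebra F R] [CommRing S] [Algebra F S]

/-- The ring homomorphism `R ⊗ A → S ⊗ A` induced by `R → S`. -/
noncomputable abbrev scalarMap (A : Type u) [Ring A] [Algebra F A] (f : R →ₐ[F] S) :
    R ⊗[F] A →ₐ[F] S ⊗[F] A :=
  Algebra.TensorProduct.map f (AlgHom.id F A)

/-- The base change of a point `I` of a Grassmannian of `A` along `R → S` is the `S`-submodule of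
`S ⊗ A` generated by the image of `I ⊆ R ⊗ A`. -/
theorem map_eq_span {k : ℕ} (f : R →ₐ[F] S) (I : Module.Grassmannian R (R ⊗[F] A) k) :
    (Module.Grassmannian.map f I).toSubmodule =
      Submodule.span S (scalarMap A f '' (I.toSubmodule : Set (R ⊗[F] A))) := by
  let _ : Algebra R S := f.toAlgebra
  let _ : IsScalarTower F R S :=
    IsScalarTower.of_algebraMap_eq' <| IsScalarTower.algebraMap_eq F R S
  rw [Module.Grassmannian.map_toSubmodule]
  have hker : LinearMap.ker (I.toSubmodule.mkQ.baseChange S) = I.toSubmodule.baseChange S := by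
    ext x
    have h := lTensor_exact S (LinearMap.exact_subtype_mkQ I.toSubmodule)
      (Submodule.mkQ_surjective _) x
    rw [LinearMap.mem_ker, Submodule.baseChange]
    exact h
  rw [Module.Grassmannian.baseChangeMkQ, LinearMap.ker_comp, hker, Submodule.baseChange_eq_span]
  have hmap : Submodule.comap
      (AlgebraTensorModule.cancelBaseChange F R S S A).symm.toLinearMap
      (Submodule.span S (I.toSubmodule.map (TensorProduct.mk R S (R ⊗[F] A) 1))) =
      Submodule.map (AlgebraTensorModule.cancelBaseChange F R S S A).toLinearMap
      (Submodule.span S (I.toSubmodule.map (TensorProduct.mk R S (R ⊗[F] A) 1))) :=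
    (Submodule.map_equiv_eq_comap_symm _ _).symm
  rw [hmap, Submodule.map_span]
  congr 1
  rw [Submodule.map_coe, Set.image_image]
  refine Set.image_congr fun x hx ↦ ?_
  clear hx
  induction x using TensorProduct.induction_on with
  | zero => simp
  | tmul r d => simp [Algebra.smul_def, RingHom.algebraMap_toAlgebra]
  | add x y hx hy => simp only [map_add, hx, hy]

/-- `I ⊆ R ⊗ A` is a right ideal. -/
def IsRightIdeal (I : Submodule R (R ⊗[F] A)) : Prop :=
  ∀ x ∈ I, ∀ c : R ⊗[F] A, x * c ∈ I

/-- `c I ⊆ J`, where `c ∈ A` acts on `R ⊗ A` by left multiplication with `1 ⊗ c`. -/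
def LeftMulLE (c : A) (I J : Submodule R (R ⊗[F] A)) : Prop :=
  ∀ x ∈ I, ((1 : R) ⊗ₜ[F] c) * x ∈ J

theorem IsRightIdeal.map {k : ℕ} (f : R →ₐ[F] S) {I : Module.Grassmannian R (R ⊗[F] A) k}
    (h : IsRightIdeal I.toSubmodule) :
    IsRightIdeal (Module.Grassmannian.map f I).toSubmodule := by
  rw [map_eq_span]
  intro x hx c
  induction hx using Submodule.span_induction with
  | mem x hx =>
    obtain ⟨y, hy, rfl⟩ := hx
    induction c using TensorProduct.induction_on with
    | zero => simp
    | tmul s d =>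
      have e : scalarMap A f y * (s ⊗ₜ[F] d) = s • scalarMap A f (y * ((1 : R) ⊗ₜ[F] d)) := by
        rw [map_mul, ← mul_smul_comm]
        simp [TensorProduct.smul_tmul']
      rw [e]
      exact Submodule.smul_mem _ _ (Submodule.subset_span ⟨_, h y hy _, rfl⟩)
    | add c d hc hd => rw [mul_add]; exact add_mem hc hd
  | zero => simp
  | add x y _ _ hx hy => rw [add_mul]; exact add_mem hx hy
  | smul s x _ hx => rw [smul_mul_assoc]; exact Submodule.smul_mem _ _ hx

theorem LeftMulLE.map {k l : ℕ} (f : R →ₐ[F] S) {c : A}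
    {I : Module.Grassmannian R (R ⊗[F] A) k} {J : Module.Grassmannian R (R ⊗[F] A) l}
    (h : LeftMulLE c I.toSubmodule J.toSubmodule) :
    LeftMulLE c (Module.Grassmannian.map f I).toSubmodule
      (Module.Grassmannian.map f J).toSubmodule := by
  rw [map_eq_span, map_eq_span]
  intro x hx
  induction hx using Submodule.span_induction with
  | mem x hx =>
    obtain ⟨y, hy, rfl⟩ := hx
    exact Submodule.subset_span ⟨_, h y hy, by simp⟩
  | zero => simp
  | add x y _ _ hx hy => rw [mul_add]; exact add_mem hx hy
  | smul s x _ hx => rw [mul_smul_comm]; exact Submodule.smul_mem _ _ hx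

theorem le_map {k l : ℕ} (f : R →ₐ[F] S)
    {I : Module.Grassmannian R (R ⊗[F] A) k} {J : Module.Grassmannian R (R ⊗[F] A) l}
    (h : I.toSubmodule ≤ J.toSubmodule) :
    (Module.Grassmannian.map f I).toSubmodule ≤ (Module.Grassmannian.map f J).toSubmodule := by
  rw [map_eq_span, map_eq_span]
  exact Submodule.span_mono (Set.image_mono h)

end BaseChange

/-! ### The twisted Milnor hypersurface and its hyperplane section -/

section Flags

variable (F : Type u) [Field F]

/-- Let `A` be an `F`-algebra of dimension `n ^ 2`. An `R`-point of the variety of right ideals of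
reduced dimension `i` of `A`: a right ideal `I` of `R ⊗ A` whose quotient is locally free over `R`
of rank `n * (n - i)`. Such an `I` is a direct summand of `R ⊗ A`, locally free of rank `n * i`. -/
structure RightIdeal (A : Type u) [Ring A] [Algebra F A] (n i : ℕ)
    (R : Type u) [CommRing R] [Algebra F R] extends
    Module.Grassmannian R (R ⊗[F] A) (n * (n - i)) where
  isRightIdeal : IsRightIdeal toSubmodule

theorem RightIdeal.ext {F : Type u} [Field F] {A : Type u} [Ring A] [Algebra F A] {n i : ℕ}
    {R : Type u} [CommRing R] [Algebra F R] {I J : RightIdeal F A n i R}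
    (h : I.toGrassmannian = J.toGrassmannian) : I = J := by
  cases I; cases J; congr

/-- Extension of scalars of right ideals along `R → S`. -/
noncomputable def RightIdeal.map {F : Type u} [Field F] {A : Type u} [Ring A] [Algebra F A] {n i : ℕ}
    {R S : Type u} [CommRing R] [Algebra F R] [CommRing S] [Algebra F S] (f : R →ₐ[F] S)
    (I : RightIdeal F A n i R) : RightIdeal F A n i S where
  toGrassmannian := Module.Grassmannian.map f I.toGrassmannian
  isRightIdeal := I.isRightIdeal.map f

/-- An `R`-point of the twisted Milnor hypersurface `X`: right ideals `I ⊆ J` of `R ⊗ A` of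
reduced dimensions `1` and `n - 1`. -/
@[ext]
structure FlagPoint (A : Type u) [Ring A] [Algebra F A] (n : ℕ)
    (R : Type u) [CommRing R] [Algebra F R] where
  I : RightIdeal F A n 1 R
  J : RightIdeal F A n (n - 1) R
  le : I.toSubmodule ≤ J.toSubmodule

namespace FlagPoint

variable {F} {A : Type u} [Ring A] [Algebra F A] {n : ℕ}
  {R S T : Type u} [CommRing R] [Algebra F R] [CommRing S] [Algebra F S] [CommRing T] [Algebra F T]

/-- Extension of scalars of flags of right ideals along `R → S`. -/
noncomputable def map (f : R →ₐ[F] S) (p : FlagPoint F A n R) : FlagPoint F A n S where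
  I := p.I.map f
  J := p.J.map f
  le := le_map f p.le

theorem map_id (p : FlagPoint F A n R) : p.map (AlgHom.id F R) = p :=
  FlagPoint.ext (RightIdeal.ext (Module.Grassmannian.map_id _ (.of F R) p.I.toGrassmannian))
    (RightIdeal.ext (Module.Grassmannian.map_id _ (.of F R) p.J.toGrassmannian))

theorem map_comp (f : R →ₐ[F] S) (g : S →ₐ[F] T) (p : FlagPoint F A n R) :
    p.map (g.comp f) = (p.map f).map g :=
  FlagPoint.ext (RightIdeal.ext (Module.Grassmannian.map_comp _ f g p.I.toGrassmannian))
    (RightIdeal.ext (Module.Grassmannian.map_comp _ f g p.J.toGrassmannian))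

end FlagPoint

/-- An `R`-point `(I ⊆ J)` of the twisted Milnor hypersurface `X` such that `c I ⊆ J`. -/
@[ext]
structure SectionPoint (A : Type u) [Ring A] [Algebra F A] (n : ℕ) (c : A)
    (R : Type u) [CommRing R] [Algebra F R] where
  flag : FlagPoint F A n R
  leftMulLE : LeftMulLE c flag.I.toSubmodule flag.J.toSubmodule

/-- Extension of scalars along `R → S`. -/
noncomputable def SectionPoint.map {F : Type u} [Field F] {A : Type u} [Ring A] [Algebra F A]
    {n : ℕ} {c : A} {R S : Type u} [CommRing R] [Algebra F R] [CommRing S] [Algebra F S]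
    (f : R →ₐ[F] S) (p : SectionPoint F A n c R) : SectionPoint F A n c S where
  flag := p.flag.map f
  leftMulLE := LeftMulLE.map f p.leftMulLE

/-- The functor of points of the hyperplane section `Y = {(I ⊆ J) ∈ X : c I ⊆ J}` of `X`, for an
element `c` of `A`. -/
noncomputable def hyperplaneSection (A : Type u) [Ring A] [Algebra F A] (n : ℕ) (c : A) :
    CommAlgCat.{u} F ⥤ Type u where
  obj R := SectionPoint F A n c R
  map f := ↾fun p ↦ p.map f.hom
  map_id _ := ConcreteCategory.hom_ext _ _ fun p ↦ SectionPoint.ext p.flag.map_id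
  map_comp f g := ConcreteCategory.hom_ext _ _ fun p ↦
    SectionPoint.ext (p.flag.map_comp f.hom g.hom)

end Flags

/-! ### Functor of points of a scheme over `F` -/

section Points

variable {F : Type u} [Field F]

/-- The functor `R ↦ Hom_F(Spec R, Y)` of an `F`-scheme `s : Y ⟶ Spec F` on commutative
`F`-algebras. -/
noncomputable def schemePoints {Y : Scheme.{u}} (s : Y ⟶ Spec (.of F)) :
    CommAlgCat.{u} F ⥤ Type u where
  obj R := {y : Spec (.of R) ⟶ Y // y ≫ s = Spec.map (CommRingCat.ofHom (algebraMap F R))}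
  map f := ↾fun y ↦ ⟨Spec.map (CommRingCat.ofHom f.hom.toRingHom) ≫ y.1, by
    rw [Category.assoc, y.2, ← Spec.map_comp, ← CommRingCat.ofHom_comp]
    congr 2
    exact f.hom.comp_algebraMap⟩
  map_id R := by
    ext y
    exact (congrArg (· ≫ y.1) (Spec.map_id _)).trans (Category.id_comp _)
  map_comp f g := by
    ext y
    exact (congrArg (· ≫ y.1) (Spec.map_comp (CommRingCat.ofHom f.hom.toRingHom)
      (CommRingCat.ofHom g.hom.toRingHom))).trans (Category.assoc _ _ _)

/-- The `F`-scheme `s : Y ⟶ Spec F` represents the functor `P` on commutative `F`-algebras. By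
Yoneda, since schemes are glued from affine ones, `P` then determines `Y` up to a unique
isomorphism over `F`. -/
def Represents {Y : Scheme.{u}} (s : Y ⟶ Spec (.of F)) (P : CommAlgCat.{u} F ⥤ Type u) : Prop :=
  Nonempty (schemePoints s ≅ P)

end Points

end TwistedMilnor

/-! Representability is the standard gluing of Grassmannian charts; the content specific to the
cyclic algebra is smoothness.

On a chart where prescribed basis vectors of `A` form bases of the two quotients, a point is a pair
of normalized matrices. The conditions (right ideals, `I ⊆ J`, `u I ⊆ J`) are polynomial in the
entries, and two charts meet where certain minors are invertible. This gives a finite affine atlas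
(`sectionAtlas`) of a Zariski sheaf (`hyperplaneSection_isZariskiSheaf`), so the functor is that of
the glued scheme (`AffineAtlas.represents`). Finiteness of the atlas gives quasi-compactness.
Separatedness is the valuative criterion: over a domain, a submodule with projective quotient is
recovered from its extension to the fraction field.

For smoothness, the charts are finitely presented, so it suffices to lift points from `R/N` to `R`
when `N² = 0` (`IsSymbol.exists_lift`). As `n` is invertible, averaging a linear projection over the
powers of `v` and `u` makes it right `A`-linear; hence the two ideals are `eA` and `(1 - g)A` for
idempotents, which lift to `R`. The incidence conditions read `ge = 0` and `gue = 0`, and hold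
modulo `N`. Conjugating `e` by `1 + x` and `g` by `1 + y`, with `x, y` in `N A_R`, changes `ge` and
`gue` to first order by `g(x - y)e` and `g(ux - yu)e`. So this linear map has to be onto `(gAe)²`,
which by Nakayama may be checked over residue fields (`exists_correction_of_residue`).

Over a field `gAe` is a line. If the map is not onto, a linear relation between its components
forces `gu = lg` and `ue = le` with the same `l ≠ 0`. Moving `u` across in `g u v^j e` gives `g v^j
e = 0` unless `n ∣ j`, in which case `v^j` is a scalar and `ge = 0` applies. Hence `gAe = 0`,
contradicting that the algebra is prime (`surjective_of_mul_eq_zero`). -/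

namespace TwistedMilnor

/-! ### Zariski sheaves on `F`-algebras and their comparison through atlases -/

section ZariskiSheaf

variable {F : Type u} [Field F]

/-- The localization map `R → R[1/r]`, as a morphism of commutative `F`-algebras. -/
noncomputable abbrev awayMap (R : CommAlgCat.{u} F) (r : R) :
    R ⟶ CommAlgCat.of F (Localization.Away r) :=
  CommAlgCat.ofHom (IsScalarTower.toAlgHom F R (Localization.Away r))

theorem awayMap_isUnit (R : CommAlgCat.{u} F) (r : R) : IsUnit ((awayMap R r).hom r) :=
  IsLocalization.Away.algebraMap_isUnit (S := Localization.Away r) r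

/-- A morphism inverting `r` factors through `R[1/r]`. -/
theorem exists_awayMap_comp_eq {R S : CommAlgCat.{u} F} (r : R) (g : R ⟶ S)
    (h : IsUnit (g.hom r)) : ∃ g' : CommAlgCat.of F (Localization.Away r) ⟶ S,
      awayMap R r ≫ g' = g := by
  have hg (y : Submonoid.powers r) : IsUnit (g.hom y) := by
    obtain ⟨_, m, rfl⟩ := y
    simpa using h.pow m
  refine ⟨CommAlgCat.ofHom (IsLocalization.liftAlgHom (M := Submonoid.powers r)
    (S := Localization.Away r) (f := g.hom) hg), ?_⟩
  ext x
  exact IsLocalization.lift_eq _ x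

theorem awayMap_hom_ext {R S : CommAlgCat.{u} F} (r : R)
    {g h : CommAlgCat.of F (Localization.Away r) ⟶ S} (e : awayMap R r ≫ g = awayMap R r ≫ h) :
    g = h := by
  ext x
  exact congr($(e).hom x)

/-- The Zariski sheaf condition for a functor on commutative `F`-algebras. -/
structure IsZariskiSheaf (P : CommAlgCat.{u} F ⥤ Type u) : Prop where
  sep : ∀ (R : CommAlgCat.{u} F) (s : Set R), Ideal.span s = ⊤ → ∀ p q : P.obj R,
    (∀ r ∈ s, P.map (awayMap R r) p = P.map (awayMap R r) q) → p = q
  glue : ∀ (R : CommAlgCat.{u} F) (s : Set R), s.Finite → Ideal.span s = ⊤ →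
    ∀ p : ∀ r : s, P.obj (CommAlgCat.of F (Localization.Away r.1)),
    (∀ (r r' : s) (S : CommAlgCat.{u} F) (a : CommAlgCat.of F (Localization.Away r.1) ⟶ S)
      (b : CommAlgCat.of F (Localization.Away r'.1) ⟶ S),
      awayMap R r.1 ≫ a = awayMap R r'.1 ≫ b → P.map a (p r) = P.map b (p r')) →
    ∃ q, ∀ r : s, P.map (awayMap R r.1) q = p r

/-- Zariski locally, every element of `P` comes from one of the elements `ξ i ∈ P (B i)`. -/
def Covers {ι : Type u} (P : CommAlgCat.{u} F ⥤ Type u) (B : ι → CommAlgCat.{u} F)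
    (ξ : ∀ i, P.obj (B i)) : Prop :=
  ∀ (R : CommAlgCat.{u} F) (p : P.obj R), ∃ s : Set R, s.Finite ∧ Ideal.span s = ⊤ ∧
    ∀ r : s, ∃ (i : ι) (g : B i ⟶ CommAlgCat.of F (Localization.Away r.1)),
      P.map (awayMap R r.1) p = P.map g (ξ i)

/-- The elements `r` chosen at all primes lie in no common maximal ideal, so finitely many of them
already generate the unit ideal. -/
theorem covers_of_forall_prime {ι : Type u} {P : CommAlgCat.{u} F ⥤ Type u}
    {B : ι → CommAlgCat.{u} F} {ξ : ∀ i, P.obj (B i)}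
    (h : ∀ (R : CommAlgCat.{u} F) (p : P.obj R) (x : PrimeSpectrum R), ∃ r : R, r ∉ x.asIdeal ∧
      ∃ (i : ι) (g : B i ⟶ CommAlgCat.of F (Localization.Away r)),
        P.map (awayMap R r) p = P.map g (ξ i)) : Covers P B ξ := by
  intro R p
  choose f hf H using h R p
  have hspan : Ideal.span (Set.range f) = ⊤ := by
    by_contra hne
    obtain ⟨m, hm, hle⟩ := Ideal.exists_le_maximal _ hne
    exact hf ⟨m, hm.isPrime⟩ (hle (Ideal.subset_span ⟨_, rfl⟩))
  obtain ⟨t, ht, htop⟩ := (Ideal.span_eq_top_iff_finite _).1 hspan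
  refine ⟨t, t.finite_toSet, htop, fun r ↦ ?_⟩
  obtain ⟨r, hr⟩ := r
  obtain ⟨x, rfl⟩ := ht hr
  exact H x

/-- The relation between the elements of two functors with atlases indexed by the same rings
that sends a local chart of the first to the same local chart of the second. -/
def ChartRel {ι : Type u} {P Q : CommAlgCat.{u} F ⥤ Type u} {B : ι → CommAlgCat.{u} F}
    (ξ : ∀ i, P.obj (B i)) (η : ∀ i, Q.obj (B i)) {R : CommAlgCat.{u} F}
    (p : P.obj R) (q : Q.obj R) : Prop :=
  ∀ (i : ι) (S : CommAlgCat.{u} F) (φ : R ⟶ S) (g : B i ⟶ S),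
    P.map φ p = P.map g (ξ i) → Q.map φ q = Q.map g (η i)

theorem span_image_hom {R S : CommAlgCat.{u} F} (φ : R ⟶ S) {s : Set R}
    (hs : Ideal.span s = ⊤) : Ideal.span (φ.hom '' s) = ⊤ := by
  have := congr_arg (Ideal.map φ.hom) hs
  rwa [Ideal.map_span, Ideal.map_top] at this

/-- The map `R[1/r] → S[1/φ(r)]` induced by `φ : R → S`. -/
theorem exists_awayMap_comm {R S : CommAlgCat.{u} F} (φ : R ⟶ S) (r : R) :
    ∃ c : CommAlgCat.of F (Localization.Away r) ⟶ CommAlgCat.of F (Localization.Away (φ.hom r)),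
      awayMap R r ≫ c = φ ≫ awayMap S (φ.hom r) :=
  exists_awayMap_comp_eq r _ (awayMap_isUnit S (φ.hom r))

section Compare

variable {ι : Type u} {P Q : CommAlgCat.{u} F ⥤ Type u} {B : ι → CommAlgCat.{u} F}
  {ξ : ∀ i, P.obj (B i)} {η : ∀ i, Q.obj (B i)}

theorem ChartRel.map {R S : CommAlgCat.{u} F} {p : P.obj R} {q : Q.obj R}
    (h : ChartRel ξ η p q) (φ : R ⟶ S) : ChartRel ξ η (P.map φ p) (Q.map φ q) := by
  intro i T ψ g e
  rw [← Functor.map_comp_apply] at e ⊢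
  exact h i T _ g e

/-- Locally `p` lies in a chart, which prescribes the restriction of `q`; separatedness of `Q` does
the rest. -/
theorem ChartRel.unique (hQ : IsZariskiSheaf Q) (hξ : Covers P B ξ)
    {R : CommAlgCat.{u} F} {p : P.obj R} {q q' : Q.obj R}
    (h : ChartRel ξ η p q) (h' : ChartRel ξ η p q') : q = q' := by
  obtain ⟨s, -, hs, H⟩ := hξ R p
  refine hQ.sep R s hs _ _ fun r hr ↦ ?_
  obtain ⟨i, g, hg⟩ := H ⟨r, hr⟩
  rw [h i _ _ g hg, h' i _ _ g hg]

variable (H : ∀ (i j : ι) (S : CommAlgCat.{u} F) (g : B i ⟶ S) (h : B j ⟶ S),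
  P.map g (ξ i) = P.map h (ξ j) ↔ Q.map g (η i) = Q.map h (η j))

include H

/-- Write `p` locally as a pullback of some `ξ i` and glue the corresponding pullbacks of `η i`; by
`H` they agree on overlaps because those of `ξ` do. -/
theorem ChartRel.exists_right (hQ : IsZariskiSheaf Q) (hξ : Covers P B ξ)
    {R : CommAlgCat.{u} F} (p : P.obj R) : ∃ q : Q.obj R, ChartRel ξ η p q := by
  obtain ⟨s, hfin, hs, hsp⟩ := hξ R p
  choose k g hg using hsp
  obtain ⟨q, hq⟩ := hQ.glue R s hfin hs (fun r ↦ Q.map (g r) (η (k r))) (by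
    intro r r' S a b hab
    rw [← Functor.map_comp_apply, ← Functor.map_comp_apply, ← H, Functor.map_comp_apply,
      Functor.map_comp_apply, ← hg, ← hg, ← Functor.map_comp_apply, ← Functor.map_comp_apply, hab])
  -- The relation must hold after every base change `φ`; it is tested on the cover of `S` induced
  -- from that of `R`, where `q` is known.
  refine ⟨q, fun i S φ h e ↦ hQ.sep S _ (span_image_hom φ hs) _ _ ?_⟩
  rintro _ ⟨r, hr, rfl⟩
  obtain ⟨c, hc⟩ := exists_awayMap_comm φ r
  have hq := hq ⟨r, hr⟩
  have hg := hg ⟨r, hr⟩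
  dsimp only at hq hg
  rw [← Functor.map_comp_apply, ← hc, Functor.map_comp_apply, hq, ← Functor.map_comp_apply,
    ← Functor.map_comp_apply, ← H, Functor.map_comp_apply, ← hg, ← Functor.map_comp_apply, hc,
    Functor.map_comp_apply, e, ← Functor.map_comp_apply]

/-- Where `p` lies in a chart `j`, `q` is the same point of the chart `j` of `Q`; an equality of `q`
with a point of the chart `i` is then one between charts, which `H` carries back to `P`. -/
theorem ChartRel.symm (hP : IsZariskiSheaf P) (hξ : Covers P B ξ)
    {R : CommAlgCat.{u} F} {p : P.obj R} {q : Q.obj R} (h : ChartRel ξ η p q) :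
    ChartRel η ξ q p := by
  intro i S φ g e
  obtain ⟨s, -, hs, hsp⟩ := hξ R p
  refine hP.sep S _ (span_image_hom φ hs) _ _ ?_
  rintro _ ⟨r, hr, rfl⟩
  obtain ⟨c, hc⟩ := exists_awayMap_comm φ r
  obtain ⟨j, g', hg'⟩ := hsp ⟨r, hr⟩
  have h1 := h j _ _ g' hg'
  dsimp only at hg' h1
  rw [← Functor.map_comp_apply, ← hc, Functor.map_comp_apply, hg', ← Functor.map_comp_apply,
    ← Functor.map_comp_apply, H, Functor.map_comp_apply, ← h1, ← Functor.map_comp_apply, hc,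
    Functor.map_comp_apply, e, ← Functor.map_comp_apply]

/-- Two Zariski sheaves with atlases by the same rings, glued in the same way, are isomorphic. -/
theorem nonempty_iso_of_atlas (hP : IsZariskiSheaf P) (hQ : IsZariskiSheaf Q)
    (hξ : Covers P B ξ) (hη : Covers Q B η) : Nonempty (Q ≅ P) := by
  have H' := fun i j S g h ↦ (H i j S g h).symm
  choose f hf using fun (R : CommAlgCat.{u} F) (q : Q.obj R) ↦ ChartRel.exists_right H' hP hη q
  choose f' hf' using fun (R : CommAlgCat.{u} F) (p : P.obj R) ↦ ChartRel.exists_right H hQ hξ p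
  refine ⟨NatIso.ofComponents (fun R ↦ Equiv.toIso ⟨f R, f' R, fun q ↦ ?_, fun p ↦ ?_⟩) ?_⟩
  · exact (hf' R _).unique hQ hξ ((hf R q).symm H' hQ hη)
  · exact (hf R _).unique hP hη ((hf' R p).symm H hP hξ)
  · intro R S φ
    ext q
    exact (hf S _).unique hP hη ((hf R q).map φ)

end Compare

end ZariskiSheaf

/-! ### The functor of points of a scheme as a Zariski sheaf -/

section SchemePoints

variable {F : Type u} [Field F]

/-- The morphism `Spec S → Spec R` attached to a morphism `R → S` of commutative `F`-algebras. -/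
noncomputable abbrev specMap {R S : CommAlgCat.{u} F} (f : R ⟶ S) :
    Spec (.of S) ⟶ Spec (.of R) :=
  Spec.map (CommRingCat.ofHom f.hom.toRingHom)

theorem specMap_comp {R S T : CommAlgCat.{u} F} (f : R ⟶ S) (g : S ⟶ T) :
    specMap (f ≫ g) = specMap g ≫ specMap f :=
  Spec.map_comp (CommRingCat.ofHom f.hom.toRingHom) (CommRingCat.ofHom g.hom.toRingHom)

theorem specMap_id (R : CommAlgCat.{u} F) : specMap (𝟙 R) = 𝟙 _ := Spec.map_id _

theorem specMap_comp_algebraMap {R S : CommAlgCat.{u} F} (f : R ⟶ S) :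
    specMap f ≫ Spec.map (CommRingCat.ofHom (algebraMap F R)) =
      Spec.map (CommRingCat.ofHom (algebraMap F S)) := by
  rw [← Spec.map_comp, ← CommRingCat.ofHom_comp]
  congr 2
  exact f.hom.comp_algebraMap

theorem exists_specMap_eq {R S : CommAlgCat.{u} F} (y : Spec (.of S) ⟶ Spec (.of R))
    (h : y ≫ Spec.map (CommRingCat.ofHom (algebraMap F R)) =
      Spec.map (CommRingCat.ofHom (algebraMap F S))) : ∃ f : R ⟶ S, specMap f = y := by
  obtain ⟨g, rfl⟩ := Spec.map_surjective y
  rw [← Spec.map_comp, Spec.map_inj] at h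
  refine ⟨CommAlgCat.ofHom ⟨g.hom, fun r ↦ congr($(h) r)⟩, rfl⟩

variable {Y : Scheme.{u}} (s : Y ⟶ Spec (.of F))

theorem schemePoints_map_val {R S : CommAlgCat.{u} F} (f : R ⟶ S) (y : (schemePoints s).obj R) :
    ((schemePoints s).map f y).1 = specMap f ≫ y.1 := rfl

/-- Morphisms of schemes glue along the open cover of `Spec R` by basic opens. For the overlaps it
suffices to test compatibility on the tensor product of the two localizations, whose spectrum is the
fibre product. -/
theorem schemePoints_isZariskiSheaf : IsZariskiSheaf (schemePoints s) where
  sep R t ht p q h := by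
    have ht' : Ideal.span (Set.range ((↑) : t → R)) = ⊤ := by rwa [Subtype.range_coe]
    refine Subtype.ext ((Scheme.affineOpenCoverOfSpanRangeEqTop (R := .of R)
      ((↑) : t → R) ht').openCover.hom_ext _ _ fun r ↦ ?_)
    exact congr_arg Subtype.val (h r.1 r.2)
  glue R t _ ht p h := by
    have ht' : Ideal.span (Set.range ((↑) : t → R)) = ⊤ := by rwa [Subtype.range_coe]
    let 𝒰 := (Scheme.affineOpenCoverOfSpanRangeEqTop (R := .of R) ((↑) : t → R) ht').openCover
    have key (r r' : t) : Limits.pullback.fst (𝒰.f r) (𝒰.f r') ≫ (p r).1 =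
        Limits.pullback.snd (𝒰.f r) (𝒰.f r') ≫ (p r').1 := by
      refine (cancel_epi
        (pullbackSpecIso R (Localization.Away r.1) (Localization.Away r'.1)).inv).1 ?_
      have h1 := pullbackSpecIso_inv_fst_assoc R (Localization.Away r.1) (Localization.Away r'.1)
        (p r).1
      have h2 := pullbackSpecIso_inv_snd_assoc R (Localization.Away r.1) (Localization.Away r'.1)
        (p r').1
      refine h1.trans (.trans ?_ h2.symm)
      refine congr_arg Subtype.val (h r r'
        (CommAlgCat.of F (Localization.Away r.1 ⊗[R] Localization.Away r'.1))
        (CommAlgCat.ofHom Algebra.TensorProduct.includeLeft)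
        (CommAlgCat.ofHom (Algebra.TensorProduct.includeRight.restrictScalars F)) ?_)
      ext x
      exact (Algebra.TensorProduct.algebraMap_apply x).symm.trans
        (Algebra.TensorProduct.algebraMap_apply' x)
    refine ⟨⟨𝒰.glueMorphisms (fun r ↦ (p r).1) key, ?_⟩, fun r ↦ ?_⟩
    · refine 𝒰.hom_ext _ _ fun r ↦ ?_
      refine (Scheme.Cover.ι_glueMorphisms_assoc 𝒰 _ key r s).trans ?_
      exact (p r).2.trans (specMap_comp_algebraMap (awayMap R r.1)).symm
    · exact Subtype.ext (Scheme.Cover.ι_glueMorphisms 𝒰 _ key r)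

/-- If the open subschemes `Spec (B i)` cover `Y`, every point of `Y` locally factors through one
of them. -/
theorem schemePoints_covers {ι : Type u} (B : ι → CommAlgCat.{u} F)
    (η : ∀ i, (schemePoints s).obj (B i)) [∀ i, IsOpenImmersion (η i).1]
    (hη : ∀ y : Y, ∃ i, y ∈ Set.range (η i).1) : Covers (schemePoints s) B η := by
  refine covers_of_forall_prime fun R p x ↦ ?_
  obtain ⟨i, hi⟩ := hη (p.1 x)
  have hopen : IsOpen (p.1 ⁻¹' Set.range (η i).1) :=
    (η i).1.isOpenEmbedding.isOpen_range.preimage p.1.continuous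
  obtain ⟨_, ⟨r, rfl⟩, hxr, hr⟩ :=
    PrimeSpectrum.isTopologicalBasis_basic_opens.exists_subset_of_mem_open
      (show x ∈ p.1 ⁻¹' Set.range (η i).1 from hi) hopen
  refine ⟨r, hxr, i, ?_⟩
  -- `D(r)` maps into the open image of the chart `i`, so the restricted morphism lifts through the
  -- open immersion.
  have hsub : Set.range (specMap (awayMap R r) ≫ p.1) ⊆ Set.range (η i).1 := by
    rintro _ ⟨z, rfl⟩
    have hz : specMap (awayMap R r) z ∈ PrimeSpectrum.basicOpen r := by
      have := PrimeSpectrum.localization_away_comap_range (Localization.Away r) r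
      exact this.le ⟨z, rfl⟩
    exact hr hz
  obtain ⟨g, hg⟩ := exists_specMap_eq (R := B i)
    (S := CommAlgCat.of F (Localization.Away r)) (IsOpenImmersion.lift (η i).1 _ hsub) (by
      refine (congr_arg (_ ≫ ·) (η i).2.symm).trans ?_
      refine (IsOpenImmersion.lift_fac_assoc (η i).1 _ hsub s).trans ?_
      exact (Category.assoc _ _ _).trans ((congr_arg (_ ≫ ·) p.2).trans
        (specMap_comp_algebraMap _)))
  refine ⟨g, Subtype.ext ?_⟩
  rw [schemePoints_map_val, schemePoints_map_val, hg]
  exact (IsOpenImmersion.lift_fac _ _ _).symm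

end SchemePoints

/-! ### Gluing data from an affine atlas -/

section Atlas

variable {F : Type u} [Field F]

/-- An atlas of a functor on commutative `F`-algebras by affine schemes, whose pairwise
intersections are the basic open subschemes `D(f i j) ⊆ Spec (B i)`. -/
structure AffineAtlas (P : CommAlgCat.{u} F ⥤ Type u) (ι : Type u) where
  /-- The coordinate ring of a chart. -/
  B : ι → CommAlgCat.{u} F
  /-- The universal element of a chart. -/
  ξ : ∀ i, P.obj (B i)
  /-- The equation of the complement of the chart `j` in the chart `i`. -/
  f : ∀ i, ι → B i
  inj : ∀ (i : ι) (R : CommAlgCat.{u} F) (g h : B i ⟶ R), P.map g (ξ i) = P.map h (ξ i) → g = h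
  isUnit_iff : ∀ (i j : ι) (R : CommAlgCat.{u} F) (g : B i ⟶ R),
    IsUnit (g.hom (f i j)) ↔ ∃ h : B j ⟶ R, P.map g (ξ i) = P.map h (ξ j)
  covers : Covers P B ξ

namespace AffineAtlas

variable {P : CommAlgCat.{u} F ⥤ Type u} {ι : Type u} (𝒜 : AffineAtlas P ι)

/-- The coordinate ring of the intersection of two charts. -/
noncomputable abbrev B₂ (i j : ι) : CommAlgCat.{u} F := CommAlgCat.of F (Localization.Away (𝒜.f i j))

/-- Over `D(f i j)` the element `ξ i` also lies in the chart `j`, which gives a map out of `B j`; it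
inverts `f j i` because the same element lies in the chart `i`. -/
theorem exists_transition (i j : ι) : ∃ h : 𝒜.B₂ j i ⟶ 𝒜.B₂ i j,
    P.map (awayMap (𝒜.B i) (𝒜.f i j)) (𝒜.ξ i) =
      P.map (awayMap (𝒜.B j) (𝒜.f j i) ≫ h) (𝒜.ξ j) := by
  obtain ⟨h, hh⟩ := (𝒜.isUnit_iff i j _ (awayMap (𝒜.B i) (𝒜.f i j))).1 (awayMap_isUnit _ _)
  obtain ⟨h', rfl⟩ := exists_awayMap_comp_eq (𝒜.f j i) h ((𝒜.isUnit_iff j i _ h).2 ⟨_, hh.symm⟩)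
  exact ⟨h', hh⟩

/-- The identification of the intersections of two charts. -/
noncomputable def transition (i j : ι) : 𝒜.B₂ j i ⟶ 𝒜.B₂ i j := (𝒜.exists_transition i j).choose

theorem map_transition (i j : ι) : P.map (awayMap (𝒜.B j) (𝒜.f j i) ≫ 𝒜.transition i j) (𝒜.ξ j) =
    P.map (awayMap (𝒜.B i) (𝒜.f i j)) (𝒜.ξ i) :=
  (𝒜.exists_transition i j).choose_spec.symm

/-- Maps out of an overlap are detected by the elements of `P` that they define, so identities
between transition maps are checked in `P`. -/
theorem transition_hom_ext {i j : ι} {R : CommAlgCat.{u} F} {g h : 𝒜.B₂ i j ⟶ R}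
    (e : P.map (awayMap (𝒜.B i) (𝒜.f i j) ≫ g) (𝒜.ξ i) =
      P.map (awayMap (𝒜.B i) (𝒜.f i j) ≫ h) (𝒜.ξ i)) : g = h :=
  awayMap_hom_ext _ (𝒜.inj _ _ _ _ e)

theorem transition_self (i : ι) : 𝒜.transition i i = 𝟙 _ := by
  apply transition_hom_ext
  rw [map_transition, Category.comp_id]

theorem transition_comp (i j : ι) : 𝒜.transition j i ≫ 𝒜.transition i j = 𝟙 _ := by
  apply transition_hom_ext
  rw [← Category.assoc, Functor.map_comp_apply, map_transition, ← Functor.map_comp_apply,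
    map_transition, Category.comp_id]

/-- The coordinate ring of the intersection of three charts. -/
noncomputable abbrev B₃ (i j k : ι) : CommAlgCat.{u} F :=
  CommAlgCat.of F (Localization.Away (𝒜.f i j) ⊗[𝒜.B i] Localization.Away (𝒜.f i k))

/-- The inclusion of the triple intersection into the first double intersection. -/
noncomputable abbrev inl (i j k : ι) : 𝒜.B₂ i j ⟶ 𝒜.B₃ i j k :=
  CommAlgCat.ofHom Algebra.TensorProduct.includeLeft

/-- The inclusion of the triple intersection into the second double intersection. -/
noncomputable abbrev inr (i j k : ι) : 𝒜.B₂ i k ⟶ 𝒜.B₃ i j k :=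
  CommAlgCat.ofHom (Algebra.TensorProduct.includeRight.restrictScalars F)

theorem awayMap_inl_eq (i j k : ι) : awayMap (𝒜.B i) (𝒜.f i j) ≫ 𝒜.inl i j k =
    awayMap (𝒜.B i) (𝒜.f i k) ≫ 𝒜.inr i j k := by
  ext x
  exact (Algebra.TensorProduct.algebraMap_apply x).symm.trans
    (Algebra.TensorProduct.algebraMap_apply' x)

/-- Both sides are the restriction of `ξ i` to the triple intersection. -/
theorem map_inl_eq_map_inr (i j k : ι) :
    P.map (awayMap (𝒜.B j) (𝒜.f j i) ≫ 𝒜.transition i j ≫ 𝒜.inl i j k) (𝒜.ξ j) =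
    P.map (awayMap (𝒜.B k) (𝒜.f k i) ≫ 𝒜.transition i k ≫ 𝒜.inr i j k) (𝒜.ξ k) := by
  rw [← Category.assoc, ← Category.assoc, Functor.map_comp_apply, map_transition,
    Functor.map_comp_apply, map_transition, ← Functor.map_comp_apply, ← Functor.map_comp_apply,
    awayMap_inl_eq]

theorem exists_triple (i j k : ι) : ∃ θ : 𝒜.B₂ j k ⟶ 𝒜.B₃ i j k,
    awayMap (𝒜.B j) (𝒜.f j k) ≫ θ =
      awayMap (𝒜.B j) (𝒜.f j i) ≫ 𝒜.transition i j ≫ 𝒜.inl i j k :=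
  exists_awayMap_comp_eq _ _
    ((𝒜.isUnit_iff j k _ _).2 ⟨_, 𝒜.map_inl_eq_map_inr i j k⟩)

/-- The map from the triple intersection to a double intersection not contained in its first
chart. -/
noncomputable def triple (i j k : ι) : 𝒜.B₂ j k ⟶ 𝒜.B₃ i j k := (𝒜.exists_triple i j k).choose

theorem awayMap_triple (i j k : ι) : awayMap (𝒜.B j) (𝒜.f j k) ≫ 𝒜.triple i j k =
    awayMap (𝒜.B j) (𝒜.f j i) ≫ 𝒜.transition i j ≫ 𝒜.inl i j k :=
  (𝒜.exists_triple i j k).choose_spec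

theorem awayMap_transition_triple (i j k : ι) :
    awayMap (𝒜.B k) (𝒜.f k j) ≫ 𝒜.transition j k ≫ 𝒜.triple i j k =
    awayMap (𝒜.B k) (𝒜.f k i) ≫ 𝒜.transition i k ≫ 𝒜.inr i j k := by
  apply 𝒜.inj
  rw [← Category.assoc, Functor.map_comp_apply, map_transition, ← Functor.map_comp_apply,
    awayMap_triple, map_inl_eq_map_inr]

/-- The inclusion of the intersection of two charts into the first. -/
noncomputable abbrev glueF (i j : ι) : Spec (.of (𝒜.B₂ i j)) ⟶ Spec (.of (𝒜.B i)) :=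
  Spec.map (CommRingCat.ofHom (algebraMap (𝒜.B i) (Localization.Away (𝒜.f i j))))

/-- The map from the triple intersection to a double intersection not contained in its first
chart. -/
noncomputable def glueL (i j k : ι) :
    Limits.pullback (𝒜.glueF i j) (𝒜.glueF i k) ⟶ Spec (.of (𝒜.B₂ j k)) :=
  (pullbackSpecIso (𝒜.B i) (Localization.Away (𝒜.f i j)) (Localization.Away (𝒜.f i k))).hom ≫
    specMap (𝒜.triple i j k)

theorem fst_eq (i j k : ι) : Limits.pullback.fst (𝒜.glueF i j) (𝒜.glueF i k) =
    (pullbackSpecIso (𝒜.B i) (Localization.Away (𝒜.f i j)) (Localization.Away (𝒜.f i k))).hom ≫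
      specMap (𝒜.inl i j k) :=
  (pullbackSpecIso_hom_fst _ _ _).symm

theorem snd_eq (i j k : ι) : Limits.pullback.snd (𝒜.glueF i j) (𝒜.glueF i k) =
    (pullbackSpecIso (𝒜.B i) (Localization.Away (𝒜.f i j)) (Localization.Away (𝒜.f i k))).hom ≫
      specMap (𝒜.inr i j k) :=
  (pullbackSpecIso_hom_snd _ _ _).symm

theorem glueL_glueF (i j k : ι) : 𝒜.glueL i j k ≫ 𝒜.glueF j k =
    (Limits.pullback.fst (𝒜.glueF i j) (𝒜.glueF i k) ≫ specMap (𝒜.transition i j)) ≫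
      𝒜.glueF j i := by
  rw [fst_eq, glueL]
  simp only [Category.assoc]
  refine congr_arg (_ ≫ ·) ?_
  refine (specMap_comp (awayMap (𝒜.B j) (𝒜.f j k)) (𝒜.triple i j k)).symm.trans ?_
  rw [awayMap_triple, specMap_comp, specMap_comp, Category.assoc]
  rfl

theorem glueL_transition (i j k : ι) :
    𝒜.glueL i j k ≫ specMap (𝒜.transition j k) ≫ 𝒜.glueF k j =
    Limits.pullback.snd (𝒜.glueF i j) (𝒜.glueF i k) ≫ specMap (𝒜.transition i k) ≫
      𝒜.glueF k i := by
  rw [snd_eq, glueL]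
  simp only [Category.assoc]
  refine congr_arg (_ ≫ ·) ?_
  have := congr_arg specMap (𝒜.awayMap_transition_triple i j k)
  rw [specMap_comp, specMap_comp, specMap_comp, specMap_comp, Category.assoc, Category.assoc]
    at this
  exact this

/-- The gluing isomorphisms on triple intersections. -/
noncomputable def glueT' (i j k : ι) : Limits.pullback (𝒜.glueF i j) (𝒜.glueF i k) ⟶
    Limits.pullback (𝒜.glueF j k) (𝒜.glueF j i) :=
  Limits.pullback.lift (𝒜.glueL i j k)
    (Limits.pullback.fst (𝒜.glueF i j) (𝒜.glueF i k) ≫ specMap (𝒜.transition i j))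
    (𝒜.glueL_glueF i j k)

theorem glueT'_fst (i j k : ι) : 𝒜.glueT' i j k ≫ Limits.pullback.fst _ _ = 𝒜.glueL i j k :=
  Limits.pullback.lift_fst _ _ _

theorem glueT'_snd (i j k : ι) : 𝒜.glueT' i j k ≫ Limits.pullback.snd _ _ =
    Limits.pullback.fst _ _ ≫ specMap (𝒜.transition i j) :=
  Limits.pullback.lift_snd _ _ _

theorem specMap_transition_comp (i j : ι) :
    specMap (𝒜.transition i j) ≫ specMap (𝒜.transition j i) = 𝟙 _ := by
  rw [← specMap_comp, transition_comp, specMap_id]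

/-- It is enough to compare the maps to the chart `i`, since the pullback embeds there. Three
rotations then collapse through `transition_comp`. -/
theorem glueT'_cocycle (i j k : ι) :
    𝒜.glueT' i j k ≫ 𝒜.glueT' j k i ≫ 𝒜.glueT' k i j = 𝟙 _ := by
  rw [← cancel_mono (Limits.pullback.fst (𝒜.glueF i j) (𝒜.glueF i k)),
    ← cancel_mono (𝒜.glueF i j)]
  simp only [Category.assoc]
  rw [Limits.pullback.condition, reassoc_of% 𝒜.glueT'_snd k i j, reassoc_of% 𝒜.glueT'_fst j k i,
    glueL_transition, reassoc_of% 𝒜.glueT'_snd i j k, reassoc_of% 𝒜.specMap_transition_comp i j,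
    Category.id_comp, Limits.pullback.condition]

theorem isUnit_f_self (i : ι) : IsUnit (𝒜.f i i) :=
  (𝒜.isUnit_iff i i _ (𝟙 _)).2 ⟨𝟙 _, rfl⟩

theorem isIso_glueF_self (i : ι) : IsIso (𝒜.glueF i i) := by
  have : IsIso (CommRingCat.ofHom (algebraMap (𝒜.B i) (Localization.Away (𝒜.f i i)))) := by
    rw [ConcreteCategory.isIso_iff_bijective]
    exact (IsLocalization.atUnit _ (Localization.Away (𝒜.f i i)) _ (𝒜.isUnit_f_self i)).bijective
  infer_instance

/-- The gluing datum attached to an affine atlas. -/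
noncomputable def glueData : Scheme.GlueData.{u} where
  J := ι
  U i := Spec (.of (𝒜.B i))
  V ij := Spec (.of (𝒜.B₂ ij.1 ij.2))
  f i j := 𝒜.glueF i j
  f_id := 𝒜.isIso_glueF_self
  t i j := specMap (𝒜.transition i j)
  t_id i := by rw [transition_self]; exact specMap_id _
  t' := 𝒜.glueT'
  t_fac := 𝒜.glueT'_snd
  cocycle := 𝒜.glueT'_cocycle
  f_open i j := by dsimp only; infer_instance

end AffineAtlas

end Atlas

/-! ### The glued scheme: representability, smoothness, quasi-compactness, separatedness -/

section Atlas

variable {F : Type u} [Field F] {P : CommAlgCat.{u} F ⥤ Type u} {ι : Type u}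

namespace AffineAtlas

variable (𝒜 : AffineAtlas P ι)

/-- The inclusion of a chart into the glued scheme. -/
noncomputable def chart (i : ι) : Spec (.of (𝒜.B i)) ⟶ 𝒜.glueData.glued := 𝒜.glueData.ι i

instance (i : ι) : IsOpenImmersion (𝒜.chart i) := 𝒜.glueData.ι_isOpenImmersion i

theorem exists_mem_range_chart (y : 𝒜.glueData.glued) : ∃ i, y ∈ Set.range (𝒜.chart i) :=
  𝒜.glueData.ι_jointly_surjective y

theorem glueF_chart (i j : ι) : specMap (𝒜.transition i j) ≫ 𝒜.glueF j i ≫ 𝒜.chart j =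
    𝒜.glueF i j ≫ 𝒜.chart i :=
  𝒜.glueData.glue_condition i j

/-- The glued overlap is the fibre product of the two charts over the glued scheme. -/
theorem exists_lift_of_chart_eq {i j : ι} {T : Scheme.{u}} (a : T ⟶ Spec (.of (𝒜.B i)))
    (b : T ⟶ Spec (.of (𝒜.B j))) (h : a ≫ 𝒜.chart i = b ≫ 𝒜.chart j) :
    ∃ c : T ⟶ Spec (.of (𝒜.B₂ i j)), c ≫ 𝒜.glueF i j = a ∧
      c ≫ specMap (𝒜.transition i j) ≫ 𝒜.glueF j i = b :=
  ⟨Limits.PullbackCone.IsLimit.lift (𝒜.glueData.vPullbackConeIsLimit i j) a b h,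
    Limits.PullbackCone.IsLimit.lift_fst (𝒜.glueData.vPullbackConeIsLimit i j) a b h,
    Limits.PullbackCone.IsLimit.lift_snd (𝒜.glueData.vPullbackConeIsLimit i j) a b h⟩

/-- The open cover of the glued scheme by the charts. -/
noncomputable def cover : 𝒜.glueData.glued.OpenCover := 𝒜.glueData.openCover

theorem glueF_base (i j : ι) :
    𝒜.glueF i j ≫ Spec.map (CommRingCat.ofHom (algebraMap F (𝒜.B i))) =
      Spec.map (CommRingCat.ofHom (algebraMap F (𝒜.B₂ i j))) :=
  specMap_comp_algebraMap (awayMap (𝒜.B i) (𝒜.f i j))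

/-- The structure morphism of the glued scheme. -/
noncomputable def structureMap : 𝒜.glueData.glued ⟶ Spec (.of F) :=
  𝒜.cover.glueMorphisms (fun i : ι ↦ Spec.map (CommRingCat.ofHom (algebraMap F (𝒜.B i)))) (by
    intro (i : ι) (j : ι)
    obtain ⟨c, h1, h2⟩ := 𝒜.exists_lift_of_chart_eq
      (Limits.pullback.fst (𝒜.chart i) (𝒜.chart j)) (Limits.pullback.snd (𝒜.chart i) (𝒜.chart j))
      Limits.pullback.condition
    change Limits.pullback.fst (𝒜.chart i) (𝒜.chart j) ≫ _ =
      Limits.pullback.snd (𝒜.chart i) (𝒜.chart j) ≫ _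
    rw [← h1, ← h2]
    simp only [Category.assoc]
    rw [glueF_base, glueF_base]
    exact congr_arg (c ≫ ·) (specMap_comp_algebraMap (𝒜.transition i j)).symm)

theorem chart_structureMap (i : ι) : 𝒜.chart i ≫ 𝒜.structureMap =
    Spec.map (CommRingCat.ofHom (algebraMap F (𝒜.B i))) :=
  Scheme.Cover.ι_glueMorphisms 𝒜.cover _ _ i

/-- Each side says that `g` factors through the overlap and that `h` is obtained from it by the
transition map. This is the hypothesis that `nonempty_iso_of_atlas` needs. -/
theorem map_eq_iff_chart_eq (i j : ι) (S : CommAlgCat.{u} F) (g : 𝒜.B i ⟶ S) (h : 𝒜.B j ⟶ S) :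
    P.map g (𝒜.ξ i) = P.map h (𝒜.ξ j) ↔
      specMap g ≫ 𝒜.chart i = specMap h ≫ 𝒜.chart j := by
  constructor
  · intro e
    obtain ⟨g', rfl⟩ := exists_awayMap_comp_eq (𝒜.f i j) g ((𝒜.isUnit_iff i j S g).2 ⟨h, e⟩)
    have hh : h = awayMap (𝒜.B j) (𝒜.f j i) ≫ 𝒜.transition i j ≫ g' := by
      apply 𝒜.inj
      rw [← e, ← Category.assoc, Functor.map_comp_apply, Functor.map_comp_apply _ _ g',
        map_transition]
    rw [hh, specMap_comp, specMap_comp, specMap_comp]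
    simp only [Category.assoc]
    exact congr_arg (specMap g' ≫ ·) (𝒜.glueF_chart i j).symm
  · intro e
    obtain ⟨c, h1, h2⟩ := 𝒜.exists_lift_of_chart_eq _ _ e
    obtain ⟨c, rfl⟩ := exists_specMap_eq (R := 𝒜.B₂ i j) c (by
      rw [← glueF_base, reassoc_of% h1, specMap_comp_algebraMap])
    have h1' : awayMap (𝒜.B i) (𝒜.f i j) ≫ c = g := by
      apply CommAlgCat.hom_ext
      apply AlgHom.coe_ringHom_injective
      have := (specMap_comp (awayMap (𝒜.B i) (𝒜.f i j)) c).trans h1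
      exact congr_arg CommRingCat.Hom.hom (Spec.map_injective this)
    have h2' : awayMap (𝒜.B j) (𝒜.f j i) ≫ 𝒜.transition i j ≫ c = h := by
      apply CommAlgCat.hom_ext
      apply AlgHom.coe_ringHom_injective
      have h3 : specMap (awayMap (𝒜.B j) (𝒜.f j i) ≫ 𝒜.transition i j ≫ c) = specMap h := by
        rw [specMap_comp, specMap_comp, Category.assoc]
        exact h2
      exact congr_arg CommRingCat.Hom.hom (Spec.map_injective h3)
    rw [← h1', ← h2', ← Category.assoc, Functor.map_comp_apply, Functor.map_comp_apply _ _ c,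
      map_transition]

/-- A Zariski sheaf with an affine atlas is represented by the glued scheme. -/
theorem represents (hP : IsZariskiSheaf P) : Represents 𝒜.structureMap P := by
  let η (i : ι) : (schemePoints 𝒜.structureMap).obj (𝒜.B i) := ⟨𝒜.chart i, 𝒜.chart_structureMap i⟩
  have (i : ι) : IsOpenImmersion (η i).1 := inferInstanceAs (IsOpenImmersion (𝒜.chart i))
  refine nonempty_iso_of_atlas (ξ := 𝒜.ξ) (η := η) (fun i j S g h ↦ ?_) hP
    (schemePoints_isZariskiSheaf _) 𝒜.covers
    (schemePoints_covers _ _ _ 𝒜.exists_mem_range_chart)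
  refine (𝒜.map_eq_iff_chart_eq i j S g h).trans ⟨fun e ↦ Subtype.ext e, fun e ↦ ?_⟩
  exact congr_arg Subtype.val e

theorem smooth_structureMap (h : ∀ i, Algebra.Smooth F (𝒜.B i)) : Smooth 𝒜.structureMap := by
  have : IsZariskiLocalAtSource @Smooth.{u} :=
    HasRingHomProperty.instIsZariskiLocalAtSource (Q := RingHom.Smooth)
  rw [IsZariskiLocalAtSource.iff_of_openCover (P := @Smooth) 𝒜.cover]
  intro (i : ι)
  have e : 𝒜.cover.f i ≫ 𝒜.structureMap = _ := 𝒜.chart_structureMap i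
  rw [e]
  exact (HasRingHomProperty.Spec_iff (P := @Smooth)).2 (RingHom.smooth_algebraMap.2 (h i))

theorem quasiCompact_structureMap [Finite ι] : QuasiCompact 𝒜.structureMap := by
  rw [quasiCompact_iff_compactSpace]
  have : Finite 𝒜.cover.I₀ := ‹Finite ι›
  have (i : 𝒜.cover.I₀) : CompactSpace (𝒜.cover.X i) :=
    inferInstanceAs (CompactSpace (Spec (.of (𝒜.B i))))
  exact Scheme.OpenCover.compactSpace 𝒜.cover

end AffineAtlas

/-- A scheme representing a functor `P` is separated if `P(R) → P(K)` is injective for all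
valuation rings `R` with field of fractions `K`. -/
theorem isSeparated_of_represents {Y : Scheme.{u}} (s : Y ⟶ Spec (.of F)) [Smooth s]
    (h : Represents s P)
    (hP : ∀ (R K : Type u) [CommRing R] [IsDomain R] [CommRing K] [Algebra F R] [Algebra F K]
      [Algebra R K] [IsScalarTower F R K] [IsFractionRing R K],
      Function.Injective (P.map (CommAlgCat.ofHom (IsScalarTower.toAlgHom F R K)))) :
    IsSeparated s := by
  -- This supplies the quasi-separatedness that the valuative criterion requires.
  have : IsLocallyNoetherian Y := LocallyOfFiniteType.isLocallyNoetherian s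
  refine IsSeparated.of_valuativeCriterion s fun S ↦ ⟨fun a b ↦ ?_⟩
  obtain ⟨e⟩ := h
  obtain ⟨g, hg⟩ := Spec.map_surjective S.i₂
  let _ : Algebra F S.R := g.hom.toAlgebra
  let _ : Algebra F S.K := ((algebraMap S.R S.K).comp g.hom).toAlgebra
  have : IsScalarTower F S.R S.K := IsScalarTower.of_algebraMap_eq' rfl
  let f : CommAlgCat.of F S.R ⟶ CommAlgCat.of F S.K :=
    CommAlgCat.ofHom (IsScalarTower.toAlgHom F S.R S.K)
  let pa : (schemePoints s).obj (CommAlgCat.of F S.R) := ⟨a.l, a.fac_right.trans hg.symm⟩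
  let pb : (schemePoints s).obj (CommAlgCat.of F S.R) := ⟨b.l, b.fac_right.trans hg.symm⟩
  have hab : (schemePoints s).map f pa = (schemePoints s).map f pb :=
    Subtype.ext (a.fac_left.trans b.fac_left.symm)
  have hpp : e.hom.app _ pa = e.hom.app _ pb := by
    apply hP S.R S.K
    rw [← NatTrans.naturality_apply, ← NatTrans.naturality_apply, hab]
  have : pa = pb := by
    have := congr_arg (e.inv.app _) hpp
    simpa using this
  exact CommSq.LiftStruct.ext (congr_arg Subtype.val this)

end Atlas

/-! ### Zariski descent for points of the Grassmannian -/

section GrassmannianSheaf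

theorem mem_localized'_iff {R M N : Type*} (T : Type*) [CommRing R] [CommRing T] [Algebra R T]
    [AddCommGroup M] [Module R M] [AddCommGroup N] [Module R N] [Module T N] [IsScalarTower R T N]
    (S : Submonoid R) [IsLocalization S T] (f : M →ₗ[R] N) [IsLocalizedModule S f]
    (I : Submodule R M) (x : M) : f x ∈ I.localized' T S f ↔ ∃ m ∈ S, m • x ∈ I := by
  constructor
  · rintro ⟨y, hy, t, e⟩
    rw [IsLocalizedModule.mk'_eq_iff, Submonoid.smul_def, ← map_smul] at e
    obtain ⟨c, hc⟩ := IsLocalizedModule.exists_of_eq (S := S) e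
    refine ⟨c * t, (c * t).2, ?_⟩
    rw [mul_smul, ← Submonoid.smul_def, ← hc]
    exact I.smul_mem _ hy
  · rintro ⟨m, hm, h⟩
    exact ⟨m • x, h, ⟨m, hm⟩, by rw [IsLocalizedModule.mk'_eq_iff, map_smul]; rfl⟩

variable {F : Type u} [Field F] {A : Type u} [Ring A] [Algebra F A]
  {R S T : Type u} [CommRing R] [Algebra F R] [CommRing S] [Algebra F S] [CommRing T] [Algebra F T]

section Algebra

variable [Algebra R S] [IsScalarTower F R S]

variable (A R S) in
/-- The `R`-linear map `R ⊗ A → S ⊗ A` for an `R`-algebra `S`. -/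
noncomputable def scalarMapₗ : R ⊗[F] A →ₗ[R] S ⊗[F] A :=
  AlgebraTensorModule.map (Algebra.linearMap R S) LinearMap.id

theorem scalarMapₗ_apply (x : R ⊗[F] A) :
    scalarMapₗ A R S x = scalarMap A (IsScalarTower.toAlgHom F R S) x := by
  induction x using TensorProduct.induction_on with
  | zero => simp
  | tmul r a => simp [scalarMapₗ]
  | add x y hx hy => simp only [map_add, hx, hy]

variable (A R S) in
theorem scalarMapₗ_isBaseChange : IsBaseChange S (scalarMapₗ (F := F) A R S) := by
  refine IsBaseChange.of_equiv (AlgebraTensorModule.cancelBaseChange F R S S A) fun x ↦ ?_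
  induction x using TensorProduct.induction_on with
  | zero => simp
  | tmul r a => simp [scalarMapₗ, Algebra.smul_def]
  | add x y hx hy => simp only [map_add, tmul_add, hx, hy]

instance scalarMapₗ_isLocalizedModule (M : Submonoid R) [IsLocalization M S] :
    IsLocalizedModule M (scalarMapₗ (F := F) A R S) :=
  (isLocalizedModule_iff_isBaseChange M S _).2 (scalarMapₗ_isBaseChange A R S)

theorem map_eq_localized' {k : ℕ} (M : Submonoid R) [IsLocalization M S]
    (I : Module.Grassmannian R (R ⊗[F] A) k) :
    (Module.Grassmannian.map (IsScalarTower.toAlgHom F R S) I).toSubmodule =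
      I.toSubmodule.localized' S M (scalarMapₗ A R S) := by
  rw [map_eq_span, Submodule.localized'_eq_span]
  congr 1

theorem mem_map_localization_iff {k : ℕ} (M : Submonoid R) [IsLocalization M S]
    (I : Module.Grassmannian R (R ⊗[F] A) k) (x : R ⊗[F] A) :
    scalarMap A (IsScalarTower.toAlgHom F R S) x ∈
      (Module.Grassmannian.map (IsScalarTower.toAlgHom F R S) I).toSubmodule ↔
      ∃ m ∈ M, m • x ∈ I.toSubmodule := by
  rw [map_eq_localized' M, ← scalarMapₗ_apply, mem_localized'_iff]

end Algebra

theorem scalarMap_mem_map {k : ℕ} (f : R →ₐ[F] S) (I : Module.Grassmannian R (R ⊗[F] A) k)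
    {x : R ⊗[F] A} (hx : x ∈ I.toSubmodule) :
    scalarMap A f x ∈ (Module.Grassmannian.map f I).toSubmodule := by
  rw [map_eq_span]
  exact Submodule.subset_span ⟨x, hx, rfl⟩

theorem scalarMap_comp (f : R →ₐ[F] S) (g : S →ₐ[F] T) (x : R ⊗[F] A) :
    scalarMap A (g.comp f) x = scalarMap A g (scalarMap A f x) := by
  induction x using TensorProduct.induction_on with
  | zero => simp
  | tmul r a => simp
  | add x y hx hy => simp only [map_add, hx, hy]

theorem mem_iff_forall_away {k : ℕ} {s : Set R} (hs : Ideal.span s = ⊤)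
    (I : Module.Grassmannian R (R ⊗[F] A) k) (x : R ⊗[F] A) :
    x ∈ I.toSubmodule ↔ ∀ r ∈ s,
      scalarMap A (IsScalarTower.toAlgHom F R (Localization.Away r)) x ∈
      (Module.Grassmannian.map (IsScalarTower.toAlgHom F R (Localization.Away r)) I).toSubmodule := by
  refine ⟨fun h r _ ↦ scalarMap_mem_map _ _ h, fun h ↦ ?_⟩
  refine Submodule.mem_of_isLocalized_span s hs _
    (fun r : s ↦ scalarMapₗ (F := F) A R (Localization.Away r.1)) fun r ↦ ?_
  have := h r.1 r.2
  rw [map_eq_localized' (Submonoid.powers r.1), ← scalarMapₗ_apply] at this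
  exact this

theorem grassmannian_sep {k : ℕ} {s : Set R} (hs : Ideal.span s = ⊤)
    {I J : Module.Grassmannian R (R ⊗[F] A) k}
    (h : ∀ r ∈ s, Module.Grassmannian.map (IsScalarTower.toAlgHom F R (Localization.Away r)) I =
      Module.Grassmannian.map (IsScalarTower.toAlgHom F R (Localization.Away r)) J) : I = J := by
  apply Module.Grassmannian.ext
  ext x
  rw [mem_iff_forall_away hs, mem_iff_forall_away hs]
  exact forall₂_congr fun r hr ↦ by rw [h r hr]

/-- The glued submodule `N` consists of the elements whose image lies in every `I r`. Its
localizations are the given ones because an element of `I r` enters each `I r'` after multiplication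
by a power of `r`, and the cover is finite. -/
theorem grassmannian_glue {k : ℕ} {s : Set R} (hfin : s.Finite) (hs : Ideal.span s = ⊤)
    (I : ∀ r : s, Module.Grassmannian (Localization.Away r.1) (Localization.Away r.1 ⊗[F] A) k)
    (h : ∀ (r r' : s) (S : CommAlgCat.{u} F) (a : Localization.Away r.1 →ₐ[F] S)
      (b : Localization.Away r'.1 →ₐ[F] S),
      a.comp (IsScalarTower.toAlgHom F R _) = b.comp (IsScalarTower.toAlgHom F R _) →
      Module.Grassmannian.map a (I r) = Module.Grassmannian.map b (I r')) :
    ∃ J : Module.Grassmannian R (R ⊗[F] A) k, ∀ r : s,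
      Module.Grassmannian.map (IsScalarTower.toAlgHom F R (Localization.Away r.1)) J = I r := by
  have := hfin.to_subtype
  let ψ (r : s) := scalarMapₗ (F := F) A R (Localization.Away r.1)
  let N : Submodule R (R ⊗[F] A) := ⨅ r : s, ((I r).toSubmodule.restrictScalars R).comap (ψ r)
  have hN (x : R ⊗[F] A) : x ∈ N ↔ ∀ r, ψ r x ∈ (I r).toSubmodule := by simp [N]
  have key (r r' : s) (x : R ⊗[F] A) (hx : ψ r x ∈ (I r).toSubmodule) :
      -- The overlap is taken as `R[1/r'][1/r]`, where `I r` and `I r'` agree; clearing the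
      -- denominators gives a power of `r`.
      ∃ m : ℕ, ψ r' (r.1 ^ m • x) ∈ (I r').toSubmodule := by
    let ρ := algebraMap R (Localization.Away r'.1) r.1
    let b : Localization.Away r'.1 →ₐ[F] Localization.Away ρ := IsScalarTower.toAlgHom F _ _
    obtain ⟨a, ha⟩ := exists_awayMap_comp_eq (R := CommAlgCat.of F R)
      (S := CommAlgCat.of F (Localization.Away ρ)) r.1
      (CommAlgCat.ofHom (b.comp (IsScalarTower.toAlgHom F R _)))
      (IsLocalization.Away.algebraMap_isUnit (S := Localization.Away ρ) ρ)
    have ha' : a.hom.comp (IsScalarTower.toAlgHom F R (Localization.Away r.1)) =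
      b.comp (IsScalarTower.toAlgHom F R _) := congr_arg CommAlgCat.Hom.hom ha
    have h1 := scalarMap_mem_map a.hom (I r) hx
    have h2 := h r r' (CommAlgCat.of F (Localization.Away ρ)) a.hom b ha'
    rw [h2, scalarMapₗ_apply, ← scalarMap_comp, ha', scalarMap_comp,
      mem_map_localization_iff (Submonoid.powers ρ)] at h1
    obtain ⟨_, ⟨m, rfl⟩, hm⟩ := h1
    refine ⟨m, ?_⟩
    rw [map_smul]
    simpa [ρ, ψ, scalarMapₗ_apply, ← map_pow] using hm
  have hloc (r : s) : N.localized' (Localization.Away r.1) (Submonoid.powers r.1) (ψ r) =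
      (I r).toSubmodule := by
    apply le_antisymm
    · rw [Submodule.localized'_eq_span, Submodule.span_le]
      rintro _ ⟨x, hx, rfl⟩
      exact (hN x).1 hx r
    · intro y hy
      obtain ⟨⟨x, t⟩, rfl⟩ := IsLocalizedModule.mk'_surjective (Submonoid.powers r.1) (ψ r) y
      have hx : ψ r x ∈ (I r).toSubmodule := by
        have := (I r).toSubmodule.smul_mem (algebraMap R (Localization.Away r.1) t) hy
        rw [algebraMap_smul] at this
        rwa [Function.uncurry_apply_pair, ← Submonoid.smul_def, IsLocalizedModule.mk'_cancel']
          at this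
      choose m hm using fun r' ↦ key r r' x hx
      obtain ⟨M, hM⟩ := Finite.exists_le m
      have hxN : r.1 ^ M • x ∈ N := by
        rw [hN]
        intro r'
        rw [← Nat.sub_add_cancel (hM r'), pow_add, mul_smul, map_smul]
        rw [← algebraMap_smul (Localization.Away r'.1)]
        exact (I r').toSubmodule.smul_mem _ (hm r')
      have : ψ r x ∈ N.localized' (Localization.Away r.1) (Submonoid.powers r.1) (ψ r) :=
        (mem_localized'_iff _ _ _ _ _).2 ⟨_, ⟨M, rfl⟩, hxN⟩
      have h3 := Submodule.smul_mem _ (IsLocalization.mk' (Localization.Away r.1) 1 t) this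
      rwa [← IsLocalizedModule.mk'_one (Submonoid.powers r.1) (ψ r) x,
        IsLocalizedModule.mk'_smul_mk', one_smul, mul_one] at h3
  have hfp (r : s) : Module.Finite (Localization.Away r.1) ((Localization.Away r.1 ⊗[F] A) ⧸
      N.localized' (Localization.Away r.1) (Submonoid.powers r.1) (ψ r)) := by
    rw [hloc]; exact (I r).finite_quotient
  have hproj (r : s) : Module.Projective (Localization.Away r.1) ((Localization.Away r.1 ⊗[F] A) ⧸
      N.localized' (Localization.Away r.1) (Submonoid.powers r.1) (ψ r)) := by
    rw [hloc]; exact (I r).projective_quotient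
  have hrank (r : s) (p) : Module.rankAtStalk (R := Localization.Away r.1)
      ((Localization.Away r.1 ⊗[F] A) ⧸
      N.localized' (Localization.Away r.1) (Submonoid.powers r.1) (ψ r)) p = k := by
    rw [hloc]; exact (I r).rankAtStalk_eq p
  -- Projectivity descends as finite presentation plus flatness, each of which is local for the
  -- Zariski topology.
  have hfp' : Module.FinitePresentation R ((R ⊗[F] A) ⧸ N) :=
    Module.FinitePresentation.of_localizationSpan' (Rₚ := fun r : s ↦ Localization.Away r.1) s hs
      (fun r ↦ N.toLocalizedQuotient' (Localization.Away r.1) (Submonoid.powers r.1) (ψ r))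
      (fun r ↦ Module.finitePresentation_of_projective _ _)
  have hflat : Module.Flat R ((R ⊗[F] A) ⧸ N) := by
    refine Module.flat_of_isLocalized_span R _ s hs _
      (fun r ↦ N.toLocalizedQuotient' (Localization.Away r.1) (Submonoid.powers r.1) (ψ r))
      fun r ↦ ?_
    have : Module.Flat R (Localization.Away r.1) :=
      IsLocalization.flat (Localization.Away r.1) (Submonoid.powers r.1)
    exact Module.Flat.trans R (Localization.Away r.1) _
  refine ⟨⟨N, inferInstance, Module.Flat.projective_of_finitePresentation, fun p ↦ ?_⟩, fun r ↦ ?_⟩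
  · obtain ⟨r, hr, hrp⟩ : ∃ r ∈ s, r ∉ p.asIdeal := by
      by_contra! hcon
      exact p.2.ne_top (top_le_iff.1 (hs ▸ Ideal.span_le.2 hcon))
    have hmem : p ∈ Set.range (PrimeSpectrum.comap (algebraMap R (Localization.Away r))) := by
      rw [PrimeSpectrum.localization_away_comap_range (Localization.Away r) r]
      exact hrp
    obtain ⟨q, rfl⟩ := hmem
    rw [← hrank ⟨r, hr⟩ q]
    exact (Module.rankAtStalk_isBaseChange ((isLocalizedModule_iff_isBaseChange
      (Submonoid.powers r) (Localization.Away r)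
      (N.toLocalizedQuotient' (Localization.Away r) (Submonoid.powers r) (ψ ⟨r, hr⟩))).1
      inferInstance) q).symm
  · apply Module.Grassmannian.ext
    rw [map_eq_localized' (Submonoid.powers r.1)]
    exact hloc r

end GrassmannianSheaf

/-! ### The hyperplane section as a Zariski sheaf; injectivity on fraction fields -/

section SectionSheaf

variable {F : Type u} [Field F] {A : Type u} [Ring A] [Algebra F A] {n : ℕ} {c : A}

theorem SectionPoint.ext_toGrassmannian {R : Type u} [CommRing R] [Algebra F R]
    {p q : SectionPoint F A n c R} (hI : p.flag.I.toGrassmannian = q.flag.I.toGrassmannian)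
    (hJ : p.flag.J.toGrassmannian = q.flag.J.toGrassmannian) : p = q :=
  SectionPoint.ext (FlagPoint.ext (RightIdeal.ext hI) (RightIdeal.ext hJ))

variable (F A n c) in
-- The two submodules glue separately, and every condition on them asserts a membership, which is
-- local by `mem_iff_forall_away`.
theorem hyperplaneSection_isZariskiSheaf : IsZariskiSheaf (hyperplaneSection F A n c) where
  sep R s hs p q h := SectionPoint.ext_toGrassmannian
    (grassmannian_sep hs fun r hr ↦ congr_arg (fun p ↦ p.flag.I.toGrassmannian) (h r hr))
    (grassmannian_sep hs fun r hr ↦ congr_arg (fun p ↦ p.flag.J.toGrassmannian) (h r hr))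
  glue R s hfin hs p h := by
    obtain ⟨I, hI⟩ := grassmannian_glue hfin hs (fun r ↦ (p r).flag.I.toGrassmannian)
      fun r r' S a b hab ↦ congr_arg (fun p ↦ p.flag.I.toGrassmannian)
        (h r r' S (CommAlgCat.ofHom a) (CommAlgCat.ofHom b) (CommAlgCat.hom_ext hab))
    obtain ⟨J, hJ⟩ := grassmannian_glue hfin hs (fun r ↦ (p r).flag.J.toGrassmannian)
      fun r r' S a b hab ↦ congr_arg (fun p ↦ p.flag.J.toGrassmannian)
        (h r r' S (CommAlgCat.ofHom a) (CommAlgCat.ofHom b) (CommAlgCat.hom_ext hab))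
    have hI' (r) (hr : r ∈ s) := hI ⟨r, hr⟩
    have hJ' (r) (hr : r ∈ s) := hJ ⟨r, hr⟩
    refine ⟨⟨⟨⟨I, fun x hx d ↦ ?_⟩, ⟨J, fun x hx d ↦ ?_⟩, fun x hx ↦ ?_⟩, fun x hx ↦ ?_⟩, fun r ↦
      SectionPoint.ext_toGrassmannian (hI r) (hJ r)⟩
    · rw [mem_iff_forall_away hs] at hx ⊢
      intro r hr
      have := hx r hr
      rw [hI' r hr] at this ⊢
      rw [map_mul]
      exact (p ⟨r, hr⟩).flag.I.isRightIdeal _ this _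
    · rw [mem_iff_forall_away hs] at hx ⊢
      intro r hr
      have := hx r hr
      rw [hJ' r hr] at this ⊢
      rw [map_mul]
      exact (p ⟨r, hr⟩).flag.J.isRightIdeal _ this _
    · rw [mem_iff_forall_away hs] at hx ⊢
      intro r hr
      have := hx r hr
      rw [hI' r hr] at this
      rw [hJ' r hr]
      exact (p ⟨r, hr⟩).flag.le this
    · have hx' := (mem_iff_forall_away hs _ _).1 hx
      refine (mem_iff_forall_away hs _ _).2 fun r hr ↦ ?_
      have := hx' r hr
      dsimp only at this ⊢
      rw [hI' r hr] at this
      rw [hJ' r hr, map_mul]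
      simpa using (p ⟨r, hr⟩).leftMulLE _ this

/-- The quotient by `I` is projective, hence torsion-free over the domain `R`, so `I` is the
preimage of its extension to `K`. -/
theorem grassmannian_map_injective {R K : Type u} [CommRing R] [IsDomain R] [CommRing K]
    [Algebra F R] [Algebra F K] [Algebra R K] [IsScalarTower F R K] [IsFractionRing R K] {k : ℕ} :
    Function.Injective (Module.Grassmannian.map (IsScalarTower.toAlgHom F R K) :
      Module.Grassmannian R (R ⊗[F] A) k → _) := by
  have key (I : Module.Grassmannian R (R ⊗[F] A) k) (x : R ⊗[F] A) : x ∈ I.toSubmodule ↔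
      scalarMap A (IsScalarTower.toAlgHom F R K) x ∈
        (Module.Grassmannian.map (IsScalarTower.toAlgHom F R K) I).toSubmodule := by
    rw [mem_map_localization_iff (nonZeroDivisors R)]
    refine ⟨fun hx ↦ ⟨1, one_mem _, by rwa [one_smul]⟩, ?_⟩
    rintro ⟨m, hm, hx⟩
    rw [← Submodule.Quotient.mk_eq_zero, Submodule.Quotient.mk_smul] at hx
    rw [← Submodule.Quotient.mk_eq_zero]
    exact (smul_eq_zero.1 hx).resolve_left (nonZeroDivisors.ne_zero hm)
  intro I J h
  apply Module.Grassmannian.ext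
  ext x
  rw [key, key, h]

theorem hyperplaneSection_map_injective (R K : Type u) [CommRing R] [IsDomain R] [CommRing K]
    [Algebra F R] [Algebra F K] [Algebra R K] [IsScalarTower F R K] [IsFractionRing R K] :
    Function.Injective ((hyperplaneSection F A n c).map
      (CommAlgCat.ofHom (IsScalarTower.toAlgHom F R K))) := fun _ _ h ↦
  SectionPoint.ext_toGrassmannian
    (grassmannian_map_injective (congr_arg (fun p ↦ p.flag.I.toGrassmannian) h))
    (grassmannian_map_injective (congr_arg (fun p ↦ p.flag.J.toGrassmannian) h))

end SectionSheaf

/-! ### Affine charts of the Grassmannian by normalized matrices -/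

section GrassmannianCharts

variable {F : Type u} [Field F] {A : Type u} [Ring A] [Algebra F A] {d k : ℕ}
  (w : Module.Basis (Fin d) F A)
  {R S : Type u} [CommRing R] [Algebra F R] [CommRing S] [Algebra F S]

/-- The `R`-linear map `R ⊗ A → Rᵏ` with matrix `x`. -/
noncomputable def coordMap (x : Fin d → Fin k → R) : R ⊗[F] A →ₗ[R] (Fin k → R) :=
  (Algebra.TensorProduct.basis R w).constr R x

@[simp]
theorem coordMap_tmul (x : Fin d → Fin k → R) (a : Fin d) :
    coordMap w x ((1 : R) ⊗ₜ[F] w a) = x a := by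
  rw [← Algebra.TensorProduct.basis_apply, coordMap, Module.Basis.constr_basis]

variable (σ : Fin k → Fin d)

/-- The `R`-linear map `Rᵏ → R ⊗ A` that sends the basis vectors to the elements `w (σ t)`. -/
noncomputable def frameMap (R : Type u) [CommRing R] [Algebra F R] :
    (Fin k → R) →ₗ[R] R ⊗[F] A :=
  Fintype.linearCombination R fun t ↦ (1 : R) ⊗ₜ[F] w (σ t)

theorem frameMap_apply (y : Fin k → R) :
    frameMap w σ R y = ∑ t, y t • ((1 : R) ⊗ₜ[F] w (σ t)) := rfl

/-- The matrix `x` is normalized on the columns `σ`. -/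
def IsNormalized (x : Fin d → Fin k → R) : Prop := ∀ t, x (σ t) = Pi.single t 1

variable {w σ}

theorem IsNormalized.coordMap_frameMap {x : Fin d → Fin k → R} (hx : IsNormalized σ x)
    (y : Fin k → R) : coordMap w x (frameMap w σ R y) = y := by
  rw [frameMap_apply, map_sum]
  ext s
  simp [hx _, Pi.single_apply]

theorem IsNormalized.surjective {x : Fin d → Fin k → R} (hx : IsNormalized σ x) :
    Function.Surjective (coordMap w x) := fun y ↦ ⟨_, hx.coordMap_frameMap y⟩

variable (w σ) in
/-- The element `w a - ∑ₜ x a t • w (σ t)` of the kernel of `coordMap w x`. -/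
noncomputable def kerGen (x : Fin d → Fin k → R) (a : Fin d) : R ⊗[F] A :=
  (1 : R) ⊗ₜ[F] w a - frameMap w σ R (x a)

theorem IsNormalized.kerGen_mem {x : Fin d → Fin k → R} (hx : IsNormalized σ x) (a : Fin d) :
    kerGen w σ x a ∈ LinearMap.ker (coordMap w x) := by
  rw [LinearMap.mem_ker, kerGen, map_sub, hx.coordMap_frameMap, coordMap_tmul, sub_self]

theorem sub_frameMap_coordMap (x : Fin d → Fin k → R) (z : R ⊗[F] A) :
    z - frameMap w σ R (coordMap w x z) =
      ∑ a, (Algebra.TensorProduct.basis R w).repr z a • kerGen w σ x a := by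
  conv_lhs => rw [← (Algebra.TensorProduct.basis R w).sum_repr z]
  simp only [map_sum, map_smul, Algebra.TensorProduct.basis_apply, coordMap_tmul, kerGen,
    smul_sub, Finset.sum_sub_distrib]

/-- On the kernel the frame term in `sub_frameMap_coordMap` vanishes. Consequently the kernel has
generators that are explicit in the entries of the matrix and compatible with base change. -/
theorem mem_span_kerGen {x : Fin d → Fin k → R} {z : R ⊗[F] A}
    (hz : z ∈ LinearMap.ker (coordMap w x)) :
    z ∈ Submodule.span R (Set.range (kerGen w σ x)) := by
  have := sub_frameMap_coordMap (w := w) (σ := σ) x z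
  rw [LinearMap.mem_ker.1 hz, map_zero, sub_zero] at this
  rw [this]
  exact Submodule.sum_mem _ fun a _ ↦ Submodule.smul_mem _ _ (Submodule.subset_span ⟨a, rfl⟩)

theorem scalarMap_smul (f : R →ₐ[F] S) (r : R) (z : R ⊗[F] A) :
    scalarMap A f (r • z) = f r • scalarMap A f z := by
  rw [Algebra.smul_def, map_mul, Algebra.smul_def]
  simp [Algebra.TensorProduct.algebraMap_apply]

theorem scalarMap_frameMap (f : R →ₐ[F] S) (y : Fin k → R) :
    scalarMap A f (frameMap w σ R y) = frameMap w σ S (f ∘ y) := by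
  simp only [frameMap_apply, map_sum, scalarMap_smul]
  simp

theorem scalarMap_kerGen (f : R →ₐ[F] S) (x : Fin d → Fin k → R) (a : Fin d) :
    scalarMap A f (kerGen w σ x a) = kerGen w σ (fun a t ↦ f (x a t)) a := by
  rw [kerGen, map_sub, scalarMap_frameMap]
  simp [kerGen, Function.comp_def]

theorem coordMap_scalarMap (f : R →ₐ[F] S) (x : Fin d → Fin k → R) (z : R ⊗[F] A) :
    coordMap w (fun a t ↦ f (x a t)) (scalarMap A f z) = fun t ↦ f (coordMap w x z t) := by
  rw [← (Algebra.TensorProduct.basis R w).sum_repr z]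
  ext t
  simp [scalarMap_smul, -map_smul, -Module.Basis.sum_repr]

theorem IsNormalized.map (f : R →ₐ[F] S) {x : Fin d → Fin k → R} (hx : IsNormalized σ x) :
    IsNormalized σ fun a t ↦ f (x a t) := by
  intro t
  ext s
  beta_reduce
  rw [hx t, Pi.single_apply, Pi.single_apply]
  split <;> simp

/-- The point of the Grassmannian given by the kernel of a normalized matrix. -/
noncomputable def IsNormalized.point (w : Module.Basis (Fin d) F A) {x : Fin d → Fin k → R}
    (hx : IsNormalized σ x) : Module.Grassmannian R (R ⊗[F] A) k :=
  let e := (coordMap w x).quotKerEquivOfSurjective hx.surjective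
  { toSubmodule := LinearMap.ker (coordMap w x)
    finite_quotient := Module.Finite.equiv e.symm
    projective_quotient := Module.Projective.of_equiv e.symm
    rankAtStalk_eq p := by
      have : Nontrivial R := p.nontrivial
      rw [Module.rankAtStalk_eq_of_equiv e, Module.rankAtStalk_eq_finrank_of_free]
      simp }

theorem IsNormalized.map_point (f : R →ₐ[F] S) {x : Fin d → Fin k → R} (hx : IsNormalized σ x) :
    Module.Grassmannian.map f (hx.point w) = (hx.map f).point w := by
  apply Module.Grassmannian.ext
  rw [map_eq_span]
  apply le_antisymm
  · rw [Submodule.span_le]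
    rintro _ ⟨z, hz, rfl⟩
    have hz : coordMap w x z = 0 := hz
    have := coordMap_scalarMap (w := w) f x z
    simp only [hz, Pi.zero_apply, map_zero] at this
    exact this
  · intro z hz
    refine Submodule.span_mono ?_ (mem_span_kerGen (σ := σ) hz)
    rintro _ ⟨a, rfl⟩
    exact ⟨kerGen w σ x a, hx.kerGen_mem a, scalarMap_kerGen f x a⟩

/-- The row `x a` is read off from the generator `kerGen w σ x a`: if `y` kills it, then `y a = x
a`. -/
theorem IsNormalized.eq_of_ker_le {x y : Fin d → Fin k → R} (hx : IsNormalized σ x)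
    (hy : IsNormalized σ y) (h : LinearMap.ker (coordMap w x) ≤ LinearMap.ker (coordMap w y)) :
    x = y := by
  ext a : 1
  have := h (hx.kerGen_mem a)
  rw [LinearMap.mem_ker, kerGen, map_sub, hy.coordMap_frameMap, coordMap_tmul, sub_eq_zero] at this
  exact this.symm

variable (w σ) in
/-- The point `I` of the Grassmannian lies in the chart `σ`: the elements `w (σ t)` span the
quotient. -/
def InChart (I : Submodule R (R ⊗[F] A)) : Prop := LinearMap.range (frameMap w σ R) ⊔ I = ⊤

theorem IsNormalized.inChart {x : Fin d → Fin k → R} (hx : IsNormalized σ x) :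
    InChart w σ (LinearMap.ker (coordMap w x)) := by
  rw [InChart, eq_top_iff]
  intro z _
  rw [← add_sub_cancel (frameMap w σ R (coordMap w x z)) z]
  refine Submodule.add_mem_sup ⟨_, rfl⟩ ?_
  rw [LinearMap.mem_ker, map_sub, hx.coordMap_frameMap, sub_self]

theorem InChart.exists_isNormalized {I : Module.Grassmannian R (R ⊗[F] A) k}
    (h : InChart w σ I.toSubmodule) :
    ∃ x : Fin d → Fin k → R, IsNormalized σ x ∧ LinearMap.ker (coordMap w x) = I.toSubmodule := by
  have hsurj : Function.Surjective (I.toSubmodule.mkQ ∘ₗ frameMap w σ R) := by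
    intro q
    obtain ⟨z, rfl⟩ := I.toSubmodule.mkQ_surjective q
    have hz : z ∈ LinearMap.range (frameMap w σ R) ⊔ I.toSubmodule := h ▸ Submodule.mem_top
    obtain ⟨_, ⟨y, rfl⟩, i, hi, rfl⟩ := Submodule.mem_sup.1 hz
    exact ⟨y, by simpa using hi⟩
  -- A surjection between finite projective modules of equal rank is bijective; its inverse supplies
  -- the matrix.
  have hbij := Module.bijective_of_surjective_of_rankAtStalk_eq hsurj fun m _ ↦ by
    have : Nontrivial R := (⟨m, inferInstance⟩ : PrimeSpectrum R).nontrivial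
    rw [I.rankAtStalk_eq, Module.rankAtStalk_eq_finrank_of_free]
    simp
  let e := LinearEquiv.ofBijective _ hbij
  let q : R ⊗[F] A →ₗ[R] (Fin k → R) := e.symm.toLinearMap ∘ₗ I.toSubmodule.mkQ
  have hq : coordMap w (fun a ↦ q ((1 : R) ⊗ₜ[F] w a)) = q :=
    (Algebra.TensorProduct.basis R w).ext fun a ↦ by
      rw [Algebra.TensorProduct.basis_apply, coordMap_tmul]
  refine ⟨fun a ↦ q ((1 : R) ⊗ₜ[F] w a), fun t ↦ ?_, ?_⟩
  · have : frameMap w σ R (Pi.single t 1) = (1 : R) ⊗ₜ[F] w (σ t) := by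
      simp [frameMap_apply, Pi.single_apply]
    beta_reduce
    rw [← this]
    exact e.symm_apply_apply _
  · rw [hq, LinearEquiv.ker_comp, Submodule.ker_mkQ]

/-- The chart `σ'` inside the chart `σ` is given by the invertibility of a minor. -/
theorem IsNormalized.exists_iff_isUnit_det {x : Fin d → Fin k → R} (hx : IsNormalized σ x)
    (σ' : Fin k → Fin d) :
    (∃ y : Fin d → Fin k → R, IsNormalized σ' y ∧
      LinearMap.ker (coordMap w y) = LinearMap.ker (coordMap w x)) ↔
      IsUnit (Matrix.of fun t s ↦ x (σ' t) s).det := by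
  constructor
  · rintro ⟨y, hy, h⟩
    have key (z : R ⊗[F] A) : coordMap w x z = ∑ t, coordMap w y z t • x (σ' t) := by
      have hz : z - frameMap w σ' R (coordMap w y z) ∈ LinearMap.ker (coordMap w x) := by
        rw [← h, LinearMap.mem_ker, map_sub, hy.coordMap_frameMap, sub_self]
      rw [LinearMap.mem_ker, map_sub, sub_eq_zero] at hz
      rw [hz, frameMap_apply, map_sum]
      simp
    -- The two minors are the changes of frame between the bases indexed by `σ` and `σ'`, hence
    -- mutually inverse.
    have hmul : (Matrix.of fun s t ↦ y (σ s) t) * (Matrix.of fun t s ↦ x (σ' t) s) = 1 := by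
      ext s s'
      have := congr_fun (key ((1 : R) ⊗ₜ[F] w (σ s))) s'
      rw [coordMap_tmul, coordMap_tmul, hx s] at this
      simp only [Matrix.mul_apply, Matrix.of_apply, Matrix.one_apply]
      simpa [Pi.single_apply, eq_comm] using this.symm
    exact (Matrix.isUnit_iff_isUnit_det _).1 (IsUnit.of_mul_eq_one_right _ hmul)
  · intro hdet
    set X : Matrix (Fin k) (Fin k) R := Matrix.of fun t s ↦ x (σ' t) s with hX
    have hcoord : coordMap w (fun a ↦ Matrix.vecMul (x a) X⁻¹) =
        (Matrix.vecMulLinear X⁻¹) ∘ₗ coordMap w x :=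
      (Algebra.TensorProduct.basis R w).ext fun a ↦ by simp
    refine ⟨fun a ↦ Matrix.vecMul (x a) X⁻¹, fun t ↦ ?_, ?_⟩
    · have h1 : x (σ' t) = Matrix.vecMul (Pi.single t 1) X := by
        rw [Matrix.single_one_vecMul]; rfl
      beta_reduce
      rw [h1, Matrix.vecMul_vecMul, Matrix.mul_nonsing_inv _ hdet, Matrix.vecMul_one]
    · rw [hcoord, LinearMap.ker_comp, LinearMap.ker_eq_bot_of_injective (f := Matrix.vecMulLinear X⁻¹),
        LinearMap.ker]
      intro u v huv
      have := congr_arg (fun u ↦ Matrix.vecMul u X) huv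
      simpa [Matrix.vecMul_vecMul, Matrix.nonsing_inv_mul _ hdet] using this

theorem inChart_of_forall_smul_mem [Algebra R S] [IsScalarTower F R S]
    {I : Module.Grassmannian R (R ⊗[F] A) k} {r : R} (hr : IsUnit (algebraMap R S r))
    (h : ∀ a, r • ((1 : R) ⊗ₜ[F] w a) ∈ LinearMap.range (frameMap w σ R) ⊔ I.toSubmodule) :
    InChart w σ (Module.Grassmannian.map (IsScalarTower.toAlgHom F R S) I).toSubmodule := by
  rw [InChart, eq_top_iff, ← (Algebra.TensorProduct.basis S w).span_eq, Submodule.span_le]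
  rintro _ ⟨a, rfl⟩
  rw [Algebra.TensorProduct.basis_apply]
  obtain ⟨_, ⟨y, rfl⟩, i, hi, e⟩ := Submodule.mem_sup.1 (h a)
  have e' := congr_arg (scalarMap A (IsScalarTower.toAlgHom F R S)) e
  rw [scalarMap_smul, map_add, scalarMap_frameMap] at e'
  have hmem : (algebraMap R S r) • ((1 : S) ⊗ₜ[F] w a) ∈ LinearMap.range (frameMap w σ S) ⊔
      (Module.Grassmannian.map (IsScalarTower.toAlgHom F R S) I).toSubmodule := by
    have h2 : scalarMap A (IsScalarTower.toAlgHom F R S) ((1 : R) ⊗ₜ[F] w a) =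
      (1 : S) ⊗ₜ[F] w a := by simp
    rw [h2] at e'
    exact e' ▸ Submodule.add_mem_sup ⟨_, rfl⟩ (scalarMap_mem_map _ _ hi)
  exact (Submodule.smul_mem_iff_of_isUnit _ hr).1 hmem

/-- Near every prime, a point of the Grassmannian lies in one of the charts. -/
theorem exists_chart (I : Module.Grassmannian R (R ⊗[F] A) k) (p : PrimeSpectrum R) :
    ∃ σ : Fin k → Fin d, ∃ r : R, r ∉ p.asIdeal ∧
      ∀ a, r • ((1 : R) ⊗ₜ[F] w a) ∈ LinearMap.range (frameMap w σ R) ⊔ I.toSubmodule := by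
  let M := (R ⊗[F] A) ⧸ I.toSubmodule
  let f := LocalizedModule.mkLinearMap p.asIdeal.primeCompl M
  let v (a : Fin d) : M := I.toSubmodule.mkQ ((1 : R) ⊗ₜ[F] w a)
  have hv : Submodule.span R (Set.range v) = ⊤ := by
    have : Set.range v = I.toSubmodule.mkQ '' Set.range (Algebra.TensorProduct.basis R w) := by
      rw [← Set.range_comp]
      congr 1
      ext a
      simp [v]
    rw [this, ← Submodule.map_span, Module.Basis.span_eq, Submodule.map_top, Submodule.range_mkQ]
  have hfv : Submodule.span (Localization.AtPrime p.asIdeal) (Set.range (f ∘ v)) = ⊤ := by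
    rw [Set.range_comp, ← Submodule.localized'_span _ p.asIdeal.primeCompl f, hv,
      Submodule.localized'_top]
  have : Module.FinitePresentation (Localization.AtPrime p.asIdeal)
    (LocalizedModule p.asIdeal.primeCompl M) := Module.finitePresentation_of_projective _ _
  -- Over the local ring the images of the basis vectors contain a basis of the localized quotient.
  -- `ULift` only adjusts the universe.
  obtain ⟨κ, α, b, hb⟩ := Module.exists_basis_of_span_of_flat
    (f ∘ v ∘ ULift.down.{u}) (by
      rwa [← Function.comp_assoc, Set.range_comp, ULift.down_surjective.range_eq, Set.image_univ])
  have hcard : Module.finrank (Localization.AtPrime p.asIdeal)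
    (LocalizedModule p.asIdeal.primeCompl M) = k := I.rankAtStalk_eq p
  have : Module.Free (Localization.AtPrime p.asIdeal)
    (LocalizedModule p.asIdeal.primeCompl M) := .of_basis b
  let e : Fin k ≃ κ := ((Module.finBasisOfFinrankEq _ _ hcard).indexEquiv b)
  let σ (t : Fin k) : Fin d := (α (e t)).down
  have htop : (Submodule.span R (Set.range (v ∘ σ))).localized'
      (Localization.AtPrime p.asIdeal) p.asIdeal.primeCompl f = ⊤ := by
    rw [Submodule.localized'_span, ← Set.range_comp, ← b.span_eq]
    congr 1
    rw [← e.surjective.range_comp b]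
    congr 1
    ext t
    exact (hb (e t)).symm
  have hm (a : Fin d) : ∃ m ∈ p.asIdeal.primeCompl,
      m • v a ∈ Submodule.span R (Set.range (v ∘ σ)) :=
    (mem_localized'_iff (Localization.AtPrime p.asIdeal) _ f _ _).1 (htop ▸ Submodule.mem_top)
  choose m hmp hm using hm
  -- One product clears the denominators of all basis vectors at once.
  refine ⟨σ, ∏ a, m a, prod_mem (S := p.asIdeal.primeCompl) fun a _ ↦ hmp a, fun a ↦ ?_⟩
  have hspan : Submodule.span R (Set.range (v ∘ σ)) =
      (LinearMap.range (frameMap w σ R)).map I.toSubmodule.mkQ := by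
    rw [frameMap, Fintype.range_linearCombination, Submodule.map_span, ← Set.range_comp]
    rfl
  rw [← Finset.prod_erase_mul _ _ (Finset.mem_univ a), mul_smul]
  refine Submodule.smul_mem _ _ ?_
  have := hm a
  rw [hspan] at this
  obtain ⟨y, hy, e⟩ := this
  rw [← map_smul, ← sub_eq_zero, ← map_sub, Submodule.mkQ_apply, Submodule.Quotient.mk_eq_zero] at e
  rw [← add_sub_cancel y (m a • _)]
  exact Submodule.add_mem_sup hy (by rw [← neg_sub]; exact neg_mem e)

end GrassmannianCharts

/-! ### Charts of the hyperplane section and their coordinate rings -/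

section SectionCharts

variable {F : Type u} [Field F] {A : Type u} [Ring A] [Algebra F A] {d n : ℕ}
  (w : Module.Basis (Fin d) F A) (c : A)
  {R S : Type u} [CommRing R] [Algebra F R] [CommRing S] [Algebra F S]

/-- The equations of a chart of the hyperplane section, for matrices `x` and `y` defining the two
right ideals. -/
inductive ChartEquation {k l : ℕ} (σ : Fin k → Fin d) (τ : Fin l → Fin d)
    (x : Fin d → Fin k → R) (y : Fin d → Fin l → R) : R → Prop
  | normalized_left (t s : Fin k) :
    ChartEquation σ τ x y (x (σ t) s - (Pi.single t 1 : Fin k → R) s)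
  | normalized_right (t s : Fin l) :
    ChartEquation σ τ x y (y (τ t) s - (Pi.single t 1 : Fin l → R) s)
  | ideal_left (a e : Fin d) (s : Fin k) :
    ChartEquation σ τ x y (coordMap w x (kerGen w σ x a * ((1 : R) ⊗ₜ[F] w e)) s)
  | ideal_right (a e : Fin d) (s : Fin l) :
    ChartEquation σ τ x y (coordMap w y (kerGen w τ y a * ((1 : R) ⊗ₜ[F] w e)) s)
  | le (a : Fin d) (s : Fin l) :
    ChartEquation σ τ x y (coordMap w y (kerGen w σ x a) s)
  | mul_le (a : Fin d) (s : Fin l) :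
    ChartEquation σ τ x y (coordMap w y (((1 : R) ⊗ₜ[F] c) * kerGen w σ x a) s)

/-- The matrices `x` and `y` satisfy the equations of a chart of the hyperplane section. -/
def SolvesChart {k l : ℕ} (σ : Fin k → Fin d) (τ : Fin l → Fin d)
    (x : Fin d → Fin k → R) (y : Fin d → Fin l → R) : Prop :=
  ∀ r, ChartEquation w c σ τ x y r → r = 0

section Equations

variable {w c} {k l : ℕ} {σ : Fin k → Fin d} {τ : Fin l → Fin d}
  {x : Fin d → Fin k → R} {y : Fin d → Fin l → R}

theorem scalarMap_one_tmul (f : R →ₐ[F] S) (z : A) :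
    scalarMap A f ((1 : R) ⊗ₜ[F] z) = (1 : S) ⊗ₜ[F] z := by simp

theorem ChartEquation.map (f : R →ₐ[F] S) {r : R} (h : ChartEquation w c σ τ x y r) :
    ChartEquation w c σ τ (fun a t ↦ f (x a t)) (fun a t ↦ f (y a t)) (f r) := by
  cases h with
  | normalized_left t s =>
    convert ChartEquation.normalized_left (w := w) (c := c) (σ := σ) (τ := τ)
      (x := fun a t ↦ f (x a t)) (y := fun a t ↦ f (y a t)) t s using 1
    simp [Pi.single_apply, apply_ite f]
  | normalized_right t s =>
    convert ChartEquation.normalized_right (w := w) (c := c) (σ := σ) (τ := τ)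
      (x := fun a t ↦ f (x a t)) (y := fun a t ↦ f (y a t)) t s using 1
    simp [Pi.single_apply, apply_ite f]
  | ideal_left a e s =>
    convert ChartEquation.ideal_left (w := w) (c := c) (σ := σ) (τ := τ)
      (x := fun a t ↦ f (x a t)) (y := fun a t ↦ f (y a t)) a e s using 1
    rw [← scalarMap_kerGen, ← scalarMap_one_tmul f, ← map_mul, coordMap_scalarMap]
  | ideal_right a e s =>
    convert ChartEquation.ideal_right (w := w) (c := c) (σ := σ) (τ := τ)
      (x := fun a t ↦ f (x a t)) (y := fun a t ↦ f (y a t)) a e s using 1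
    rw [← scalarMap_kerGen, ← scalarMap_one_tmul f, ← map_mul, coordMap_scalarMap]
  | le a s =>
    convert ChartEquation.le (w := w) (c := c) (σ := σ) (τ := τ)
      (x := fun a t ↦ f (x a t)) (y := fun a t ↦ f (y a t)) a s using 1
    rw [← scalarMap_kerGen, coordMap_scalarMap]
  | mul_le a s =>
    convert ChartEquation.mul_le (w := w) (c := c) (σ := σ) (τ := τ)
      (x := fun a t ↦ f (x a t)) (y := fun a t ↦ f (y a t)) a s using 1
    rw [← scalarMap_kerGen, ← scalarMap_one_tmul f, ← map_mul, coordMap_scalarMap]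

/-- The equations are natural in the ring, so solutions base change and the universal matrices solve
them. -/
theorem ChartEquation.exists_eq_map (f : R →ₐ[F] S) {r : S}
    (h : ChartEquation w c σ τ (fun a t ↦ f (x a t)) (fun a t ↦ f (y a t)) r) :
    ∃ r', ChartEquation w c σ τ x y r' ∧ f r' = r := by
  cases h with
  | normalized_left t s =>
    exact ⟨_, .normalized_left t s, by simp [Pi.single_apply, apply_ite f]⟩
  | normalized_right t s =>
    exact ⟨_, .normalized_right t s, by simp [Pi.single_apply, apply_ite f]⟩
  | ideal_left a e s =>
    refine ⟨_, .ideal_left a e s, ?_⟩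
    rw [← scalarMap_kerGen, ← scalarMap_one_tmul f, ← map_mul, coordMap_scalarMap]
  | ideal_right a e s =>
    refine ⟨_, .ideal_right a e s, ?_⟩
    rw [← scalarMap_kerGen, ← scalarMap_one_tmul f, ← map_mul, coordMap_scalarMap]
  | le a s =>
    refine ⟨_, .le a s, ?_⟩
    rw [← scalarMap_kerGen, coordMap_scalarMap]
  | mul_le a s =>
    refine ⟨_, .mul_le a s, ?_⟩
    rw [← scalarMap_kerGen, ← scalarMap_one_tmul f, ← map_mul, coordMap_scalarMap]

theorem SolvesChart.map (h : SolvesChart w c σ τ x y) (f : R →ₐ[F] S) :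
    SolvesChart w c σ τ (fun a t ↦ f (x a t)) (fun a t ↦ f (y a t)) := by
  intro r hr
  obtain ⟨r', hr', rfl⟩ := hr.exists_eq_map
  rw [h r' hr', map_zero]

theorem SolvesChart.normalized_left (h : SolvesChart w c σ τ x y) : IsNormalized σ x :=
  fun t ↦ funext fun s ↦ sub_eq_zero.1 (h _ (.normalized_left t s))

theorem SolvesChart.normalized_right (h : SolvesChart w c σ τ x y) : IsNormalized τ y :=
  fun t ↦ funext fun s ↦ sub_eq_zero.1 (h _ (.normalized_right t s))

/-- By bilinearity, stability under right multiplication need only be tested on the generators of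
the kernel and a basis of `A`; this makes it finitely many equations. -/
theorem isRightIdeal_ker {x : Fin d → Fin k → R}
    (h : ∀ a e, coordMap w x (kerGen w σ x a * ((1 : R) ⊗ₜ[F] w e)) = 0) :
    IsRightIdeal (LinearMap.ker (coordMap w x)) := by
  intro z hz v
  rw [LinearMap.mem_ker]
  rw [← (Algebra.TensorProduct.basis R w).sum_repr v, Finset.mul_sum, map_sum]
  refine Finset.sum_eq_zero fun e _ ↦ ?_
  rw [mul_smul_comm, map_smul, Algebra.TensorProduct.basis_apply]
  convert smul_zero _
  have hz' := mem_span_kerGen (σ := σ) hz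
  clear hz
  induction hz' using Submodule.span_induction with
  | mem z hz => obtain ⟨a, rfl⟩ := hz; exact h a e
  | zero => simp
  | add z z' _ _ h h' => rw [add_mul, map_add, h, h', add_zero]
  | smul r z _ h => rw [smul_mul_assoc, map_smul, h, smul_zero]

theorem SolvesChart.isRightIdeal_left (h : SolvesChart w c σ τ x y) :
    IsRightIdeal (LinearMap.ker (coordMap w x)) :=
  isRightIdeal_ker fun a e ↦ funext fun s ↦ h _ (.ideal_left a e s)

theorem SolvesChart.isRightIdeal_right (h : SolvesChart w c σ τ x y) :
    IsRightIdeal (LinearMap.ker (coordMap w y)) :=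
  isRightIdeal_ker fun a e ↦ funext fun s ↦ h _ (.ideal_right a e s)

theorem SolvesChart.ker_le (h : SolvesChart w c σ τ x y) :
    LinearMap.ker (coordMap w x) ≤ LinearMap.ker (coordMap w y) := by
  intro z hz
  refine (Submodule.span_le.2 ?_) (mem_span_kerGen (σ := σ) hz)
  rintro _ ⟨a, rfl⟩
  exact funext fun s ↦ h _ (.le a s)

theorem SolvesChart.leftMulLE (h : SolvesChart w c σ τ x y) :
    LeftMulLE c (LinearMap.ker (coordMap w x)) (LinearMap.ker (coordMap w y)) := by
  intro z hz
  have : Submodule.span R (Set.range (kerGen w σ x)) ≤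
      (LinearMap.ker (coordMap w y)).comap (LinearMap.mulLeft R ((1 : R) ⊗ₜ[F] c)) := by
    rw [Submodule.span_le]
    rintro _ ⟨a, rfl⟩
    exact funext fun s ↦ h _ (.mul_le a s)
  exact this (mem_span_kerGen hz)

theorem solvesChart_of_ker (hx : IsNormalized σ x) (hy : IsNormalized τ y)
    (h1 : IsRightIdeal (LinearMap.ker (coordMap w x)))
    (h2 : IsRightIdeal (LinearMap.ker (coordMap w y)))
    (h3 : LinearMap.ker (coordMap w x) ≤ LinearMap.ker (coordMap w y))
    (h4 : LeftMulLE c (LinearMap.ker (coordMap w x)) (LinearMap.ker (coordMap w y))) :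
    SolvesChart w c σ τ x y := by
  rintro _ (⟨t, s⟩ | ⟨t, s⟩ | ⟨a, e, s⟩ | ⟨a, e, s⟩ | ⟨a, s⟩ | ⟨a, s⟩)
  · rw [hx t, sub_self]
  · rw [hy t, sub_self]
  · exact congr_fun (h1 _ (hx.kerGen_mem a) _) s
  · exact congr_fun (h2 _ (hy.kerGen_mem a) _) s
  · exact congr_fun (h3 (hx.kerGen_mem a)) s
  · exact congr_fun (h4 _ (hx.kerGen_mem a)) s

end Equations

variable {w c} {σ : Fin (n * (n - 1)) → Fin d} {τ : Fin (n * (n - (n - 1))) → Fin d}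
  {x : Fin d → Fin (n * (n - 1)) → R} {y : Fin d → Fin (n * (n - (n - 1))) → R}

/-- The point of the hyperplane section given by a solution of the equations of a chart. -/
noncomputable def SolvesChart.point (h : SolvesChart w c σ τ x y) : SectionPoint F A n c R where
  flag :=
    { I := ⟨h.normalized_left.point w, h.isRightIdeal_left⟩
      J := ⟨h.normalized_right.point w, h.isRightIdeal_right⟩
      le := h.ker_le }
  leftMulLE := h.leftMulLE

theorem SolvesChart.map_point (h : SolvesChart w c σ τ x y) (f : R →ₐ[F] S) :
    h.point.map f = (h.map f).point :=
  SectionPoint.ext_toGrassmannian (h.normalized_left.map_point f) (h.normalized_right.map_point f)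

theorem SolvesChart.point_eq_iff {σ' : Fin (n * (n - 1)) → Fin d}
    {τ' : Fin (n * (n - (n - 1))) → Fin d}
    {x' : Fin d → Fin (n * (n - 1)) → R} {y' : Fin d → Fin (n * (n - (n - 1))) → R}
    (h : SolvesChart w c σ τ x y) (h' : SolvesChart w c σ' τ' x' y') :
    h.point = h'.point ↔ LinearMap.ker (coordMap w x) = LinearMap.ker (coordMap w x') ∧
      LinearMap.ker (coordMap w y) = LinearMap.ker (coordMap w y') := by
  constructor
  · intro e
    exact ⟨congr_arg (fun p ↦ p.flag.I.toSubmodule) e, congr_arg (fun p ↦ p.flag.J.toSubmodule) e⟩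
  · rintro ⟨e, e'⟩
    exact SectionPoint.ext_toGrassmannian (Module.Grassmannian.ext e) (Module.Grassmannian.ext e')

theorem SolvesChart.eq_of_point_eq {x' : Fin d → Fin (n * (n - 1)) → R}
    {y' : Fin d → Fin (n * (n - (n - 1))) → R} (h : SolvesChart w c σ τ x y)
    (h' : SolvesChart w c σ τ x' y') (e : h.point = h'.point) : x = x' ∧ y = y' := by
  rw [point_eq_iff] at e
  exact ⟨h.normalized_left.eq_of_ker_le h'.normalized_left e.1.le,
    h.normalized_right.eq_of_ker_le h'.normalized_right e.2.le⟩

theorem exists_solvesChart (p : SectionPoint F A n c R) (hI : InChart w σ p.flag.I.toSubmodule)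
    (hJ : InChart w τ p.flag.J.toSubmodule) :
    ∃ x y, ∃ h : SolvesChart w c σ τ x y, h.point = p := by
  obtain ⟨x, hx, hxI⟩ := hI.exists_isNormalized
  obtain ⟨y, hy, hyJ⟩ := hJ.exists_isNormalized
  refine ⟨x, y, solvesChart_of_ker hx hy ?_ ?_ ?_ ?_, SectionPoint.ext_toGrassmannian
    (Module.Grassmannian.ext hxI) (Module.Grassmannian.ext hyJ)⟩
  · rw [hxI]; exact p.flag.I.isRightIdeal
  · rw [hyJ]; exact p.flag.J.isRightIdeal
  · rw [hxI, hyJ]; exact p.flag.le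
  · rw [hxI, hyJ]; exact p.leftMulLE

/-! #### The coordinate ring of a chart -/

variable (d n) in
/-- The indices of the charts. -/
abbrev ChartIndex : Type u :=
  ULift.{u} ((Fin (n * (n - 1)) → Fin d) × (Fin (n * (n - (n - 1))) → Fin d))

variable (F d n) in
/-- The polynomial ring in the entries of two matrices. -/
abbrev EntryRing : Type u :=
  MvPolynomial ((Fin d × Fin (n * (n - 1))) ⊕ (Fin d × Fin (n * (n - (n - 1))))) F

variable (w c) in
/-- The ideal of the equations of a chart. -/
noncomputable def chartIdeal (i : ChartIndex d n) : Ideal (EntryRing F d n) :=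
  Ideal.span {r | ChartEquation w c i.down.1 i.down.2
    (fun a t ↦ MvPolynomial.X (Sum.inl (a, t))) (fun a t ↦ MvPolynomial.X (Sum.inr (a, t))) r}

variable (w c) in
/-- The coordinate ring of a chart. -/
abbrev ChartRing (i : ChartIndex d n) : Type u := EntryRing F d n ⧸ chartIdeal w c i

variable (w c) in
/-- The entries of the first universal matrix. -/
noncomputable def univLeft (i : ChartIndex d n) (a : Fin d) (t : Fin (n * (n - 1))) :
    ChartRing w c i :=
  Ideal.Quotient.mkₐ F (chartIdeal w c i) (MvPolynomial.X (Sum.inl (a, t)))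

variable (w c) in
/-- The entries of the second universal matrix. -/
noncomputable def univRight (i : ChartIndex d n) (a : Fin d) (t : Fin (n * (n - (n - 1)))) :
    ChartRing w c i :=
  Ideal.Quotient.mkₐ F (chartIdeal w c i) (MvPolynomial.X (Sum.inr (a, t)))

variable (w c) in
theorem univ_solvesChart (i : ChartIndex d n) :
    SolvesChart w c i.down.1 i.down.2 (univLeft w c i) (univRight w c i) := by
  intro r hr
  obtain ⟨r', hr', rfl⟩ := ChartEquation.exists_eq_map
    (Ideal.Quotient.mkₐ F (chartIdeal w c i)) hr
  exact Ideal.Quotient.eq_zero_iff_mem.2 (Ideal.subset_span hr')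

theorem exists_chartRing_hom {i : ChartIndex d n}
    (h : SolvesChart w c i.down.1 i.down.2 x y) : ∃ g : ChartRing w c i →ₐ[F] R,
      (∀ a t, g (univLeft w c i a t) = x a t) ∧ ∀ a t, g (univRight w c i a t) = y a t := by
  let φ : EntryRing F d n →ₐ[F] R :=
    MvPolynomial.aeval (Sum.elim (fun q ↦ x q.1 q.2) (fun q ↦ y q.1 q.2))
  refine ⟨Ideal.Quotient.liftₐ _ φ fun r hr ↦ ?_, fun a t ↦ ?_, fun a t ↦ ?_⟩
  · have : chartIdeal w c i ≤ RingHom.ker φ := by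
      rw [chartIdeal, Ideal.span_le]
      intro r hr
      have h1 := ChartEquation.map φ hr
      simp only [φ, MvPolynomial.aeval_X, Sum.elim_inl, Sum.elim_inr] at h1
      exact h _ h1
    exact this hr
  · exact MvPolynomial.aeval_X _ _
  · exact MvPolynomial.aeval_X _ _

theorem chartRing_hom_ext {i : ChartIndex d n} {g h : ChartRing w c i →ₐ[F] R}
    (hl : ∀ a t, g (univLeft w c i a t) = h (univLeft w c i a t))
    (hr : ∀ a t, g (univRight w c i a t) = h (univRight w c i a t)) : g = h := by
  apply Ideal.Quotient.algHom_ext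
  apply MvPolynomial.algHom_ext
  rintro (⟨a, t⟩ | ⟨a, t⟩)
  · exact hl a t
  · exact hr a t

instance (i : ChartIndex d n) : Algebra.FinitePresentation F (ChartRing w c i) :=
  Algebra.FinitePresentation.of_finiteType.1 inferInstance

/-- A point of the hyperplane section in the chart `i` comes from a unique homomorphism from the
coordinate ring of the chart. -/
theorem exists_map_univ_eq {i : ChartIndex d n} (p : SectionPoint F A n c R)
    (hI : InChart w i.down.1 p.flag.I.toSubmodule)
    (hJ : InChart w i.down.2 p.flag.J.toSubmodule) :
    ∃ g : ChartRing w c i →ₐ[F] R, (univ_solvesChart w c i).point.map g = p := by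
  obtain ⟨x, y, h, rfl⟩ := exists_solvesChart p hI hJ
  obtain ⟨g, h1, h2⟩ := exists_chartRing_hom h
  refine ⟨g, ?_⟩
  rw [SolvesChart.map_point, SolvesChart.point_eq_iff]
  simp only [h1, h2, true_and]

theorem map_univ_injective {i : ChartIndex d n} {g h : ChartRing w c i →ₐ[F] R}
    (e : (univ_solvesChart w c i).point.map g = (univ_solvesChart w c i).point.map h) : g = h := by
  rw [SolvesChart.map_point, SolvesChart.map_point] at e
  obtain ⟨h1, h2⟩ := SolvesChart.eq_of_point_eq _ _ e
  exact chartRing_hom_ext (fun a t ↦ congr_fun (congr_fun h1 a) t)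
    (fun a t ↦ congr_fun (congr_fun h2 a) t)

theorem inChart_map_univ {i : ChartIndex d n} (g : ChartRing w c i →ₐ[F] R) :
    InChart w i.down.1 ((univ_solvesChart w c i).point.map g).flag.I.toSubmodule ∧
    InChart w i.down.2 ((univ_solvesChart w c i).point.map g).flag.J.toSubmodule := by
  rw [SolvesChart.map_point]
  exact ⟨((univ_solvesChart w c i).map g).normalized_left.inChart,
    ((univ_solvesChart w c i).map g).normalized_right.inChart⟩

variable (w c) in
/-- The product of the minors whose invertibility defines the chart `j` inside the chart `i`. -/
noncomputable def minors (i j : ChartIndex d n) : ChartRing w c i :=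
  (Matrix.of fun t s ↦ univLeft w c i (j.down.1 t) s).det *
    (Matrix.of fun t s ↦ univRight w c i (j.down.2 t) s).det

/-- A product is a unit exactly when both factors are, and each minor decides whether one of the two
ideals lies in its chart. -/
theorem isUnit_minors_iff (i j : ChartIndex d n) (g : ChartRing w c i →ₐ[F] R) :
    IsUnit (g (minors w c i j)) ↔ ∃ h : ChartRing w c j →ₐ[F] R,
      (univ_solvesChart w c i).point.map g = (univ_solvesChart w c j).point.map h := by
  have hg := (univ_solvesChart w c i).map g
  have h1 := hg.normalized_left.exists_iff_isUnit_det (w := w) j.down.1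
  have h2 := hg.normalized_right.exists_iff_isUnit_det (w := w) j.down.2
  have e : g (minors w c i j) = (Matrix.of fun t s ↦ g (univLeft w c i (j.down.1 t) s)).det *
    (Matrix.of fun t s ↦ g (univRight w c i (j.down.2 t) s)).det := by
    rw [minors, map_mul, AlgHom.map_det, AlgHom.map_det]
    rfl
  rw [e, IsUnit.mul_iff, ← h1, ← h2]
  constructor
  · rintro ⟨⟨x, hx, ex⟩, y, hy, ey⟩
    obtain ⟨h, eh⟩ := exists_map_univ_eq (i := j) ((univ_solvesChart w c i).point.map g)
      (by rw [SolvesChart.map_point]; exact (congr_arg (InChart w j.down.1) ex).mp hx.inChart)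
      (by rw [SolvesChart.map_point]; exact (congr_arg (InChart w j.down.2) ey).mp hy.inChart)
    exact ⟨h, eh.symm⟩
  · rintro ⟨h, eh⟩
    rw [SolvesChart.map_point, SolvesChart.map_point, SolvesChart.point_eq_iff] at eh
    have hh := (univ_solvesChart w c j).map h
    exact ⟨⟨_, hh.normalized_left, eh.1.symm⟩, ⟨_, hh.normalized_right, eh.2.symm⟩⟩

variable (n w c) in
/-- The atlas of the hyperplane section. -/
noncomputable def sectionAtlas : AffineAtlas (hyperplaneSection F A n c) (ChartIndex.{u} d n) where
  B i := CommAlgCat.of F (ChartRing w c i)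
  ξ i := (univ_solvesChart w c i).point
  f i j := minors w c i j
  inj i R g h e := CommAlgCat.hom_ext (map_univ_injective e)
  isUnit_iff i j R g := (isUnit_minors_iff i j g.hom).trans
    ⟨fun ⟨h, e⟩ ↦ ⟨CommAlgCat.ofHom h, e⟩, fun ⟨h, e⟩ ↦ ⟨h.hom, e⟩⟩
  covers := covers_of_forall_prime fun R p x ↦ by
    obtain ⟨σ, r, hr, H⟩ := exists_chart (w := w) p.flag.I.toGrassmannian x
    obtain ⟨τ, r', hr', H'⟩ := exists_chart (w := w) p.flag.J.toGrassmannian x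
    have hu := awayMap_isUnit R (r * r')
    rw [map_mul, IsUnit.mul_iff] at hu
    obtain ⟨g, hg⟩ := exists_map_univ_eq (w := w) (i := ⟨(σ, τ)⟩)
      (p.map (IsScalarTower.toAlgHom F R (Localization.Away (r * r'))))
      (inChart_of_forall_smul_mem hu.1 H) (inChart_of_forall_smul_mem hu.2 H')
    exact ⟨r * r', fun h ↦ (x.2.mem_or_mem h).elim hr hr', ⟨(σ, τ)⟩, CommAlgCat.ofHom g, hg.symm⟩

end SectionCharts

/-! ### Smoothness of the charts from infinitesimal lifting -/

section ChartSmooth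

variable {F : Type u} [Field F] {A : Type u} [Ring A] [Algebra F A] {d n : ℕ}
  {w : Module.Basis (Fin d) F A} {c : A}
  {R : Type u} [CommRing R] [Algebra F R]

theorem scalarMap_mk_surjective (N : Ideal R) :
    Function.Surjective (scalarMap A (Ideal.Quotient.mkₐ F N)) :=
  TensorProduct.map_surjective (Ideal.Quotient.mk_surjective) Function.surjective_id

theorem scalarMap_mk_eq_zero_iff (N : Ideal R) (z : R ⊗[F] A) :
    scalarMap A (Ideal.Quotient.mkₐ F N) z = 0 ↔ z ∈ N • (⊤ : Submodule R (R ⊗[F] A)) := by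
  have h1 : scalarMap A (Ideal.Quotient.mkₐ F N) z = scalarMapₗ A R (R ⧸ N) z :=
    (scalarMapₗ_apply z).symm
  rw [h1, ← one_smul (R ⧸ N) (scalarMapₗ A R (R ⧸ N) z),
    ← (scalarMapₗ_isBaseChange A R (R ⧸ N)).equiv_tmul, LinearEquiv.map_eq_zero_iff,
    ← (quotTensorEquivQuotSMul (R ⊗[F] A) N).map_eq_zero_iff, quotTensorEquivQuotSMul_mk_one_tmul,
    Submodule.Quotient.mk_eq_zero]

/-- Scalars lift along `R → R ⧸ N`, so the image of `I` is already a submodule and no span is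
needed. -/
theorem exists_mem_scalarMap_eq {N : Ideal R} {k : ℕ} (I : Module.Grassmannian R (R ⊗[F] A) k)
    {y : (R ⧸ N) ⊗[F] A}
    (hy : y ∈ (Module.Grassmannian.map (Ideal.Quotient.mkₐ F N) I).toSubmodule) :
    ∃ z ∈ I.toSubmodule, scalarMap A (Ideal.Quotient.mkₐ F N) z = y := by
  rw [map_eq_span] at hy
  induction hy using Submodule.span_induction with
  | mem y hy => exact hy
  | zero => exact ⟨0, zero_mem _, map_zero _⟩
  | add y y' _ _ h h' =>
    obtain ⟨z, hz, rfl⟩ := h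
    obtain ⟨z', hz', rfl⟩ := h'
    exact ⟨z + z', add_mem hz hz', map_add _ _ _⟩
  | smul r y _ h =>
    obtain ⟨z, hz, rfl⟩ := h
    obtain ⟨r, rfl⟩ := Ideal.Quotient.mk_surjective r
    exact ⟨r • z, Submodule.smul_mem _ _ hz, scalarMap_smul _ _ _⟩

theorem le_jacobson_bot_of_sq_eq_bot {N : Ideal R} (hN : N ^ 2 = ⊥) :
    N ≤ Ideal.jacobson (⊥ : Ideal R) := by
  intro r hr
  refine Ideal.radical_le_jacobson ⟨2, ?_⟩
  rw [← hN]
  exact Ideal.pow_mem_pow hr 2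

/-- Nakayama: `N` lies in the Jacobson radical, so spanning the quotient modulo `N` implies spanning
it. Thus a lift of a point stays in the same chart. -/
theorem inChart_of_quotient {k : ℕ} {σ : Fin k → Fin d} {N : Ideal R} (hN : N ^ 2 = ⊥)
    (I : Module.Grassmannian R (R ⊗[F] A) k)
    (h : InChart w σ (Module.Grassmannian.map (Ideal.Quotient.mkₐ F N) I).toSubmodule) :
    InChart w σ I.toSubmodule := by
  have : Module.Finite F A := Module.Finite.of_basis w
  rw [InChart, eq_top_iff]
  refine Submodule.le_of_le_smul_of_le_jacobson_bot Module.Finite.fg_top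
    (le_jacobson_bot_of_sq_eq_bot hN) fun z _ ↦ ?_
  have hz : scalarMap A (Ideal.Quotient.mkₐ F N) z ∈ LinearMap.range (frameMap w σ (R ⧸ N)) ⊔
    (Module.Grassmannian.map (Ideal.Quotient.mkₐ F N) I).toSubmodule := h ▸ Submodule.mem_top
  obtain ⟨_, ⟨y, rfl⟩, i, hi, e⟩ := Submodule.mem_sup.1 hz
  obtain ⟨i, hi', rfl⟩ := exists_mem_scalarMap_eq I hi
  obtain ⟨y, rfl⟩ := (Ideal.Quotient.mkₐ_surjective F N).comp_left y
  rw [← scalarMap_frameMap, ← map_add] at e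
  rw [← add_sub_cancel (frameMap w σ R y + i) z]
  refine Submodule.add_mem_sup (Submodule.add_mem_sup ⟨_, rfl⟩ hi') ?_
  rw [← scalarMap_mk_eq_zero_iff, map_sub, e, sub_self]

theorem SectionPoint.map_comp {S T : Type u} [CommRing S] [Algebra F S] [CommRing T] [Algebra F T]
    (f : R →ₐ[F] S) (g : S →ₐ[F] T) (p : SectionPoint F A n c R) :
    p.map (g.comp f) = (p.map f).map g :=
  SectionPoint.ext (p.flag.map_comp f g)

/-- The charts are smooth if points of the hyperplane section lift along square zero extensions. -/
theorem chartRing_smooth (h : ∀ (R : Type u) [CommRing R] [Algebra F R] (N : Ideal R), N ^ 2 = ⊥ →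
      ∀ p : SectionPoint F A n c (R ⧸ N), ∃ q : SectionPoint F A n c R,
        q.map (Ideal.Quotient.mkₐ F N) = p) (i : ChartIndex.{u} d n) :
    Algebra.Smooth F (ChartRing w c i) where
  formallySmooth := by
    refine Algebra.FormallySmooth.of_comp_surjective fun R _ _ N hN g ↦ ?_
    obtain ⟨q, hq⟩ := h R N hN ((univ_solvesChart w c i).point.map g)
    have hg := inChart_map_univ g
    rw [← hq] at hg
    obtain ⟨g', hg'⟩ := exists_map_univ_eq (i := i) q
      (inChart_of_quotient hN _ hg.1) (inChart_of_quotient hN _ hg.2)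
    refine ⟨g', map_univ_injective ?_⟩
    rw [SectionPoint.map_comp, hg', hq]
  finitePresentation := inferInstance

end ChartSmooth

/-! ### Symbol algebras over a ring: averaging and idempotent generators -/

section Symbol

/-- The elements `u` and `v` generate the `R`-module `D` by their monomials and satisfy the
relations of a cyclic algebra. -/
structure IsSymbol {R D : Type*} [CommRing R] [Ring D] [Algebra R D] (n : ℕ) (ζ a b : R)
    (u v : D) : Prop where
  u_pow : u ^ n = algebraMap R D a
  v_pow : v ^ n = algebraMap R D b
  comm : u * v = ζ • (v * u)
  span_eq_top : Submodule.span R (Set.range fun m : ℕ × ℕ ↦ u ^ m.1 * v ^ m.2) = ⊤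

namespace IsSymbol

section CommRing

variable {R D : Type*} [CommRing R] [Ring D] [Algebra R D] {n : ℕ} {ζ a b : R} {u v : D}
  (h : IsSymbol n ζ a b u v)

include h

theorem u_mul_v_pow (j : ℕ) : u * v ^ j = ζ ^ j • (v ^ j * u) := by
  induction j with
  | zero => simp
  | succ j ih =>
    rw [pow_succ, ← mul_assoc, ih, smul_mul_assoc, mul_assoc, h.comm, mul_smul_comm, smul_smul,
      ← mul_assoc, ← pow_succ]

theorem u_pow_mul_v_pow (i j : ℕ) : u ^ i * v ^ j = ζ ^ (i * j) • (v ^ j * u ^ i) := by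
  induction i with
  | zero => simp
  | succ i ih =>
    rw [pow_succ', mul_assoc, ih, mul_smul_comm, ← mul_assoc, h.u_mul_v_pow, smul_mul_assoc,
      smul_smul, mul_assoc, ← pow_succ', ← pow_add]
    congr 2
    ring

theorem isUnit_u (hn : n ≠ 0) (ha : IsUnit a) : IsUnit u :=
  (isUnit_pow_iff hn).1 (h.u_pow ▸ ha.map (algebraMap R D))

theorem isUnit_v (hn : n ≠ 0) (hb : IsUnit b) : IsUnit v :=
  (isUnit_pow_iff hn).1 (h.v_pow ▸ hb.map (algebraMap R D))

theorem u_pow_mod (i : ℕ) : u ^ i = a ^ (i / n) • u ^ (i % n) := by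
  conv_lhs => rw [← Nat.div_add_mod i n, pow_add, pow_mul, h.u_pow, ← map_pow, ← Algebra.smul_def]

theorem v_pow_mod (i : ℕ) : v ^ i = b ^ (i / n) • v ^ (i % n) := by
  conv_lhs => rw [← Nat.div_add_mod i n, pow_add, pow_mul, h.v_pow, ← map_pow, ← Algebra.smul_def]

theorem span_fin_eq_top (hn : n ≠ 0) :
    Submodule.span R (Set.range fun m : Fin n × Fin n ↦ u ^ (m.1 : ℕ) * v ^ (m.2 : ℕ)) = ⊤ := by
  rw [eq_top_iff, ← h.span_eq_top, Submodule.span_le]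
  rintro _ ⟨⟨i, j⟩, rfl⟩
  dsimp only
  rw [h.u_pow_mod i, h.v_pow_mod j, smul_mul_smul_comm]
  exact Submodule.smul_mem _ _ (Submodule.subset_span
    ⟨(⟨i % n, Nat.mod_lt _ (by omega)⟩, ⟨j % n, Nat.mod_lt _ (by omega)⟩), rfl⟩)

theorem finite (hn : n ≠ 0) : Module.Finite R D :=
  ⟨h.span_fin_eq_top hn ▸ Submodule.fg_span (Set.finite_range _)⟩

/-- A linear map that commutes with right multiplication by `u` and `v` is right `D`-linear. -/
theorem map_eq_map_one_mul {π : D →ₗ[R] D} (hu : ∀ x, π (x * u) = π x * u)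
    (hv : ∀ x, π (x * v) = π x * v) (x : D) : π x = π 1 * x := by
  have hpow (w : D) (hw : ∀ x, π (x * w) = π x * w) (i : ℕ) (x : D) :
      π (x * w ^ i) = π x * w ^ i := by
    induction i with
    | zero => simp
    | succ i ih => rw [pow_succ, ← mul_assoc, hw, ih, mul_assoc]
  have hx : x ∈ Submodule.span R (Set.range fun m : ℕ × ℕ ↦ u ^ m.1 * v ^ m.2) :=
    h.span_eq_top ▸ Submodule.mem_top
  induction hx using Submodule.span_induction with
  | mem x hx =>
    obtain ⟨⟨i, j⟩, rfl⟩ := hx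
    have := hpow u hu i 1
    rw [one_mul] at this
    rw [hpow v hv, this, mul_assoc]
  | zero => simp
  | add x y _ _ hx hy => rw [map_add, hx, hy, mul_add]
  | smul r x _ hx => rw [map_smul, hx, mul_smul_comm]

end CommRing

end IsSymbol

section Average

variable {R D : Type*} [CommRing R] [Ring D] [Algebra R D]

/-- The sum of the translates of a linear map `π` by the first `n` powers of `w`. -/
noncomputable def average (n : ℕ) (w : Dˣ) (π : D →ₗ[R] D) : D →ₗ[R] D :=
  ∑ j ∈ Finset.range n, LinearMap.mulRight R (↑(w⁻¹ ^ j) : D) ∘ₗ π ∘ₗ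
    LinearMap.mulRight R (↑(w ^ j) : D)

theorem average_apply (n : ℕ) (w : Dˣ) (π : D →ₗ[R] D) (x : D) :
    average n w π x = ∑ j ∈ Finset.range n, π (x * ↑(w ^ j)) * ↑(w⁻¹ ^ j) := by
  simp [average]

/-- Right multiplication by `w` shifts the index of the sum, which is cyclic because `w ^ n` is a
scalar. -/
theorem average_mul {n : ℕ} {w : Dˣ} {a : R} (hw : (w : D) ^ n = algebraMap R D a)
    (π : D →ₗ[R] D) (x : D) : average n w π (x * w) = average n w π x * w := by
  let f (j : ℕ) : D := π (x * ↑(w ^ j)) * ↑(w⁻¹ ^ j)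
  have hfn : f n = f 0 := by
    have h1 : (↑(w ^ n) : D) = algebraMap R D a := by rw [Units.val_pow_eq_pow_val, hw]
    simp only [f, h1, ← Algebra.commutes a x, ← Algebra.smul_def, map_smul, pow_zero, Units.val_one,
      mul_one]
    rw [Algebra.smul_def, Algebra.commutes, ← h1, mul_assoc, inv_pow, Units.mul_inv, mul_one]
  have hsum : ∑ j ∈ Finset.range n, f (j + 1) = ∑ j ∈ Finset.range n, f j := by
    have := Finset.sum_range_succ f n
    rw [Finset.sum_range_succ', hfn] at this
    exact add_right_cancel this
  rw [average_apply, average_apply, ← hsum, Finset.sum_mul]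
  refine Finset.sum_congr rfl fun j _ ↦ ?_
  simp only [f]
  rw [mul_assoc, mul_assoc, ← Units.val_mul, ← Units.val_mul, ← pow_succ', pow_succ w⁻¹,
    inv_mul_cancel_right]

/-- The factors `ζ ^ j` from moving `v` past `w ^ j` and then past its inverse cancel. Averaging
over `w` therefore preserves linearity already obtained for `v`. -/
theorem average_mul_of_comm {n : ℕ} {w : Dˣ} {v : D} {ζ : R} (hv : v * w = ζ • (w * v))
    {π : D →ₗ[R] D} (hπ : ∀ x, π (x * v) = π x * v) (x : D) :
    average n w π (x * v) = average n w π x * v := by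
  have hvj (j : ℕ) : v * ↑(w ^ j) = ζ ^ j • (↑(w ^ j) * v) := by
    induction j with
    | zero => simp
    | succ j ih =>
      rw [pow_succ, Units.val_mul, ← mul_assoc, ih, smul_mul_assoc, mul_assoc, hv, mul_smul_comm,
        smul_smul, ← mul_assoc, ← pow_succ]
  rw [average_apply, average_apply, Finset.sum_mul]
  refine Finset.sum_congr rfl fun j _ ↦ ?_
  rw [mul_assoc, hvj, mul_smul_comm, map_smul, ← mul_assoc, hπ, smul_mul_assoc, mul_assoc,
    mul_assoc, ← mul_smul_comm]
  congr 1
  have := congr_arg (fun z : D ↦ (↑(w⁻¹ ^ j) : D) * z * (↑(w⁻¹ ^ j) : D)) (hvj j)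
  simp only [mul_smul_comm, smul_mul_assoc] at this
  rw [inv_pow] at this ⊢
  rw [mul_assoc, mul_assoc, Units.mul_inv, mul_one, Units.inv_mul_cancel_left] at this
  exact this.symm

theorem average_mem {n : ℕ} {w : Dˣ} {I : Submodule R D} (hI : ∀ x ∈ I, ∀ c, x * c ∈ I)
    {π : D →ₗ[R] D} (hπ : ∀ x, π x ∈ I) (x : D) : average n w π x ∈ I := by
  rw [average_apply]
  exact sum_mem fun j _ ↦ hI _ (hπ _) _

theorem average_eq_smul {n : ℕ} {w : Dˣ} {I : Submodule R D} (hI : ∀ x ∈ I, ∀ c, x * c ∈ I)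
    {π : D →ₗ[R] D} {m : ℕ} (hπ : ∀ x ∈ I, π x = m • x) {x : D} (hx : x ∈ I) :
    average n w π x = (n * m) • x := by
  rw [average_apply, Finset.sum_congr rfl fun j _ ↦ (by
    rw [hπ _ (hI _ hx _), smul_mul_assoc, mul_assoc, inv_pow, Units.mul_inv, mul_one] :
    π (x * ↑(w ^ j)) * ↑(w⁻¹ ^ j) = m • x)]
  simp [mul_smul]

/-- A right ideal of a symbol algebra that is a direct summand is generated by an idempotent. -/
theorem IsSymbol.exists_isIdempotentElem {n : ℕ} {ζ a b : R} {u v : D}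
    (h : IsSymbol n ζ a b u v) (hn : IsUnit (n : R)) (hn0 : n ≠ 0) (hζ : IsUnit ζ) (ha : IsUnit a)
    (hb : IsUnit b) {I : Submodule R D} (hI : ∀ x ∈ I, ∀ c, x * c ∈ I)
    [Module.Projective R (D ⧸ I)] :
    ∃ e : D, IsIdempotentElem e ∧ I = LinearMap.range (LinearMap.mulLeft R e) := by
  obtain ⟨s, hs⟩ := Module.projective_lifting_property I.mkQ LinearMap.id I.mkQ_surjective
  -- A splitting of the quotient map gives an `R`-linear projection onto `I`; two averages make it
  -- right `D`-linear, at the cost of a factor `n²` on `I`.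
  let π₀ : D →ₗ[R] D := LinearMap.id - s ∘ₗ I.mkQ
  have hπ₀ (x : D) : π₀ x ∈ I := by
    rw [← Submodule.Quotient.mk_eq_zero, ← Submodule.mkQ_apply]
    have := LinearMap.congr_fun hs (I.mkQ x)
    simp only [LinearMap.comp_apply, LinearMap.id_apply] at this
    simp only [π₀, LinearMap.sub_apply, LinearMap.comp_apply, LinearMap.id_apply, map_sub, this,
      sub_self]
  have hπ₀' (x : D) (hx : x ∈ I) : π₀ x = 1 • x := by
    have : I.mkQ x = 0 := by simpa using hx
    simp [π₀, this]
  obtain ⟨u', hu'⟩ := h.isUnit_u hn0 ha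
  obtain ⟨v', hv'⟩ := h.isUnit_v hn0 hb
  obtain ⟨m, hm⟩ := hn
  obtain ⟨z, hz⟩ := hζ
  have hcomm : v * u = (↑z⁻¹ : R) • (u * v) := by
    rw [h.comm, ← hz, smul_smul, Units.inv_mul, one_smul]
  let π₁ := average n v' π₀
  let π₂ := average n u' π₁
  have hπ₁ (x : D) : π₁ (x * v) = π₁ x * v := hv' ▸ average_mul (hv' ▸ h.v_pow) π₀ x
  have hπ₂v (x : D) : π₂ (x * v) = π₂ x * v :=
    average_mul_of_comm (ζ := ↑z⁻¹) (by rw [hu', hcomm]) hπ₁ x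
  have hπ₂u (x : D) : π₂ (x * u) = π₂ x * u := hu' ▸ average_mul (hu' ▸ h.u_pow) π₁ x
  have hπ₂ (x : D) : π₂ x ∈ I := average_mem hI (average_mem hI hπ₀) x
  have hπ₂' (x : D) (hx : x ∈ I) : π₂ x = ((m * m : Rˣ) : R) • x := by
    rw [show π₂ x = _ from average_eq_smul hI (fun x hx ↦ average_eq_smul hI hπ₀' hx) hx]
    rw [← Nat.cast_smul_eq_nsmul R]
    simp [hm]
  -- A right linear map is left multiplication by its value at `1`; dividing by `n²` makes this
  -- value act as the identity on `I`.
  let e : D := (↑(m * m)⁻¹ : R) • π₂ 1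
  have he : e ∈ I := I.smul_mem _ (hπ₂ 1)
  have hex (x : D) (hx : x ∈ I) : e * x = x := by
    rw [smul_mul_assoc, ← h.map_eq_map_one_mul hπ₂u hπ₂v, hπ₂' x hx, smul_smul, Units.inv_mul,
      one_smul]
  refine ⟨e, hex e he, le_antisymm (fun x hx ↦ ⟨x, hex x hx⟩) ?_⟩
  rintro _ ⟨x, rfl⟩
  exact hI e he x

end Average

end Symbol

/-! ### Symbol algebras over a field: dimension, primeness, and the surjectivity at the heart of
smoothness -/

section SymbolField

variable {k D : Type*} [Field k] [Ring D] [Algebra k D] {n : ℕ}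

/-- The projection, up to the factor `n`, to the elements on which conjugation by `w` acts by
`χ⁻¹`. -/
noncomputable def fourier (n : ℕ) (w : Dˣ) (χ : k) : D →ₗ[k] D :=
  ∑ s ∈ Finset.range n, χ ^ s •
    (LinearMap.mulLeft k (↑(w ^ s) : D) ∘ₗ LinearMap.mulRight k (↑(w⁻¹ ^ s) : D))

theorem fourier_apply (w : Dˣ) (χ : k) (z : D) :
    fourier n w χ z = ∑ s ∈ Finset.range n, χ ^ s • (↑(w ^ s) * (z * ↑(w⁻¹ ^ s))) := by
  simp [fourier]

theorem fourier_eq_of_comm {w : Dˣ} {χ θ : k} {z : D} (hz : w * z = θ • (z * w)) :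
    fourier n w χ z = (∑ s ∈ Finset.range n, (χ * θ) ^ s) • z := by
  have hs (s : ℕ) : ↑(w ^ s) * z = θ ^ s • (z * ↑(w ^ s)) := by
    induction s with
    | zero => simp
    | succ s ih =>
      rw [pow_succ', Units.val_mul, mul_assoc, ih, mul_smul_comm, ← mul_assoc, hz, smul_mul_assoc,
        smul_smul, mul_assoc, ← pow_succ]
  rw [fourier_apply, Finset.sum_smul]
  refine Finset.sum_congr rfl fun s _ ↦ ?_
  rw [← mul_assoc, hs, smul_mul_assoc, mul_assoc, inv_pow, Units.mul_inv, mul_one, smul_smul,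
    mul_pow]

theorem fourier_mem {J : Submodule k D} (hJ : ∀ x, ∀ z ∈ J, ∀ y, x * (z * y) ∈ J) (w : Dˣ) (χ : k)
    {z : D} (hz : z ∈ J) : fourier n w χ z ∈ J := by
  rw [fourier_apply]
  exact sum_mem fun s _ ↦ J.smul_mem _ (hJ _ _ hz _)

/-- Orthogonality of the characters of the cyclic group of order `n`. -/
theorem sum_pow_eq_ite {ζ : k} (hζ : IsPrimitiveRoot ζ n) {i j : ℕ} (hi : i < n) (hj : j < n) :
    ∑ s ∈ Finset.range n, ((ζ⁻¹) ^ j * ζ ^ i) ^ s = if i = j then (n : k) else 0 := by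
  have hζ0 : ζ ≠ 0 := hζ.ne_zero (by omega)
  split_ifs with h
  · subst h
    rw [← mul_pow, inv_mul_cancel₀ hζ0]
    simp
  · have h1 : (ζ⁻¹) ^ j * ζ ^ i ≠ 1 := by
      intro h1
      rw [inv_pow, inv_mul_eq_one₀ (pow_ne_zero _ hζ0)] at h1
      exact h (hζ.pow_inj hj hi h1).symm
    have h2 := geom_sum_mul ((ζ⁻¹) ^ j * ζ ^ i) n
    have h3 : ((ζ⁻¹) ^ j * ζ ^ i) ^ n = 1 := by
      rw [mul_pow, ← pow_mul, ← pow_mul, mul_comm j, mul_comm i, pow_mul, pow_mul, inv_pow,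
        hζ.pow_eq_one]
      simp
    rw [h3, sub_self, mul_eq_zero, sub_eq_zero] at h2
    exact h2.resolve_right h1

theorem natCast_ne_zero_of_isPrimitiveRoot {ζ : k} (hζ : IsPrimitiveRoot ζ n) (hn : n ≠ 0) :
    (n : k) ≠ 0 := by
  have : NeZero n := ⟨hn⟩
  exact hζ.neZero'.out

namespace IsSymbol

variable {ζ a b : k} {u v : D} (h : IsSymbol n ζ a b u v) (hζ : IsPrimitiveRoot ζ n) (hn : n ≠ 0)
  (ha : a ≠ 0) (hb : b ≠ 0)

include h hζ hn ha hb

/-- The projection, up to the factor `n²`, to the span of a monomial in `u` and `v`. -/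
theorem exists_monomial_projection (m : Fin n × Fin n) : ∃ φ : D →ₗ[k] D,
    (∀ m' : Fin n × Fin n, φ (u ^ (m'.1 : ℕ) * v ^ (m'.2 : ℕ)) =
      if m' = m then ((n : k) * n) • (u ^ (m.1 : ℕ) * v ^ (m.2 : ℕ)) else 0) ∧
    ∀ J : Submodule k D, (∀ x, ∀ z ∈ J, ∀ y, x * (z * y) ∈ J) → ∀ z ∈ J, φ z ∈ J := by
  obtain ⟨u', hu'⟩ := h.isUnit_u hn ha.isUnit
  obtain ⟨v', hv'⟩ := h.isUnit_v hn hb.isUnit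
  refine ⟨fourier n v'⁻¹ (ζ⁻¹ ^ (m.1 : ℕ)) ∘ₗ fourier n u' (ζ⁻¹ ^ (m.2 : ℕ)), fun m' ↦ ?_,
    fun J hJ z hz ↦ fourier_mem hJ _ _ (fourier_mem hJ _ _ hz)⟩
  -- Monomials are simultaneous eigenvectors: conjugation by `u` detects the exponent of `v`, and
  -- conjugation by `v⁻¹` that of `u`.
  have e1 : ↑u' * (u ^ (m'.1 : ℕ) * v ^ (m'.2 : ℕ)) =
      ζ ^ (m'.2 : ℕ) • (u ^ (m'.1 : ℕ) * v ^ (m'.2 : ℕ) * ↑u') := by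
    rw [hu', ← mul_assoc, ← pow_succ', pow_succ, mul_assoc, h.u_mul_v_pow, mul_smul_comm, mul_assoc]
  have e2 : ↑v'⁻¹ * (u ^ (m'.1 : ℕ) * v ^ (m'.2 : ℕ)) =
      ζ ^ (m'.1 : ℕ) • (u ^ (m'.1 : ℕ) * v ^ (m'.2 : ℕ) * ↑v'⁻¹) := by
    have h1 := h.u_pow_mul_v_pow m'.1 1
    rw [mul_one, pow_one] at h1
    have h2 : u ^ (m'.1 : ℕ) * v ^ (m'.2 : ℕ) * v =
        ζ ^ (m'.1 : ℕ) • (v * (u ^ (m'.1 : ℕ) * v ^ (m'.2 : ℕ))) := by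
      rw [mul_assoc, ← pow_succ, pow_succ', ← mul_assoc, h1, smul_mul_assoc, mul_assoc]
    rw [Units.inv_mul_eq_iff_eq_mul, mul_smul_comm, ← mul_assoc, ← smul_mul_assoc, hv', ← h2, ← hv',
      Units.mul_inv_cancel_right]
  rw [LinearMap.comp_apply, fourier_eq_of_comm e1, map_smul, fourier_eq_of_comm e2,
    sum_pow_eq_ite hζ m'.1.2 m.1.2, sum_pow_eq_ite hζ m'.2.2 m.2.2, smul_smul]
  by_cases hm : m' = m
  · subst hm; simp
  · rw [if_neg hm]
    by_cases h1 : (m'.1 : ℕ) = m.1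
    · have h2 : (m'.2 : ℕ) ≠ m.2 := fun h2 ↦ hm (Prod.ext (Fin.ext h1) (Fin.ext h2))
      simp [h2]
    · simp [h1]

omit hζ in
theorem monomial_isUnit (i j : ℕ) : IsUnit (u ^ i * v ^ j) :=
  ((h.isUnit_u hn ha.isUnit).pow i).mul ((h.isUnit_v hn hb.isUnit).pow j)

theorem linearIndependent_monomial [Nontrivial D] :
    LinearIndependent k fun m : Fin n × Fin n ↦ u ^ (m.1 : ℕ) * v ^ (m.2 : ℕ) := by
  rw [Fintype.linearIndependent_iff]
  intro g hg m
  obtain ⟨φ, hφ, -⟩ := h.exists_monomial_projection hζ hn ha hb m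
  have h1 := congr_arg φ hg
  simp only [map_sum, map_smul, hφ, map_zero, smul_ite, smul_zero, Finset.sum_ite_eq',
    Finset.mem_univ, if_true, smul_smul] at h1
  have h2 := (smul_eq_zero.1 h1).resolve_right
    (h.monomial_isUnit hn ha hb _ _).ne_zero
  have hn' := natCast_ne_zero_of_isPrimitiveRoot hζ hn
  exact (mul_eq_zero.1 h2).resolve_right (mul_ne_zero hn' hn')

theorem finrank_eq [Nontrivial D] : Module.finrank k D = n * n := by
  let B := Module.Basis.mk (h.linearIndependent_monomial hζ hn ha hb) (h.span_fin_eq_top hn).ge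
  rw [Module.finrank_eq_card_basis B]
  simp

/-- A symbol algebra over a field is a prime ring. -/
theorem eq_zero_of_forall_mul_mul_eq_zero {c e : D} (hce : ∀ x, c * x * e = 0) (he : e ≠ 0) :
    c = 0 := by
  -- `J` is a two-sided ideal containing `e`. Projecting `e` to a monomial with nonzero coefficient
  -- puts a unit into `J`, which kills `c`.
  let J : Submodule k D :=
    { carrier := {z | ∀ x, c * x * z = 0}
      add_mem' := fun hx hy z ↦ by rw [mul_add, hx, hy, add_zero]
      zero_mem' := fun x ↦ mul_zero _
      smul_mem' := fun r x hx z ↦ by rw [mul_smul_comm, hx, smul_zero] }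
  have hJ : ∀ x, ∀ z ∈ J, ∀ y, x * (z * y) ∈ J := fun x z hz y t ↦ by
    have := hz (t * x)
    rw [← mul_assoc, ← mul_assoc, mul_assoc c t x, this, zero_mul]
  have heJ : e ∈ J := hce
  have hes : e ∈ Submodule.span k (Set.range fun m : Fin n × Fin n ↦
      u ^ (m.1 : ℕ) * v ^ (m.2 : ℕ)) := h.span_fin_eq_top hn ▸ Submodule.mem_top
  obtain ⟨g, hg⟩ := (Submodule.mem_span_range_iff_exists_fun k).1 hes
  obtain ⟨m, hm⟩ : ∃ m, g m ≠ 0 := by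
    by_contra! hg0
    exact he (by rw [← hg]; simp [hg0])
  obtain ⟨φ, hφ, hφJ⟩ := h.exists_monomial_projection hζ hn ha hb m
  have h1 := hφJ J hJ e heJ
  rw [← hg] at h1
  simp only [map_sum, map_smul, hφ, smul_ite, smul_zero, Finset.sum_ite_eq',
    Finset.mem_univ, if_true, smul_smul] at h1
  have hn' := natCast_ne_zero_of_isPrimitiveRoot hζ hn
  rw [J.smul_mem_iff (mul_ne_zero hm (mul_ne_zero hn' hn'))] at h1
  have h2 := h1 1
  rw [mul_one] at h2
  exact ((h.monomial_isUnit hn ha hb _ _).mul_left_eq_zero).1 h2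

/-- The corner ring of an idempotent of reduced rank one consists of scalars. -/
theorem exists_mul_mul_eq_smul {e : D} (he0 : e ≠ 0)
    (hrank : Module.finrank k (LinearMap.range (LinearMap.mulLeft k e)) = n) (x : D) :
    ∃ r : k, e * x * e = r • e := by
  have : Nontrivial D := ⟨e, 0, he0⟩
  have := h.finite hn
  let V := LinearMap.range (LinearMap.mulLeft k e)
  have heV (y : D) : e * y ∈ V := ⟨y, rfl⟩
  -- `D` acts on `V = eD` by right multiplication, faithfully by primeness. Both sides have
  -- dimension `n²`, so every endomorphism of `V` arises this way.
  let ρ : D →ₗ[k] Module.End k V :=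
    { toFun z := (LinearMap.mulRight k z).restrict (p := V) (q := V) (by
        rintro _ ⟨y, rfl⟩
        exact ⟨y * z, (mul_assoc _ _ _).symm⟩)
      map_add' z z' := by ext y; simp [mul_add]
      map_smul' r z := by ext y; simp }
  have hρ (z : D) (y : V) : (ρ z y : D) = y * z := rfl
  have hinj : Function.Injective ρ := by
    rw [injective_iff_map_eq_zero]
    intro z hz
    by_contra hz0
    refine he0 (h.eq_zero_of_forall_mul_mul_eq_zero hζ hn ha hb (fun y ↦ ?_) hz0)
    rw [← hρ z ⟨e * y, heV y⟩, hz]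
    rfl
  have hdim : Module.finrank k D = Module.finrank k (Module.End k V) := by
    rw [Module.finrank_linearMap k k, h.finrank_eq hζ hn ha hb, hrank]
  have hsurj : Function.Surjective ρ :=
    (LinearMap.injective_iff_surjective_of_finrank_eq_finrank
      (K := k) (V := D) (V₂ := Module.End k V) hdim (f := ρ)).1 hinj
  let T : Module.End k V := (LinearMap.mulLeft k (e * x)).restrict (p := V) (q := V) (by
    rintro _ ⟨y, rfl⟩
    exact ⟨x * (e * y), (mul_assoc _ _ _).symm⟩)
  -- Left and right multiplications commute, so `T` is central, hence a scalar; evaluating it at `e`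
  -- gives the claim.
  have hT : T ∈ Set.center (Module.End k V) := by
    rw [Semigroup.mem_center_iff]
    intro φ
    obtain ⟨z, rfl⟩ := hsurj φ
    ext y
    exact mul_assoc _ _ _
  obtain ⟨r, _, hr⟩ := Module.End.mem_center_iff.1 hT
  refine ⟨r, ?_⟩
  have h2 := congr_arg Subtype.val (LinearMap.congr_fun hr ⟨e, 1, mul_one e⟩)
  exact h2

/-- Since `gDe` is a line, failure of surjectivity is one linear relation between the two
components. It makes `g` and `e` left and right eigenvectors of `u` with a common eigenvalue, which
together with `ge = 0` kills `gDe`. -/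
theorem surjective_of_mul_eq_zero {e g : D} (he : IsIdempotentElem e) (hg : IsIdempotentElem g)
    (he0 : e ≠ 0) (hg0 : g ≠ 0)
    (herank : Module.finrank k (LinearMap.range (LinearMap.mulLeft k e)) = n)
    (hgrank : Module.finrank k (LinearMap.range (LinearMap.mulLeft k g)) = n) (hge : g * e = 0)
    (p q : D) : ∃ x y, g * (x - y) * e = g * p * e ∧ g * (u * x - y * u) * e = g * q * e := by
  have prime {c e : D} := h.eq_zero_of_forall_mul_mul_eq_zero (c := c) (e := e) hζ hn ha hb
  -- `g D e` is spanned by one element `m`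
  obtain ⟨x₀, hm0⟩ : ∃ x, g * x * e ≠ 0 := by
    by_contra! hcon
    exact hg0 (prime hcon he0)
  set m := g * x₀ * e with hm
  have hme : m * e = m := by rw [hm, mul_assoc, he.eq]
  have hgm : g * m = m := by rw [hm, ← mul_assoc, ← mul_assoc, hg.eq]
  obtain ⟨y₀, hy₀⟩ : ∃ y, m * y * g ≠ 0 := by
    by_contra! hcon
    exact hm0 (prime hcon hg0)
  obtain ⟨r, hr⟩ := h.exists_mul_mul_eq_smul hζ hn ha hb hg0 hgrank (m * y₀)
  rw [← mul_assoc, hgm] at hr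
  have hr0 : r ≠ 0 := by
    rintro rfl
    exact hy₀ (by rw [hr, zero_smul])
  -- With `m y₀ g = r g`, one has `r gze = m (e y₀ g z e)`, and the corner `eDe` is scalar.
  have hline (z : D) : ∃ t : k, g * z * e = t • m := by
    obtain ⟨t, ht⟩ := h.exists_mul_mul_eq_smul hζ hn ha hb he0 herank (y₀ * g * z)
    refine ⟨r⁻¹ * t, ?_⟩
    have h1 : r • (g * z * e) = t • m := by
      rw [← smul_mul_assoc, ← smul_mul_assoc, ← hr, ← hme, ← mul_smul_comm, ← ht]
      simp only [mul_assoc]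
    rw [mul_smul, ← h1, inv_smul_smul₀ hr0]
  choose θ hθ using hline
  let θₗ : D →ₗ[k] k :=
    { toFun := θ
      map_add' x y := by
        apply smul_left_injective k hm0
        dsimp only
        rw [← hθ, add_smul, ← hθ, ← hθ, mul_add, add_mul]
      map_smul' t x := by
        apply smul_left_injective k hm0
        dsimp only
        rw [← hθ, RingHom.id_apply, smul_assoc, ← hθ, mul_smul_comm, smul_mul_assoc] }
  let Ψ : D × D →ₗ[k] k × k := LinearMap.prod
    (θₗ ∘ₗ (LinearMap.fst k D D - LinearMap.snd k D D))
    (θₗ ∘ₗ (LinearMap.mulLeft k u ∘ₗ LinearMap.fst k D D -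
      LinearMap.mulRight k u ∘ₗ LinearMap.snd k D D))
  have hΨ (x y : D) : Ψ (x, y) = (θ (x - y), θ (u * x - y * u)) := rfl
  by_cases hsurj : LinearMap.range Ψ = ⊤
  · obtain ⟨⟨x, y⟩, hxy⟩ := LinearMap.range_eq_top.1 hsurj (θ p, θ q)
    rw [hΨ, Prod.mk.injEq] at hxy
    exact ⟨x, y, by rw [hθ, hxy.1, ← hθ], by rw [hθ, hxy.2, ← hθ]⟩
  · exfalso
    obtain ⟨f, hf0, hf⟩ := Submodule.exists_le_ker_of_lt_top _ (lt_top_iff_ne_top.2 hsurj)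
    set s := f (1, 0)
    set t := f (0, 1)
    have hfst (α β : k) : f (α, β) = α * s + β * t := by
      have : ((α, β) : k × k) = α • (1, 0) + β • (0, 1) := by simp
      rw [this, map_add, map_smul, map_smul, smul_eq_mul, smul_eq_mul]
    have hker (x y : D) : s • (g * (x - y) * e) + t • (g * (u * x - y * u) * e) = 0 := by
      have := hf ⟨(x, y), rfl⟩
      rw [LinearMap.mem_ker, hΨ, hfst] at this
      rw [hθ, hθ, smul_smul, smul_smul, ← add_smul, mul_comm s, mul_comm t, this, zero_smul]
    -- Setting `y = 0`, and then `x = 0` below, separates the relation into one on `g` and one on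
    -- `e`.
    have hl : s • g + t • (g * u) = 0 := prime (fun x ↦ by
      have := hker x 0
      simp only [sub_zero, zero_mul] at this
      rw [add_mul, add_mul, smul_mul_assoc, smul_mul_assoc, smul_mul_assoc, smul_mul_assoc,
        mul_assoc g u x, this]) he0
    have hr' : s • e + t • (u * e) = 0 := by
      by_contra hcon
      refine hg0 (prime (fun y ↦ ?_) hcon)
      have := hker 0 (-y)
      simp only [zero_sub, neg_neg, mul_zero, neg_mul] at this
      rw [mul_add, mul_smul_comm, mul_smul_comm, ← mul_assoc, mul_assoc g y u, this]
    have ht : t ≠ 0 := by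
      intro ht
      rw [ht, zero_smul, add_zero] at hl
      have hs := (smul_eq_zero.1 hl).resolve_right hg0
      apply hf0
      ext <;> simp only [LinearMap.comp_apply, LinearMap.inl_apply, LinearMap.inr_apply, hfst, hs, ht]
        <;> simp
    set l := -(t⁻¹ * s)
    have hgu : g * u = l • g := by
      rw [neg_smul, mul_smul, eq_neg_of_add_eq_zero_left hl, smul_neg, neg_neg, inv_smul_smul₀ ht]
    have hue : u * e = l • e := by
      rw [neg_smul, mul_smul, eq_neg_of_add_eq_zero_left hr', smul_neg, neg_neg,
        inv_smul_smul₀ ht]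
    have hl0 : l ≠ 0 := by
      intro hl0
      rw [hl0, zero_smul, (h.isUnit_u hn ha.isUnit).mul_right_eq_zero] at hue
      exact he0 hue
    have hgui (i : ℕ) : g * u ^ i = l ^ i • g := by
      induction i with
      | zero => simp
      | succ i ih => rw [pow_succ, ← mul_assoc, ih, smul_mul_assoc, hgu, smul_smul, ← pow_succ]
    -- Evaluate `g u v^j e` by letting `u` act on `g`, or by moving it through `v^j` onto `e`: the
    -- results differ by the factor `ζ ^ j`.
    have hgv (j : ℕ) : g * v ^ j * e = 0 := by
      have hc : l • (g * v ^ j * e) = (ζ ^ j * l) • (g * v ^ j * e) := by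
        rw [← smul_mul_assoc, ← smul_mul_assoc, ← hgu, mul_assoc g u, h.u_mul_v_pow, mul_smul_comm,
          smul_mul_assoc, mul_smul, ← mul_smul_comm l, ← hue]
        simp only [mul_assoc]
      rw [← sub_eq_zero, ← sub_smul, smul_eq_zero] at hc
      rcases hc with hc | hc
      · rw [sub_eq_zero, eq_comm, mul_eq_right₀ hl0, hζ.pow_eq_one_iff_dvd] at hc
        obtain ⟨i, rfl⟩ := hc
        rw [pow_mul, h.v_pow, ← map_pow, ← Algebra.commutes, mul_assoc, hge, mul_zero]
      · exact hc
    refine hg0 (prime (fun x ↦ ?_) he0)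
    have hx : x ∈ Submodule.span k (Set.range fun m : ℕ × ℕ ↦ u ^ m.1 * v ^ m.2) :=
      h.span_eq_top ▸ Submodule.mem_top
    induction hx using Submodule.span_induction with
    | mem x hx =>
      obtain ⟨⟨i, j⟩, rfl⟩ := hx
      dsimp only
      rw [← mul_assoc, hgui, smul_mul_assoc, smul_mul_assoc, hgv, smul_zero]
    | zero => simp
    | add x y _ _ hx hy => rw [mul_add, add_mul, hx, hy, add_zero]
    | smul r x _ hx => rw [mul_smul_comm, smul_mul_assoc, hx, smul_zero]

end IsSymbol

end SymbolField

/-! ### The cyclic algebra as a symbol algebra, and base change -/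

section CyclicAlgebra

variable {F : Type u} [Field F] (n : ℕ) (ζ a b : F)

/-- The generator `v` of the cyclic algebra. -/
noncomputable def cyclicV : CyclicAlgebra n ζ a b :=
  RingQuot.mkAlgHom F (CyclicRel n ζ a b) (FreeAlgebra.ι F Gen.v)

/-- The span of the monomials contains `1` and is stable under right multiplication by both
generators, hence is everything. Invertibility of `ζ` is what moves `u` leftwards past powers of
`v`. -/
theorem cyclicAlgebra_isSymbol (hζ : ζ ≠ 0) :
    IsSymbol n ζ a b (cyclicU n ζ a b) (cyclicV n ζ a b) := by
  have hcomm : cyclicU n ζ a b * cyclicV n ζ a b = ζ • (cyclicV n ζ a b * cyclicU n ζ a b) := by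
    have := RingQuot.mkAlgHom_rel F (CyclicRel.comm (n := n) (ζ := ζ) (a := a) (b := b))
    simp only [map_mul, map_smul] at this
    exact this
  have hcomm' : cyclicV n ζ a b * cyclicU n ζ a b = ζ⁻¹ • (cyclicU n ζ a b * cyclicV n ζ a b) := by
    rw [hcomm, inv_smul_smul₀ hζ]
  refine ⟨?_, ?_, hcomm, ?_⟩
  · have := RingQuot.mkAlgHom_rel F (CyclicRel.u_pow (n := n) (ζ := ζ) (a := a) (b := b))
    rwa [map_pow, AlgHom.commutes] at this
  · have := RingQuot.mkAlgHom_rel F (CyclicRel.v_pow (n := n) (ζ := ζ) (a := a) (b := b))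
    rwa [map_pow, AlgHom.commutes] at this
  · set U := cyclicU n ζ a b
    set V := cyclicV n ζ a b
    set M := Submodule.span F (Set.range fun m : ℕ × ℕ ↦ U ^ m.1 * V ^ m.2)
    have hmem (i j : ℕ) : U ^ i * V ^ j ∈ M := Submodule.subset_span ⟨(i, j), rfl⟩
    have hVU (j : ℕ) : V ^ j * U = ζ⁻¹ ^ j • (U * V ^ j) := by
      induction j with
      | zero => simp
      | succ j ih =>
        rw [pow_succ, mul_assoc, hcomm', mul_smul_comm, ← mul_assoc, ih, smul_mul_assoc, smul_smul,
          mul_assoc, ← pow_succ']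
    have hU : ∀ x ∈ M, x * U ∈ M := fun x hx ↦ by
      induction hx using Submodule.span_induction with
      | mem x hx =>
        obtain ⟨⟨i, j⟩, rfl⟩ := hx
        dsimp only
        rw [mul_assoc, hVU, mul_smul_comm, ← mul_assoc, ← pow_succ]
        exact M.smul_mem _ (hmem _ _)
      | zero => simp
      | add x y _ _ hx hy => rw [add_mul]; exact add_mem hx hy
      | smul r x _ hx => rw [smul_mul_assoc]; exact M.smul_mem _ hx
    have hV : ∀ x ∈ M, x * V ∈ M := fun x hx ↦ by
      induction hx using Submodule.span_induction with
      | mem x hx =>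
        obtain ⟨⟨i, j⟩, rfl⟩ := hx
        dsimp only
        rw [mul_assoc, ← pow_succ]
        exact hmem _ _
      | zero => simp
      | add x y _ _ hx hy => rw [add_mul]; exact add_mem hx hy
      | smul r x _ hx => rw [smul_mul_assoc]; exact M.smul_mem _ hx
    rw [eq_top_iff]
    rintro z -
    obtain ⟨z, rfl⟩ := RingQuot.mkAlgHom_surjective F (CyclicRel n ζ a b) z
    suffices H : ∀ x ∈ M, x * RingQuot.mkAlgHom F (CyclicRel n ζ a b) z ∈ M by
      simpa using H 1 (by simpa using hmem 0 0)
    induction z using FreeAlgebra.induction with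
    | grade0 r =>
      intro x hx
      rw [AlgHom.commutes, ← Algebra.commutes, ← Algebra.smul_def]
      exact M.smul_mem _ hx
    | grade1 g =>
      cases g with
      | u => exact hU
      | v => exact hV
    | mul y z hy hz =>
      intro x hx
      rw [map_mul, ← mul_assoc]
      exact hz _ (hy _ hx)
    | add y z hy hz =>
      intro x hx
      rw [map_add, mul_add]
      exact add_mem (hy _ hx) (hz _ hx)

end CyclicAlgebra

variable {F : Type u} [Field F] {A : Type u} [Ring A] [Algebra F A] {n : ℕ} {ζ a b : F} {u v : A}

theorem IsSymbol.baseChange (h : IsSymbol n ζ a b u v) (R : Type u) [CommRing R] [Algebra F R] :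
    IsSymbol n (algebraMap F R ζ) (algebraMap F R a) (algebraMap F R b)
      ((1 : R) ⊗ₜ[F] u) ((1 : R) ⊗ₜ[F] v) := by
  refine ⟨?_, ?_, ?_, ?_⟩
  · rw [Algebra.TensorProduct.tmul_pow, one_pow, h.u_pow, ← IsScalarTower.algebraMap_apply,
      Algebra.TensorProduct.algebraMap_apply']
  · rw [Algebra.TensorProduct.tmul_pow, one_pow, h.v_pow, ← IsScalarTower.algebraMap_apply,
      Algebra.TensorProduct.algebraMap_apply']
  · rw [Algebra.TensorProduct.tmul_mul_tmul, Algebra.TensorProduct.tmul_mul_tmul, h.comm,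
      algebraMap_smul, tmul_smul]
  · rw [eq_top_iff]
    rintro z -
    induction z using TensorProduct.induction_on with
    | zero => exact zero_mem _
    | add x y hx hy => exact add_mem hx hy
    | tmul r x =>
      rw [← mul_one r, ← smul_eq_mul, ← smul_tmul']
      refine Submodule.smul_mem _ _ ?_
      have hx : x ∈ Submodule.span F (Set.range fun m : ℕ × ℕ ↦ u ^ m.1 * v ^ m.2) :=
        h.span_eq_top ▸ Submodule.mem_top
      induction hx using Submodule.span_induction with
      | mem x hx =>
        obtain ⟨m, rfl⟩ := hx
        exact Submodule.subset_span ⟨m, by simp [Algebra.TensorProduct.tmul_pow]⟩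
      | zero => simp
      | add x y _ _ hx hy => rw [tmul_add]; exact add_mem hx hy
      | smul t x _ hx =>
        rw [tmul_smul, ← algebraMap_smul R]
        exact Submodule.smul_mem _ _ hx

/-! ### Nakayama's lemma at all maximal ideals -/

section Nakayama

variable {R M M' : Type*} [CommRing R] [AddCommGroup M] [Module R M] [AddCommGroup M'] [Module R M']

/-- Nakayama's lemma at all maximal ideals. -/
theorem le_of_forall_isMaximal_le_sup_smul {V W : Submodule R M} (hW : W.FG)
    (h : ∀ m : Ideal R, m.IsMaximal → W ≤ V ⊔ m • W) : W ≤ V := by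
  -- If this ideal were in a maximal ideal `m`, Nakayama applied to the image of `W` in `M / V`
  -- would produce an element of it congruent to `1` modulo `m`.
  let 𝔞 : Ideal R := V.colon (W : Set M)
  suffices h𝔞 : 𝔞 = ⊤ by
    intro x hx
    have : (1 : R) ∈ 𝔞 := h𝔞 ▸ Submodule.mem_top
    simpa using Submodule.mem_colon.1 this x hx
  by_contra hne
  obtain ⟨m, hm, hle⟩ := Ideal.exists_le_maximal _ hne
  have hmap : W.map V.mkQ ≤ m • W.map V.mkQ := by
    rw [← Submodule.map_smul'']
    refine (Submodule.map_mono (h m hm)).trans ?_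
    rw [Submodule.map_sup, Submodule.mkQ_map_self, bot_sup_eq]
  obtain ⟨r, hr, hrW⟩ :=
    Submodule.exists_sub_one_mem_and_smul_eq_zero_of_fg_of_le_smul m _ (hW.map _) hmap
  have hr𝔞 : r ∈ 𝔞 := by
    rw [Submodule.mem_colon]
    intro x hx
    have := hrW _ (Submodule.mem_map_of_mem hx)
    rwa [← map_smul, Submodule.mkQ_apply, Submodule.Quotient.mk_eq_zero] at this
  refine hm.ne_top ((Ideal.eq_top_iff_one _).2 ?_)
  rw [← sub_sub_cancel r 1]
  exact sub_mem (hle hr𝔞) hr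

theorem mem_smul_top_prod_iff (N : Ideal R) (x : M) (y : M') :
    (x, y) ∈ N • (⊤ : Submodule R (M × M')) ↔
      x ∈ N • (⊤ : Submodule R M) ∧ y ∈ N • (⊤ : Submodule R M') := by
  constructor
  · intro h
    have h1 := Submodule.mem_map_of_mem (f := LinearMap.fst R M M') h
    have h2 := Submodule.mem_map_of_mem (f := LinearMap.snd R M M') h
    rw [Submodule.map_smul''] at h1 h2
    exact ⟨Submodule.smul_mono le_rfl le_top h1, Submodule.smul_mono le_rfl le_top h2⟩
  · rintro ⟨h1, h2⟩
    have h1 := Submodule.mem_map_of_mem (f := LinearMap.inl R M M') h1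
    have h2 := Submodule.mem_map_of_mem (f := LinearMap.inr R M M') h2
    rw [Submodule.map_smul''] at h1 h2
    have := add_mem (Submodule.smul_mono (le_refl N) le_top h1) (Submodule.smul_mono (le_refl N) le_top h2)
    simpa using this

end Nakayama

/-! ### Right ideals generated by idempotents -/

section Idempotents

variable {F : Type u} [Field F] {A : Type u} [Ring A] [Algebra F A]
  {R S : Type u} [CommRing R] [Algebra F R] [CommRing S] [Algebra F S]

theorem span_scalarMap_range_mulLeft (f : R →ₐ[F] S) (e : R ⊗[F] A) :
    Submodule.span S (scalarMap A f ''
      (LinearMap.range (LinearMap.mulLeft R e) : Set (R ⊗[F] A))) =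
      LinearMap.range (LinearMap.mulLeft S (scalarMap A f e)) := by
  apply le_antisymm
  · rw [Submodule.span_le]
    rintro _ ⟨_, ⟨z, rfl⟩, rfl⟩
    exact ⟨scalarMap A f z, (map_mul _ _ _).symm⟩
  · rintro _ ⟨z, rfl⟩
    rw [LinearMap.mulLeft_apply]
    induction z using TensorProduct.induction_on with
    | zero => simp
    | tmul s d =>
      rw [← mul_one s, ← smul_eq_mul (a := s), ← smul_tmul', mul_smul_comm, ← scalarMap_one_tmul f, ← map_mul]
      exact Submodule.smul_mem _ _ (Submodule.subset_span ⟨_, ⟨_, rfl⟩, rfl⟩)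
    | add x y hx hy => rw [mul_add]; exact add_mem hx hy

theorem map_eq_range_mulLeft {k : ℕ} (f : R →ₐ[F] S) {I : Module.Grassmannian R (R ⊗[F] A) k}
    {e : R ⊗[F] A} (he : I.toSubmodule = LinearMap.range (LinearMap.mulLeft R e)) :
    (Module.Grassmannian.map f I).toSubmodule =
      LinearMap.range (LinearMap.mulLeft S (scalarMap A f e)) := by
  rw [map_eq_span, he, span_scalarMap_range_mulLeft]

/-- The computation of `map_eq_span` for an arbitrary submodule: it is needed before the rank of the
quotient is known. -/
theorem ker_baseChangeMkQ_eq_span [Algebra R S] [IsScalarTower F R S]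
    (I : Submodule R (R ⊗[F] A)) :
    LinearMap.ker (Module.Grassmannian.baseChangeMkQ S I) =
      Submodule.span S (scalarMap A (IsScalarTower.toAlgHom F R S) '' (I : Set (R ⊗[F] A))) := by
  have hker : LinearMap.ker (I.mkQ.baseChange S) = I.baseChange S := by
    ext x
    have h := lTensor_exact S (LinearMap.exact_subtype_mkQ I) (Submodule.mkQ_surjective _) x
    rw [LinearMap.mem_ker, Submodule.baseChange]
    exact h
  rw [Module.Grassmannian.baseChangeMkQ, LinearMap.ker_comp, hker, Submodule.baseChange_eq_span]
  have hmap : Submodule.comap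
      (AlgebraTensorModule.cancelBaseChange F R S S A).symm.toLinearMap
      (Submodule.span S (I.map (TensorProduct.mk R S (R ⊗[F] A) 1))) =
      Submodule.map (AlgebraTensorModule.cancelBaseChange F R S S A).toLinearMap
      (Submodule.span S (I.map (TensorProduct.mk R S (R ⊗[F] A) 1))) :=
    (Submodule.map_equiv_eq_comap_symm _ _).symm
  rw [hmap, Submodule.map_span]
  congr 1
  rw [Submodule.map_coe, Set.image_image]
  refine Set.image_congr fun x hx ↦ ?_
  clear hx
  induction x using TensorProduct.induction_on with
  | zero => simp
  | tmul r d => simp [Algebra.smul_def]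
  | add x y hx hy => simp only [map_add, hx, hy]

theorem projective_quotient_range_mulLeft [Module.Finite F A] {e : R ⊗[F] A}
    (he : IsIdempotentElem e) :
    Module.Projective R ((R ⊗[F] A) ⧸ LinearMap.range (LinearMap.mulLeft R e)) := by
  refine Module.Projective.of_split
    ((LinearMap.range (LinearMap.mulLeft R e)).liftQ (LinearMap.mulLeft R (1 - e)) ?_)
    (LinearMap.range (LinearMap.mulLeft R e)).mkQ ?_
  · rintro _ ⟨z, rfl⟩
    simp [← mul_assoc, sub_mul, he.eq]
  · refine Submodule.linearMap_qext _ (LinearMap.ext fun z ↦ ?_)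
    simp only [LinearMap.comp_apply, Submodule.mkQ_apply, Submodule.liftQ_apply,
      LinearMap.mulLeft_apply, LinearMap.id_apply]
    rw [← sub_eq_zero, ← Submodule.Quotient.mk_sub, Submodule.Quotient.mk_eq_zero]
    exact ⟨-z, by simp [sub_mul]⟩

/-- An idempotent generates a point of the Grassmannian if it does so modulo a square zero
ideal. -/
theorem exists_grassmannian_eq_range [Module.Finite F A] {N : Ideal R} (hN : N ^ 2 = ⊥) {k : ℕ}
    {e : R ⊗[F] A} (he : IsIdempotentElem e) (I : Module.Grassmannian (R ⧸ N) ((R ⧸ N) ⊗[F] A) k)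
    (hI : I.toSubmodule =
      LinearMap.range (LinearMap.mulLeft (R ⧸ N) (scalarMap A (Ideal.Quotient.mkₐ F N) e))) :
    ∃ J : Module.Grassmannian R (R ⊗[F] A) k,
      J.toSubmodule = LinearMap.range (LinearMap.mulLeft R e) := by
  have := projective_quotient_range_mulLeft he
  refine ⟨⟨LinearMap.range (LinearMap.mulLeft R e), inferInstance, inferInstance, fun p ↦ ?_⟩, rfl⟩
  -- Every prime contains the nilpotent ideal `N`, so the rank may be computed after base change to
  -- `R ⧸ N`.
  obtain ⟨q, rfl⟩ : p ∈ Set.range (PrimeSpectrum.comap (algebraMap R (R ⧸ N))) := by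
    rw [range_comap_of_surjective _ (algebraMap R (R ⧸ N)) Ideal.Quotient.mk_surjective]
    intro r hr
    have hrN : r ∈ N := by simpa using hr
    refine p.2.mem_of_pow_mem 2 ?_
    have := Ideal.pow_mem_pow hrN 2
    rw [hN, Ideal.mem_bot] at this
    rw [this]
    exact zero_mem _
  have hker : LinearMap.ker (Module.Grassmannian.baseChangeMkQ (R ⧸ N)
      (LinearMap.range (LinearMap.mulLeft R e))) = I.toSubmodule := by
    rw [hI, ker_baseChangeMkQ_eq_span]
    exact span_scalarMap_range_mulLeft _ e
  rw [← Module.rankAtStalk_baseChange, ← Module.rankAtStalk_eq_of_equiv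
    (Module.Grassmannian.baseChangeMkQEquiv (LinearMap.range (LinearMap.mulLeft R e))),
    Module.rankAtStalk_eq_of_equiv (Submodule.quotEquivOfEq _ _ hker)]
  exact I.rankAtStalk_eq q

theorem grassmannian_finrank_quotient {K : Type u} [Field K] [Algebra F K] {k : ℕ}
    (I : Module.Grassmannian K (K ⊗[F] A) k) :
    Module.finrank K ((K ⊗[F] A) ⧸ I.toSubmodule) = k := by
  have := I.rankAtStalk_eq ⊥
  rwa [Module.rankAtStalk_eq_finrank_of_free] at this

theorem isRightIdeal_range_mulLeft (e : R ⊗[F] A) :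
    IsRightIdeal (LinearMap.range (LinearMap.mulLeft R e)) := by
  rintro _ ⟨z, rfl⟩ c
  exact ⟨z * c, (mul_assoc _ _ _).symm⟩

theorem range_mulLeft_one_sub_eq_ker {D : Type*} [Ring D] [Algebra R D] {g : D}
    (hg : IsIdempotentElem g) : LinearMap.range (LinearMap.mulLeft R (1 - g)) =
      LinearMap.ker (LinearMap.mulLeft R g) := by
  apply le_antisymm
  · rintro _ ⟨z, rfl⟩
    simp [← mul_assoc, mul_sub, hg.eq]
  · intro z hz
    have hz : g * z = 0 := hz
    exact ⟨z, by simp [sub_mul, hz]⟩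

end Idempotents

/-! ### Lifting points along square-zero extensions -/

section Lifting

variable {F : Type u} [Field F] {A : Type u} [Ring A] [Algebra F A]
  {R : Type u} [CommRing R] [Algebra F R]

/-- The linear map whose surjectivity onto `(g A e)²` allows to correct `g` and `e` so that
`g e = 0` and `g c e = 0`. -/
noncomputable def correctionMap (c e g : R ⊗[F] A) :
    (R ⊗[F] A) × (R ⊗[F] A) →ₗ[R] (R ⊗[F] A) × (R ⊗[F] A) :=
  let T := LinearMap.mulRight R e ∘ₗ LinearMap.mulLeft R g
  LinearMap.prod (T ∘ₗ (LinearMap.fst R _ _ - LinearMap.snd R _ _))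
    (T ∘ₗ (LinearMap.mulLeft R c ∘ₗ LinearMap.fst R _ _ -
      LinearMap.mulRight R c ∘ₗ LinearMap.snd R _ _))

theorem correctionMap_apply (c e g x y : R ⊗[F] A) :
    correctionMap c e g (x, y) = (g * (x - y) * e, g * (c * x - y * c) * e) := rfl

/-- Nakayama turns surjectivity onto `(gAe)²` at all residue fields into surjectivity over `R`.
Multiplying by `N` then shows that right-hand sides in `N` are reached with `x` and `y` in `N`. -/
theorem exists_correction_of_residue [Module.Finite F A] {c : A} {e g : R ⊗[F] A}
    (he : IsIdempotentElem e) (hg : IsIdempotentElem g)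
    (h : ∀ m : Ideal R, m.IsMaximal → ∀ p q : (R ⧸ m) ⊗[F] A, ∃ x y,
      scalarMap A (Ideal.Quotient.mkₐ F m) g * (x - y) * scalarMap A (Ideal.Quotient.mkₐ F m) e =
        scalarMap A (Ideal.Quotient.mkₐ F m) g * p * scalarMap A (Ideal.Quotient.mkₐ F m) e ∧
      scalarMap A (Ideal.Quotient.mkₐ F m) g * ((1 ⊗ₜ c) * x - y * (1 ⊗ₜ c)) *
          scalarMap A (Ideal.Quotient.mkₐ F m) e =
        scalarMap A (Ideal.Quotient.mkₐ F m) g * q * scalarMap A (Ideal.Quotient.mkₐ F m) e)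
    {N : Ideal R} {p q : R ⊗[F] A} (hp : p ∈ N • (⊤ : Submodule R (R ⊗[F] A)))
    (hq : q ∈ N • (⊤ : Submodule R (R ⊗[F] A))) :
    ∃ x ∈ N • (⊤ : Submodule R (R ⊗[F] A)), ∃ y ∈ N • (⊤ : Submodule R (R ⊗[F] A)),
      g * (x - y) * e = g * p * e ∧ g * ((1 ⊗ₜ c) * x - y * (1 ⊗ₜ c)) * e = g * q * e := by
  let T := LinearMap.mulRight R e ∘ₗ LinearMap.mulLeft R g
  let T₂ := T.prodMap T
  have hT (z z' : R ⊗[F] A) : T₂ (z, z') = (g * z * e, g * z' * e) := rfl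
  have hTT (z : R ⊗[F] A) : g * (g * z * e) * e = g * z * e := by
    rw [mul_assoc, mul_assoc, mul_assoc, he.eq, ← mul_assoc, hg.eq, ← mul_assoc]
  let Ψ := correctionMap (1 ⊗ₜ c) e g
  have hle : LinearMap.range T₂ ≤ LinearMap.range Ψ := by
    refine le_of_forall_isMaximal_le_sup_smul
      (by rw [LinearMap.range_eq_map]; exact Module.Finite.fg_top.map _) fun m hm ↦ ?_
    rintro _ ⟨⟨z, z'⟩, rfl⟩
    obtain ⟨x, y, h1, h2⟩ := h m hm (scalarMap A (Ideal.Quotient.mkₐ F m) z)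
      (scalarMap A (Ideal.Quotient.mkₐ F m) z')
    obtain ⟨x, rfl⟩ := scalarMap_mk_surjective m x
    obtain ⟨y, rfl⟩ := scalarMap_mk_surjective m y
    rw [← add_sub_cancel (Ψ (x, y)) (T₂ (z, z'))]
    refine Submodule.add_mem_sup ⟨_, rfl⟩ ?_
    -- `T₂` is a projection fixing the error term, so an error with coefficients in `m` lies in `m`
    -- times the range of `T₂`, as Nakayama requires.
    have hfix : T₂ (T₂ (z, z') - Ψ (x, y)) = T₂ (z, z') - Ψ (x, y) := by
      rw [map_sub, hT z z', show Ψ (x, y) = _ from correctionMap_apply _ _ _ _ _, hT, hT]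
      simp only [hTT]
    rw [← hfix, LinearMap.range_eq_map, ← Submodule.map_smul'']
    refine Submodule.mem_map_of_mem ?_
    rw [hT, show Ψ (x, y) = _ from correctionMap_apply _ _ _ _ _, Prod.mk_sub_mk,
      mem_smul_top_prod_iff, ← scalarMap_mk_eq_zero_iff, ← scalarMap_mk_eq_zero_iff]
    constructor
    · simp only [map_sub, map_mul] at h1 ⊢
      rw [h1, sub_self]
    · simp only [map_sub, map_mul, scalarMap_one_tmul] at h2 ⊢
      rw [h2, sub_self]
  have hmem : T₂ (p, q) ∈ (N • (⊤ : Submodule R ((R ⊗[F] A) × (R ⊗[F] A)))).map Ψ := by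
    rw [Submodule.map_smul'', ← LinearMap.range_eq_map]
    refine Submodule.smul_mono le_rfl hle ?_
    rw [LinearMap.range_eq_map, ← Submodule.map_smul'']
    exact Submodule.mem_map_of_mem ((mem_smul_top_prod_iff N p q).2 ⟨hp, hq⟩)
  obtain ⟨⟨x, y⟩, hxy, e1⟩ := hmem
  rw [SetLike.mem_coe, mem_smul_top_prod_iff] at hxy
  rw [hT, show Ψ (x, y) = _ from correctionMap_apply _ _ _ _ _, Prod.mk.injEq] at e1
  exact ⟨x, hxy.1, y, hxy.2, e1⟩

theorem mul_mul_eq_zero_of_mem_smul_top {N : Ideal R} (hN : N ^ 2 = ⊥) {x y : R ⊗[F] A}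
    (hx : x ∈ N • (⊤ : Submodule R (R ⊗[F] A))) (hy : y ∈ N • (⊤ : Submodule R (R ⊗[F] A)))
    (z : R ⊗[F] A) : x * z * y = 0 := by
  induction hx using Submodule.smul_induction_on' with
  | add x _ x' _ h h' => rw [add_mul, add_mul, h, h', add_zero]
  | smul r hr x _ =>
    induction hy using Submodule.smul_induction_on' with
    | add y _ y' _ h h' => rw [mul_add, h, h', add_zero]
    | smul s hs y _ =>
      have : r * s = 0 := by
        rw [← Ideal.mem_bot, ← hN, sq]
        exact Ideal.mul_mem_mul hr hs
      rw [smul_mul_assoc, smul_mul_smul_comm, this, zero_smul]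

/-- When `x² = 0`, this is conjugation by the unit `1 + x`. -/
theorem isIdempotentElem_conj {D : Type*} [Ring D] {e x : D} (he : IsIdempotentElem e)
    (hx : x * x = 0) : IsIdempotentElem ((1 + x) * e * (1 - x)) := by
  have h1 : (1 - x) * (1 + x) = 1 := by
    rw [sub_mul, mul_add, mul_add, hx]
    simp
  calc (1 + x) * e * (1 - x) * ((1 + x) * e * (1 - x))
      = (1 + x) * e * ((1 - x) * (1 + x)) * e * (1 - x) := by simp only [mul_assoc]
    _ = (1 + x) * (e * e) * (1 - x) := by rw [h1, mul_one]; simp only [mul_assoc]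
    _ = _ := by rw [he.eq]

theorem exists_isIdempotentElem_lift {N : Ideal R} (hN : N ^ 2 = ⊥) {e₀ : (R ⧸ N) ⊗[F] A}
    (he₀ : IsIdempotentElem e₀) :
    ∃ e, IsIdempotentElem e ∧ scalarMap A (Ideal.Quotient.mkₐ F N) e = e₀ := by
  refine exists_isIdempotentElem_eq_of_ker_isNilpotent
    (scalarMap A (Ideal.Quotient.mkₐ F N)).toRingHom (fun x hx ↦ ⟨2, ?_⟩) e₀
    (scalarMap_mk_surjective N e₀) he₀
  have hx' := (scalarMap_mk_eq_zero_iff N x).1 hx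
  simpa [sq] using mul_mul_eq_zero_of_mem_smul_top hN hx' hx' 1

/-- The ideal generated by `1 - g` is the kernel of left multiplication by `g`, so the two incidence
conditions become `ge = 0` and `gce = 0`. -/
theorem exists_sectionPoint_of_isIdempotentElem [Module.Finite F A] {n : ℕ} {c : A} {N : Ideal R}
    (hN : N ^ 2 = ⊥) (P : SectionPoint F A n c (R ⧸ N)) {e g : R ⊗[F] A} (he : IsIdempotentElem e)
    (hg : IsIdempotentElem g)
    (hI₀ : P.flag.I.toSubmodule =
      LinearMap.range (LinearMap.mulLeft (R ⧸ N) (scalarMap A (Ideal.Quotient.mkₐ F N) e)))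
    (hJ₀ : P.flag.J.toSubmodule =
      LinearMap.range (LinearMap.mulLeft (R ⧸ N) (scalarMap A (Ideal.Quotient.mkₐ F N) (1 - g))))
    (hge : g * e = 0) (hgce : g * ((1 ⊗ₜ c) * e) = 0) :
    ∃ Q : SectionPoint F A n c R, Q.map (Ideal.Quotient.mkₐ F N) = P := by
  obtain ⟨I, hI⟩ := exists_grassmannian_eq_range hN he P.flag.I.toGrassmannian hI₀
  obtain ⟨J, hJ⟩ := exists_grassmannian_eq_range hN hg.one_sub P.flag.J.toGrassmannian hJ₀
  have hmemJ {z : R ⊗[F] A} (hz : g * z = 0) : z ∈ J.toSubmodule := by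
    rw [hJ, range_mulLeft_one_sub_eq_ker hg]
    exact hz
  let Q : SectionPoint F A n c R :=
    { flag :=
        { I := ⟨I, hI ▸ isRightIdeal_range_mulLeft e⟩
          J := ⟨J, hJ ▸ isRightIdeal_range_mulLeft (1 - g)⟩
          le := by
            intro z hz
            rw [hI] at hz
            obtain ⟨z, rfl⟩ := hz
            exact hmemJ (by rw [LinearMap.mulLeft_apply, ← mul_assoc, hge, zero_mul]) }
      leftMulLE := by
        intro z hz
        rw [hI] at hz
        obtain ⟨z, rfl⟩ := hz
        exact hmemJ (by
          rw [LinearMap.mulLeft_apply, ← mul_assoc, ← mul_assoc, mul_assoc g, hgce, zero_mul]) }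
  refine ⟨Q, SectionPoint.ext_toGrassmannian (Module.Grassmannian.ext ?_)
    (Module.Grassmannian.ext ?_)⟩
  · rw [hI₀]
    exact map_eq_range_mulLeft _ hI
  · rw [hJ₀]
    exact map_eq_range_mulLeft _ hJ

variable {n : ℕ} {ζ a b : F} {u v : A}

theorem IsSymbol.exists_residue_correction (h : IsSymbol n ζ a b u v) (hζ : IsPrimitiveRoot ζ n)
    (hn : 2 ≤ n) (ha : a ≠ 0) (hb : b ≠ 0) {K : Type u} [Field K] [Algebra F K]
    (P : SectionPoint F A n u K) {e g : K ⊗[F] A} (he : IsIdempotentElem e)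
    (hg : IsIdempotentElem g)
    (hI : P.flag.I.toSubmodule = LinearMap.range (LinearMap.mulLeft K e))
    (hJ : P.flag.J.toSubmodule = LinearMap.range (LinearMap.mulLeft K (1 - g)))
    (p q : K ⊗[F] A) : ∃ x y, g * (x - y) * e = g * p * e ∧
      g * ((1 ⊗ₜ u) * x - y * (1 ⊗ₜ u)) * e = g * q * e := by
  have hn0 : n ≠ 0 := by omega
  have hK := h.baseChange K
  have hζK : IsPrimitiveRoot (algebraMap F K ζ) n := hζ.map_of_injective (algebraMap F K).injective
  have haK : algebraMap F K a ≠ 0 := by simpa using ha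
  have hbK : algebraMap F K b ≠ 0 := by simpa using hb
  have := hK.finite hn0
  have h1 := grassmannian_finrank_quotient P.flag.I.toGrassmannian
  have h2 := grassmannian_finrank_quotient P.flag.J.toGrassmannian
  rw [hI] at h1
  -- The quotient by `J = ker g` is the right ideal generated by `g`, of dimension `n * (n - (n -
  -- 1)) = n`.
  have hgrank : Module.finrank K (LinearMap.range (LinearMap.mulLeft K g)) = n := by
    rw [hJ, range_mulLeft_one_sub_eq_ker hg,
      (LinearMap.quotKerEquivRange (LinearMap.mulLeft K g)).finrank_eq] at h2
    rw [h2, Nat.sub_sub_self (by omega), mul_one]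
  have hg0 : g ≠ 0 := by
    rintro rfl
    rw [LinearMap.mulLeft_zero_eq_zero, LinearMap.range_zero, finrank_bot] at hgrank
    omega
  -- The point itself shows that the algebra is nonzero; only then is its dimension `n²`, which
  -- gives `eD` dimension `n² - n(n - 1) = n`.
  have : Nontrivial (K ⊗[F] A) := ⟨g, 0, hg0⟩
  have herank : Module.finrank K (LinearMap.range (LinearMap.mulLeft K e)) = n := by
    have h3 := Submodule.finrank_quotient_add_finrank (LinearMap.range (LinearMap.mulLeft K e))
    rw [h1, hK.finrank_eq hζK hn0 haK hbK] at h3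
    obtain ⟨m, rfl⟩ : ∃ m, n = m + 1 := ⟨n - 1, by omega⟩
    rw [Nat.add_sub_cancel, Nat.mul_add_one (m + 1) m] at h3
    omega
  have he0 : e ≠ 0 := by
    rintro rfl
    rw [LinearMap.mulLeft_zero_eq_zero, LinearMap.range_zero, finrank_bot] at herank
    omega
  have hge : g * e = 0 := by
    have : e ∈ P.flag.J.toSubmodule := P.flag.le (hI ▸ ⟨1, mul_one e⟩)
    rw [hJ, range_mulLeft_one_sub_eq_ker hg] at this
    exact this
  exact hK.surjective_of_mul_eq_zero hζK hn0 haK hbK he hg he0 hg0 herank hgrank hge p q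

/-- Points of the hyperplane section of a symbol algebra lift along square zero extensions. -/
theorem IsSymbol.exists_lift (h : IsSymbol n ζ a b u v) (hζ : IsPrimitiveRoot ζ n)
    (hn : 2 ≤ n) (ha : a ≠ 0) (hb : b ≠ 0) {N : Ideal R} (hN : N ^ 2 = ⊥)
    (P : SectionPoint F A n u (R ⧸ N)) :
    ∃ Q : SectionPoint F A n u R, Q.map (Ideal.Quotient.mkₐ F N) = P := by
  have hn0 : n ≠ 0 := by omega
  have hfin := h.finite hn0
  let π := scalarMap A (Ideal.Quotient.mkₐ F N)
  have hS := h.baseChange (R ⧸ N)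
  have hunit {r : F} (hr : r ≠ 0) : IsUnit (algebraMap F (R ⧸ N) r) := hr.isUnit.map _
  have hnN : IsUnit (n : R ⧸ N) := by
    simpa using hunit (natCast_ne_zero_of_isPrimitiveRoot hζ hn0)
  obtain ⟨e₀, he₀, hI₀⟩ := hS.exists_isIdempotentElem hnN hn0 (hunit (hζ.ne_zero hn0)) (hunit ha)
    (hunit hb) P.flag.I.isRightIdeal
  obtain ⟨f₀, hf₀, hJ₀⟩ := hS.exists_isIdempotentElem hnN hn0 (hunit (hζ.ne_zero hn0)) (hunit ha)
    (hunit hb) P.flag.J.isRightIdeal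
  obtain ⟨e, he, hπe⟩ := exists_isIdempotentElem_lift hN he₀
  -- `g` lifts the complementary idempotent, so that membership in `J` is the equation `g z = 0`.
  obtain ⟨g, hg, hπg⟩ := exists_isIdempotentElem_lift hN hf₀.one_sub
  replace hπe : π e = e₀ := hπe
  replace hπg : π g = 1 - f₀ := hπg
  have hker {x : (R ⧸ N) ⊗[F] A} (hx : x ∈ P.flag.J.toSubmodule) : π g * x = 0 := by
    rw [hJ₀] at hx
    obtain ⟨z, rfl⟩ := hx
    rw [hπg, LinearMap.mulLeft_apply, ← mul_assoc, sub_mul, one_mul, hf₀.eq, sub_self, zero_mul]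
  have he₀I : e₀ ∈ P.flag.I.toSubmodule := hI₀ ▸ ⟨1, mul_one e₀⟩
  have hge : g * e ∈ N • (⊤ : Submodule R (R ⊗[F] A)) := by
    rw [← scalarMap_mk_eq_zero_iff, map_mul, show scalarMap A _ e = e₀ from hπe]
    exact hker (P.flag.le he₀I)
  have hgue : g * (1 ⊗ₜ u) * e ∈ N • (⊤ : Submodule R (R ⊗[F] A)) := by
    rw [← scalarMap_mk_eq_zero_iff, map_mul, map_mul, show scalarMap A _ e = e₀ from hπe,
      scalarMap_one_tmul, mul_assoc]
    exact hker (P.leftMulLE _ he₀I)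
  have hres (m : Ideal R) (hm : m.IsMaximal) := by
    let _ : Field (R ⧸ m) := Ideal.Quotient.field m
    have hNm : N ≤ m := (le_jacobson_bot_of_sq_eq_bot hN).trans (sInf_le ⟨bot_le, hm⟩)
    let φ : R ⧸ N →ₐ[F] R ⧸ m := Ideal.Quotient.factorₐ F hNm
    have hφ (z : R ⊗[F] A) : scalarMap A φ (π z) = scalarMap A (Ideal.Quotient.mkₐ F m) z := by
      rw [← scalarMap_comp]
      rfl
    refine h.exists_residue_correction hζ hn ha hb (P.map φ)
      (e := scalarMap A (Ideal.Quotient.mkₐ F m) e) (g := scalarMap A (Ideal.Quotient.mkₐ F m) g)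
      (he.map _) (hg.map _) ?_ ?_
    · rw [← hφ, hπe]
      exact map_eq_range_mulLeft φ hI₀
    · rw [← hφ, hπg, map_sub, map_one, sub_sub_cancel]
      exact map_eq_range_mulLeft φ hJ₀
  obtain ⟨x, hx, y, hy, h1, h2⟩ := exists_correction_of_residue he hg hres
    (neg_mem hge) (neg_mem hgue)
  have zero {s t : R ⊗[F] A} (hs : s ∈ N • (⊤ : Submodule R (R ⊗[F] A)))
    (ht : t ∈ N • (⊤ : Submodule R (R ⊗[F] A))) (z : R ⊗[F] A) : s * z * t = 0 :=
    mul_mul_eq_zero_of_mem_smul_top hN hs ht z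
  have hπ0 {s : R ⊗[F] A} (hs : s ∈ N • (⊤ : Submodule R (R ⊗[F] A))) : π s = 0 :=
    (scalarMap_mk_eq_zero_iff N s).2 hs
  let e' := (1 + x) * e * (1 - x)
  let g' := (1 + y) * g * (1 - y)
  have he' : IsIdempotentElem e' := isIdempotentElem_conj he (by simpa using zero hx hx 1)
  have hg' : IsIdempotentElem g' := isIdempotentElem_conj hg (by simpa using zero hy hy 1)
  have hπe' : π e' = e₀ := by simp [e', hπ0 hx, hπe]
  have hπg' : π (1 - g') = f₀ := by simp [g', hπ0 hy, hπg]
  -- Expand `(1 - y) c (1 + x)`: the linear terms cancel `gce` by hypothesis, and the term `y c x`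
  -- vanishes since `N² = 0`. It is used for `c = 1` and `c = u`.
  have hmul (c : R ⊗[F] A) (hc : g * (c * x - y * c) * e = - (g * c * e)) : g' * (c * e') = 0 := by
    calc g' * (c * e') = (1 + y) * (g * c * e + g * (c * x - y * c) * e - g * (y * c * x) * e) *
          (1 - x) := by simp only [e', g']; noncomm_ring
      _ = 0 := by rw [zero hy hx, hc]; simp
  have hge' : g' * e' = 0 := by
    have := hmul 1 (by
      rw [one_mul, mul_one, mul_one, h1, mul_neg, neg_mul, ← mul_assoc, hg.eq, mul_assoc, he.eq])
    rwa [one_mul] at this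
  have hgue' : g' * ((1 ⊗ₜ u) * e') = 0 := hmul _ (by
    rw [h2, mul_neg, neg_mul, ← mul_assoc, ← mul_assoc, hg.eq, mul_assoc _ e e, he.eq])
  exact exists_sectionPoint_of_isIdempotentElem hN P he' hg' (by rw [hI₀, ← hπe'])
    (by rw [hJ₀, ← hπg']) hge' hgue'

end Lifting

end TwistedMilnor

/-! ### The main theorem -/

theorem mainTheorem8 {F : Type u} [Field F] (n : ℕ) (hn : 2 ≤ n)
    (ζ : F) (hζ : IsPrimitiveRoot ζ n) (a b : F) (ha : a ≠ 0) (hb : b ≠ 0)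
    (hL : Irreducible (Polynomial.X ^ n - Polynomial.C a)) :
    ∃ (Y : Scheme.{u}) (s : Y ⟶ Spec (.of F)),
      TwistedMilnor.Represents s
        (TwistedMilnor.hyperplaneSection F (TwistedMilnor.CyclicAlgebra n ζ a b) n
          (TwistedMilnor.cyclicU n ζ a b)) ∧
      IsSeparated s ∧ QuasiCompact s ∧ Smooth s := by
  have h := TwistedMilnor.cyclicAlgebra_isSymbol n ζ a b (hζ.ne_zero (by omega))
  have := h.finite (by omega)
  let w := Module.finBasis F (TwistedMilnor.CyclicAlgebra n ζ a b)
  let 𝒜 := TwistedMilnor.sectionAtlas n w (TwistedMilnor.cyclicU n ζ a b)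
  have hrep := 𝒜.represents (TwistedMilnor.hyperplaneSection_isZariskiSheaf _ _ _ _)
  have hsmooth : Smooth 𝒜.structureMap := 𝒜.smooth_structureMap fun i ↦
    TwistedMilnor.chartRing_smooth (fun _ _ _ _ hN p ↦ h.exists_lift hζ hn ha hb hN p) i
  exact ⟨_, 𝒜.structureMap, hrep,
    TwistedMilnor.isSeparated_of_represents _ hrep fun R K _ _ _ _ _ _ _ _ ↦
      TwistedMilnor.hyperplaneSection_map_injective R K,
    𝒜.quasiCompact_structureMap, hsmooth⟩
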